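/- Regard $S^7$ as the unit sphere in $\mathbb{H}^2=\mathbb{R}^8$, on which $Sp(2)\times Sp(1)$ acts by $(A,q)\cdot x=Axq^{-1}$, with kernel $\mathbb{Z}_2=\{\pm(1,1)\}$, and let $U(1)\subset Sp(1)$ be the group of unit complex numbers. Write $Sp(2)\cdot Sp(1)=(Sp(2)\times Sp(1))/\mathbb{Z}_2$ and $Sp(2)\cdot U(1)=(Sp(2)\times U(1))/\mathbb{Z}_2$. A smooth 3-form $\varphi$ on $S^7$ is called positive if at every point $x$ the relation $$\tfrac16\,\iota_X\varphi\wedge\iota_Y\varphi\wedge\varphi=g_\varphi(X,Y)\,\mathrm{dvol}_{g_\varphi}\qquad (X,Y\in T_xS^7)$$ holds for an inner product $g_\varphi$ on $T_xS^7$ and one of its two volume forms $\mathrm{dvol}_{g_\varphi}$ (both are then uniquely determined by $\varphi$). Let $*_\varphi$ be the Hodge star of this metric and orientation, let $\delta_\varphi=(-1)^k*_\varphi d*_\varphi$ on $k$-forms, and let $\Delta_\varphi=(d+\delta_\varphi)^2=d\delta_\varphi+\delta_\varphi d$. The $G_2$-Laplacian is the (non-linear) map $\varphi\mapsto\Delta_\varphi\varphi$.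 **Theorem.** Let $\mathcal{P}$ be the space of $Sp(2)\cdot U(1)$-invariant positive 3-forms on $S^7$, with its topology as a subset of the finite-dimensional vector space of invariant 3-forms. There is an open set $U\subseteq\mathcal{P}$ that contains all $Sp(2)\cdot Sp(1)$-invariant positive 3-forms and on which the $G_2$-Laplacian $\varphi\mapsto\Delta_\varphi\varphi$ is a bijection onto its image. -/

import Mathlib

open scoped Quaternion ContDiff Topology InnerProductSpace

noncomputable section

namespace G2Sphere

/-! ### Multilinear algebra on a 7-dimensional real vector space -/

section LinearAlgebra

variable {V : Type*} [NormedAddCommGroup V] [NormedSpace ℝ V]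

/-- The wedge product of alternating forms, normalised so that
`(α ∧ β)(v) = α v₁ β v₂ - α v₂ β v₁` for 1-forms (sum over shuffles). -/
def wedge {k l : ℕ} (α : V [⋀^Fin k]→ₗ[ℝ] ℝ) (β : V [⋀^Fin l]→ₗ[ℝ] ℝ) :
    V [⋀^Fin (k + l)]→ₗ[ℝ] ℝ :=
  ((LinearMap.mul' ℝ ℝ).compAlternatingMap (α.domCoprod β)).domDomCongr finSumFinEquiv

/-- The 7-form `(1/6) ι_X φ ∧ ι_Y φ ∧ φ` associated with a 3-form `φ` and vectors `X`, `Y`. -/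
def bryantForm (φ : V [⋀^Fin 3]→L[ℝ] ℝ) (X Y : V) : V [⋀^Fin 7]→ₗ[ℝ] ℝ :=
  (1 / 6 : ℝ) • wedge (wedge (φ.toAlternatingMap.curryLeft X) (φ.toAlternatingMap.curryLeft Y))
    φ.toAlternatingMap

/-- `b` is an oriented orthonormal frame for the metric and orientation determined by the 3-form
`φ`. With `e¹, …, e⁷` the dual basis of `b`, the relation
`(1/6) ι_X φ ∧ ι_Y φ ∧ φ = g(X, Y) dvol` is required for the inner product
`g = ∑ᵢ eⁱ ⊗ eⁱ` and its volume form `dvol = e¹ ∧ ⋯ ∧ e⁷`, which is `b.det`.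
(A pair of an inner product and one of its two volume forms is the same thing as a basis
up to `SO(7)`.) -/
def IsG2Frame (φ : V [⋀^Fin 3]→L[ℝ] ℝ) (b : Module.Basis (Fin 7) ℝ V) : Prop :=
  ∀ X Y : V, bryantForm φ X Y = (∑ i, b.repr X i * b.repr Y i) • b.det

/-- A 3-form on a 7-dimensional vector space is positive if the symmetric bilinear form `g`
determined by `(1/6) ι_X φ ∧ ι_Y φ ∧ φ = g(X, Y) dvol_g` is positive definite. -/
def IsPositiveForm (φ : V [⋀^Fin 3]→L[ℝ] ℝ) : Prop :=
  ∃ b : Module.Basis (Fin 7) ℝ V, IsG2Frame φ b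

theorem continuous_basis_det (b : Module.Basis (Fin 7) ℝ V) :
    Continuous fun v : Fin 7 → V => b.det v := by
  have : FiniteDimensional ℝ V := b.finiteDimensional_of_finite
  simp only [Module.Basis.det_apply]
  refine Continuous.matrix_det (continuous_matrix fun i j => ?_)
  exact (LinearMap.continuous_of_finiteDimensional (b.coord i)).comp (continuous_apply j)

/-- The vectors `u₁, …, u_k, w₁, …, w_l` as a single family of `k + l = 7` vectors. -/
def joinVectors {W : Type*} {k l : ℕ} (h : k + l = 7) (u : Fin k → W) (w : Fin l → W) : Fin 7 → W :=
  fun j => Fin.append u w (Fin.cast h.symm j)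

theorem joinVectors_update {W : Type*} {k l : ℕ} (h : k + l = 7) (u : Fin k → W) (w : Fin l → W)
    (i : Fin l) (x : W) :
    joinVectors h u (Function.update w i x) =
      Function.update (joinVectors h u w) (Fin.cast h (Fin.natAdd k i)) x := by
  funext j
  unfold joinVectors
  obtain ⟨j, rfl⟩ : ∃ j', j = Fin.cast h j' := ⟨Fin.cast h.symm j, by simp⟩
  refine Fin.addCases (fun a => ?_) (fun a => ?_) j
  · have : Fin.cast h (Fin.castAdd l a) ≠ Fin.cast h (Fin.natAdd k i) := by
      intro hh
      have := congrArg Fin.val hh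
      simp at this
      omega
    simp [Function.update_of_ne this]
  · by_cases hai : a = i
    · subst hai; simp
    · have : Fin.cast h (Fin.natAdd k a) ≠ Fin.cast h (Fin.natAdd k i) := by
        intro hh
        have := congrArg Fin.val hh
        simp at this
        omega
      simp [Function.update_of_ne this, Function.update_of_ne hai]

/-- The Hodge star on `k`-forms, for the metric and orientation in which `b` is an oriented
orthonormal basis:
`(⋆β)(w₁, …, w_l) = (1/k!) ∑ β(b_{i₁}, …, b_{i_k}) dvol(b_{i₁}, …, b_{i_k}, w₁, …, w_l)`,
i.e. `⋆ e^I = ± e^J` with `e^I ∧ ⋆ e^I = dvol`. -/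
def hodgeStar (b : Module.Basis (Fin 7) ℝ V) {k l : ℕ} (h : k + l = 7)
    (β : V [⋀^Fin k]→L[ℝ] ℝ) : V [⋀^Fin l]→L[ℝ] ℝ where
  toFun w := (1 / (k.factorial : ℝ)) *
    ∑ i : Fin k → Fin 7, β (fun a => b (i a)) * b.det (joinVectors h (fun a => b (i a)) w)
  map_update_add' {inst} w i x y := by
    rw [Subsingleton.elim inst (instDecidableEqFin l)]
    simp only [joinVectors_update, AlternatingMap.map_update_add, mul_add, Finset.sum_add_distrib]
  map_update_smul' {inst} w i c x := by
    rw [Subsingleton.elim inst (instDecidableEqFin l)]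
    simp only [joinVectors_update, AlternatingMap.map_update_smul, smul_eq_mul, Finset.mul_sum]
    exact Finset.sum_congr rfl fun _ _ => by ring
  map_eq_zero_of_eq' w i j hw hij := by
    rw [Finset.sum_eq_zero, mul_zero]
    intro s _
    rw [b.det.map_eq_zero_of_eq _ (i := Fin.cast h (Fin.natAdd k i))
      (j := Fin.cast h (Fin.natAdd k j)), mul_zero]
    · simp [joinVectors, hw]
    · intro hh
      have := congrArg Fin.val hh
      simp at this
      omega
  cont := by
    refine continuous_const.mul (continuous_finsetSum _ fun s _ => continuous_const.mul ?_)
    refine (continuous_basis_det b).comp (continuous_pi fun j => ?_)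
    unfold joinVectors
    obtain ⟨j, rfl⟩ : ∃ j', j = Fin.cast h j' := ⟨Fin.cast h.symm j, by simp⟩
    refine Fin.addCases (fun a => ?_) (fun a => ?_) j
    · simpa using continuous_const
    · simpa using continuous_apply a

open Classical in
/-- The Hodge star `⋆_φ` of the metric and orientation of a positive 3-form `φ` (it does not
depend on the choice of the frame; if `φ` is not positive, the value is `0`). -/
def g2Star (φ : V [⋀^Fin 3]→L[ℝ] ℝ) {k l : ℕ} (h : k + l = 7) (β : V [⋀^Fin k]→L[ℝ] ℝ) :
    V [⋀^Fin l]→L[ℝ] ℝ :=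
  if hφ : IsPositiveForm φ then hodgeStar hφ.choose h β else 0

end LinearAlgebra

/-! ### Differential forms on the 7-sphere -/

/-- `ℍ²` with its Euclidean norm. -/
abbrev H2 : Type := PiLp 2 fun _ : Fin 2 => ℍ[ℝ]

/-- The unit sphere `S⁷ ⊆ ℍ² = ℝ⁸`. -/
abbrev S7 : Type := Metric.sphere (0 : H2) 1

/-- The tangent space `T_x S⁷ = x^⊥`. -/
abbrev TS (x : S7) : Submodule ℝ H2 := (ℝ ∙ (x : H2))ᗮ

/-- Differential `k`-forms on `S⁷` (no regularity), with the topology of pointwise convergence. -/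
abbrev SForm (k : ℕ) : Type := ∀ x : S7, TS x [⋀^Fin k]→L[ℝ] ℝ

/-- The radial retraction `r : ℍ² ∖ {0} → S⁷`, `r(y) = y / ‖y‖`. -/
def radial (y : H2) (hy : y ≠ 0) : S7 :=
  ⟨‖y‖⁻¹ • y, by
    rw [mem_sphere_zero_iff_norm, norm_smul, norm_inv, norm_norm,
      inv_mul_cancel₀ (norm_ne_zero_iff.mpr hy)]⟩

/-- The derivative of the radial retraction at `y`: `1 / ‖y‖` times the orthogonal projection
onto `T_{r(y)} S⁷ = y^⊥`. -/
def radialDeriv (y : H2) (hy : y ≠ 0) : H2 →L[ℝ] TS (radial y hy) :=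
  ‖y‖⁻¹ • (TS (radial y hy)).orthogonalProjectionOnto

namespace SForm

open Classical in
/-- The pullback `r^* η` of a form on `S⁷` to `ℍ² ∖ {0}` (with the value `0` at the origin). -/
def pullRadial {k : ℕ} (η : SForm k) (y : H2) : H2 [⋀^Fin k]→L[ℝ] ℝ :=
  if hy : y ≠ 0 then (η (radial y hy)).compContinuousLinearMap (radialDeriv y hy) else 0

/-- A form `η` on `S⁷` is smooth iff `r^* η` is smooth on `ℍ² ∖ {0}`. -/
def IsSmooth {k : ℕ} (η : SForm k) : Prop := ContDiffOn ℝ ∞ η.pullRadial {0}ᶜ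

/-- The exterior derivative on `S⁷`: `dη = ι^* d(r^* η)`, where `ι : S⁷ → ℍ²` is the inclusion
and the second `d` is the exterior derivative on `ℍ² = ℝ⁸`. -/
def d {k : ℕ} (η : SForm k) : SForm (k + 1) := fun x =>
  (extDeriv η.pullRadial (x : H2)).compContinuousLinearMap (TS x).subtypeL

/-- A 3-form on `S⁷` is positive if it is positive at every point. -/
def IsPositive (φ : SForm 3) : Prop := ∀ x, IsPositiveForm (φ x)

/-- The Hodge star `⋆_φ` of a 3-form `φ` on `S⁷`, applied pointwise. -/
def star (φ : SForm 3) {k l : ℕ} (h : k + l = 7) (η : SForm k) : SForm l := fun x =>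
  g2Star (φ x) h (η x)

/-- The codifferential `δ_φ = (-1)^m ⋆_φ d ⋆_φ` on `m`-forms, where `m = k + 1`. -/
def codiff (φ : SForm 3) {k l : ℕ} (h : k + 1 + l = 7) (η : SForm (k + 1)) : SForm k :=
  (-1 : ℝ) ^ (k + 1) • star φ (by omega : l + 1 + k = 7) (d (star φ h η))

/-- The Hodge Laplacian `Δ_φ = (d + δ_φ)² = d δ_φ + δ_φ d` on 3-forms. -/
def hodgeLaplacian (φ η : SForm 3) : SForm 3 :=
  d (codiff (k := 2) (l := 4) φ rfl η) + codiff (k := 3) (l := 3) φ rfl (d η)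

/-- The `G₂`-Laplacian `φ ↦ Δ_φ φ`. -/
def g2Laplacian (φ : SForm 3) : SForm 3 := hodgeLaplacian φ φ

end SForm

/-! ### Symmetry groups -/

/-- The action of an orthogonal map on `S⁷`. -/
def sphereMap (g : H2 ≃ₗᵢ[ℝ] H2) (x : S7) : S7 :=
  ⟨g x, by rw [mem_sphere_zero_iff_norm, g.norm_map]; exact mem_sphere_zero_iff_norm.mp x.2⟩

/-- The differential `T_x S⁷ → T_{gx} S⁷` of the action of an orthogonal map `g`. -/
def tangentMap (g : H2 ≃ₗᵢ[ℝ] H2) (x : S7) : TS x →L[ℝ] TS (sphereMap g x) :=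
  ((g.toContinuousLinearEquiv : H2 →L[ℝ] H2).comp (TS x).subtypeL).codRestrict _ fun v => by
    rw [Submodule.mem_orthogonal_singleton_iff_inner_right]
    have hv := (Submodule.mem_orthogonal_singleton_iff_inner_right).mp v.2
    simpa [sphereMap] using hv

/-- A form on `S⁷` is `G`-invariant if `g^* η = η` for every `g ∈ G`. -/
def SForm.IsInvariant {k : ℕ} (G : Subgroup (H2 ≃ₗᵢ[ℝ] H2)) (η : SForm k) : Prop :=
  ∀ g ∈ G, ∀ x, (η (sphereMap g x)).compContinuousLinearMap (tangentMap g x) = η x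

/-- `Sp(2)`: the quaternionic `2 × 2` matrices `A` with `A^* A = A A^* = 1`. -/
abbrev Sp2 : Type := unitary (Matrix (Fin 2) (Fin 2) ℍ[ℝ])

/-- `Sp(1)`: the unit quaternions. -/
abbrev Sp1 : Type := unitary ℍ[ℝ]

/-- `U(1) ⊆ Sp(1)`: the unit complex numbers `a + b i`. -/
def U1 : Subgroup Sp1 where
  carrier := {q | (q : ℍ[ℝ]).imJ = 0 ∧ (q : ℍ[ℝ]).imK = 0}
  mul_mem' := by
    rintro p q ⟨hp, hp'⟩ ⟨hq, hq'⟩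
    simp [hp, hp', hq, hq']
  one_mem' := by simp
  inv_mem' := by
    rintro q ⟨hq, hq'⟩
    have h : ((q⁻¹ : Sp1) : ℍ[ℝ]) = star (q : ℍ[ℝ]) := rfl
    simp [h, hq, hq']

open scoped Matrix in
/-- The real linear map `x ↦ A x q^*` of the space `ℍ²` of column vectors. -/
def quatLinear (A : Matrix (Fin 2) (Fin 2) ℍ[ℝ]) (q : ℍ[ℝ]) : H2 →ₗ[ℝ] H2 where
  toFun x := WithLp.toLp 2 fun i => (A *ᵥ x.ofLp) i * star q
  map_add' x y := by
    ext i : 1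
    simp [Matrix.mulVec_add, add_mul]
  map_smul' c x := by
    ext i : 1
    simp [Matrix.mulVec_smul]

theorem quatLinear_mul (A B : Matrix (Fin 2) (Fin 2) ℍ[ℝ]) (p q : ℍ[ℝ]) (x : H2) :
    quatLinear (A * B) (p * q) x = quatLinear A p (quatLinear B q x) := by
  ext i : 1
  simp only [quatLinear, LinearMap.coe_mk, AddHom.coe_mk, ← Matrix.mulVec_mulVec, star_mul]
  simp only [Matrix.mulVec, dotProduct, Finset.sum_mul, mul_assoc]

theorem quatLinear_one (x : H2) : quatLinear 1 1 x = x := by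
  ext i : 1
  simp [quatLinear]

theorem norm_quatLinear (A : Sp2) (q : Sp1) (x : H2) : ‖quatLinear A q x‖ = ‖x‖ := by
  have key (v : Fin 2 → ℍ[ℝ]) :
      ((∑ i, ‖v i‖ ^ 2 : ℝ) : ℍ[ℝ]) = star v ⬝ᵥ v := by
    simp [dotProduct, Quaternion.normSq_eq_norm_mul_self, Quaternion.star_mul_self, pow_two]
  have hq : ‖(star (q : ℍ[ℝ]))‖ = 1 := by
    rw [norm_star]
    exact CStarRing.norm_coe_unitary q
  rw [PiLp.norm_eq_of_L2, PiLp.norm_eq_of_L2]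
  congr 1
  have h1 : ∀ i, ‖quatLinear A q x i‖ = ‖((A : Matrix (Fin 2) (Fin 2) ℍ[ℝ]).mulVec x.ofLp) i‖ :=
    fun i => by simp only [quatLinear, LinearMap.coe_mk, AddHom.coe_mk, norm_mul, hq, mul_one]
  simp only [h1]
  apply Quaternion.coe_injective
  rw [key, key, Matrix.star_mulVec, Matrix.dotProduct_mulVec, Matrix.vecMul_vecMul,
    ← Matrix.star_eq_conjTranspose, Unitary.coe_star_mul_self, Matrix.vecMul_one]

/-- The orthogonal map `x ↦ A x q⁻¹` of `ℍ²`, for `A ∈ Sp(2)` and `q ∈ Sp(1)`. -/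
def quatIsometry (A : Sp2) (q : Sp1) : H2 ≃ₗᵢ[ℝ] H2 where
  toLinearEquiv := LinearEquiv.ofLinearMap (quatLinear A q)
    (quatLinear (star (A : Matrix (Fin 2) (Fin 2) ℍ[ℝ])) (star (q : ℍ[ℝ])))
    (by
      ext1 x
      rw [LinearMap.comp_apply, ← quatLinear_mul,
        Unitary.mul_star_self_of_mem A.2, Unitary.mul_star_self_of_mem q.2]
      exact quatLinear_one x)
    (by
      ext1 x
      rw [LinearMap.comp_apply, ← quatLinear_mul,
        Unitary.star_mul_self_of_mem A.2, Unitary.star_mul_self_of_mem q.2]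
      exact quatLinear_one x)
  norm_map' := norm_quatLinear A q

/-- The action `(A, q) ↦ (x ↦ A x q⁻¹)` of `Sp(2) × Sp(1)` on `ℍ²` by orthogonal maps; its kernel
is `{(1, 1), (-1, -1)} = ℤ₂`. -/
def quatAction : Sp2 × Sp1 →* (H2 ≃ₗᵢ[ℝ] H2) where
  toFun g := quatIsometry g.1 g.2
  map_one' := LinearIsometryEquiv.ext fun x => quatLinear_one x
  map_mul' _ _ := LinearIsometryEquiv.ext fun x => quatLinear_mul _ _ _ _ x

/-- The group `Sp(2)·Sp(1) = (Sp(2) × Sp(1)) / ℤ₂`, as a group of orthogonal maps of `ℍ²`. -/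
def Sp2Sp1 : Subgroup (H2 ≃ₗᵢ[ℝ] H2) := quatAction.range

/-- The group `Sp(2)·U(1) = (Sp(2) × U(1)) / ℤ₂`, as a group of orthogonal maps of `ℍ²`. -/
def Sp2U1 : Subgroup (H2 ≃ₗᵢ[ℝ] H2) := ((⊤ : Subgroup Sp2).prod U1).map quatAction

/-- The set of `G`-invariant positive (smooth) 3-forms on `S⁷`. -/
def invariantPositiveForms (G : Subgroup (H2 ≃ₗᵢ[ℝ] H2)) : Set (SForm 3) :=
  {φ | φ.IsSmooth ∧ φ.IsInvariant G ∧ φ.IsPositive}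

end G2Sphere

end

open G2Sphere

namespace G2Sphere

/-! ### Independence of the frame, and naturality of the metric and the Hodge star -/

section Frames

open Module

variable {V W : Type*} [NormedAddCommGroup V] [NormedSpace ℝ V] [NormedAddCommGroup W]
  [NormedSpace ℝ W]

/-! The content is injectivity. Already `Sp(2)` is transitive on the sphere, so an invariant form is
determined by its value at `basePoint`, where the tangent space is `Im ℍ ⊕ ℍ`. Finitely many
isotropy elements, acting as signed permutations of a frame, leave four free components of a 3-form
(`SForm.eq_basePoint`): `a` on the three vertical vectors, `b` for the first vertical direction, and
a pair `c`, `e` for the other two. The problem becomes one about a map between open parts of `ℝ⁴`.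

Positivity forces the metric `diag(p², q², q², R, R, R, R)` and, up to a common sign `s`, `a = p
q²`, `b = p R`, while `c² + e² = q² R²` (`exists_hasMetric`). So `(p, q, R, e)` are coordinates on
the region where `s c > 0`. The exterior derivative of an invariant form at the base point is
algebraic (`SForm.d_basePoint`), and the Laplacian splits: on `(a, b, c)` it is the square of the
linear map `starDeriv`, and `e` is multiplied by `8 (2 q² / R² + 1 / q²)`
(`HasMetric.comp_g2Laplacian`). In the parameters this is `laplaceMap`.

The `Sp(2)·Sp(1)`-invariant forms lie on the surface `p = q`, `e = 0`. There the differential of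
`laplaceMap` is injective (`laplaceMap_linearization`), so `laplaceMap` is locally injective. On the
surface itself it is an embedding: with `t = p² / R`, a ratio of two components is a strictly
increasing function of `t`, and `p` is then read off from one component (`comap_laplaceMap_le`).
These two facts give injectivity on a neighbourhood of the whole surface (`exists_isOpen_injOn`).

The sign `s` gives two sheets, exchanged by `φ ↦ -φ`. The parameter domain is chosen so that the
first component of the Laplacian has sign `s` (`laplaceMap_fst_pos`), hence forms on different
sheets have different Laplacians. -/

theorem sum_multilinear_eq_of_orthogonal {k : ℕ} {b b' : Basis (Fin 7) ℝ V}
    (hG : ∀ X Y, ∑ i, b.repr X i * b.repr Y i = ∑ i, b'.repr X i * b'.repr Y i)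
    (f g : MultilinearMap ℝ (fun _ : Fin k => V) ℝ) :
    ∑ i : Fin k → Fin 7, f (fun a => b (i a)) * g (fun a => b (i a)) =
      ∑ i : Fin k → Fin 7, f (fun a => b' (i a)) * g (fun a => b' (i a)) := by
  set M : Matrix (Fin 7) (Fin 7) ℝ := Matrix.of fun i j => b'.repr (b i) j with hM
  have hMMT : M * M.transpose = 1 := by
    ext i j
    have := hG (b i) (b j)
    simp only [Basis.repr_self] at this
    simp only [Matrix.mul_apply, Matrix.transpose_apply, hM, Matrix.of_apply]
    rw [← this]
    simp [Finsupp.single_apply, Matrix.one_apply]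
  -- The hypothesis gives orthonormal rows; the sum over `i` below needs orthonormal columns.
  have hMTM : M.transpose * M = 1 := mul_eq_one_comm.mp hMMT
  have expand (f : MultilinearMap ℝ (fun _ : Fin k => V) ℝ) (i : Fin k → Fin 7) :
      f (fun a => b (i a)) =
        ∑ j : Fin k → Fin 7, (∏ a, M (i a) (j a)) * f (fun a => b' (j a)) := by
    have h : (fun a => b (i a)) = fun a => ∑ j, M (i a) j • b' j := by
      funext a
      exact (b'.sum_repr (b (i a))).symm
    rw [h, f.map_sum]
    refine Finset.sum_congr rfl fun j _ => ?_
    rw [f.map_smul_univ]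
    rfl
  simp only [expand f, expand g, Finset.sum_mul_sum]
  rw [Finset.sum_comm]
  refine Finset.sum_congr rfl fun j _ => ?_
  rw [Finset.sum_comm]
  have key (l : Fin k → Fin 7) :
      ∑ i : Fin k → Fin 7, (∏ a, M (i a) (j a)) * f (fun a => b' (j a)) *
        ((∏ a, M (i a) (l a)) * g (fun a => b' (l a))) =
      if l = j then f (fun a => b' (j a)) * g (fun a => b' (j a)) else 0 := by
    have h1 : ∑ i : Fin k → Fin 7, ∏ a, (M (i a) (j a) * M (i a) (l a)) =
        ∏ a, ∑ x, M x (j a) * M x (l a) := by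
      rw [Finset.prod_univ_sum, Fintype.piFinset_univ]
    have h2 (a : Fin k) : ∑ x, M x (j a) * M x (l a) = if j a = l a then 1 else 0 := by
      have := congrFun (congrFun hMTM (j a)) (l a)
      simpa [Matrix.mul_apply, Matrix.one_apply] using this
    have h3 : ∑ i : Fin k → Fin 7, ∏ a, (M (i a) (j a) * M (i a) (l a)) =
        if l = j then 1 else 0 := by
      rw [h1]
      simp only [h2]
      split_ifs with h
      · simp [h]
      · obtain ⟨a, ha⟩ := Function.ne_iff.mp h
        exact Finset.prod_eq_zero (Finset.mem_univ a) (if_neg fun h => ha h.symm)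
    calc _ = (∑ i : Fin k → Fin 7, ∏ a, (M (i a) (j a) * M (i a) (l a))) *
          (f (fun a => b' (j a)) * g (fun a => b' (l a))) := by
          rw [Finset.sum_mul]
          refine Finset.sum_congr rfl fun i _ => ?_
          rw [Finset.prod_mul_distrib]; ring
      _ = _ := by
          rw [h3]
          split_ifs with h
          · rw [h, one_mul]
          · rw [zero_mul]
  simp only [key]
  simp

theorem joinVectors_update_left {W : Type*} {k l : ℕ} (h : k + l = 7) (u : Fin k → W)
    (w : Fin l → W) (i : Fin k) (x : W) :
    joinVectors h (Function.update u i x) w =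
      Function.update (joinVectors h u w) (Fin.cast h (Fin.castAdd l i)) x := by
  funext j
  unfold joinVectors
  obtain ⟨j, rfl⟩ : ∃ j', j = Fin.cast h j' := ⟨Fin.cast h.symm j, by simp⟩
  refine Fin.addCases (fun a => ?_) (fun a => ?_) j
  · by_cases hai : a = i
    · subst hai; simp
    · have : Fin.cast h (Fin.castAdd l a) ≠ Fin.cast h (Fin.castAdd l i) := by
        intro hh
        have := congrArg Fin.val hh
        simp at this
        omega
      simp [Function.update_of_ne this, Function.update_of_ne hai]
  · have : Fin.cast h (Fin.natAdd k a) ≠ Fin.cast h (Fin.castAdd l i) := by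
      intro hh
      have := congrArg Fin.val hh
      simp at this
      omega
    simp [Function.update_of_ne this]

/-- A 7-form as an alternating map of its first `k` arguments. -/
def joinLeft {k l : ℕ} (h : k + l = 7) (f : V [⋀^Fin 7]→ₗ[ℝ] ℝ) (w : Fin l → V) :
    V [⋀^Fin k]→ₗ[ℝ] ℝ where
  toFun u := f (joinVectors h u w)
  map_update_add' {inst} u i x y := by
    rw [Subsingleton.elim inst (instDecidableEqFin k)]
    simp only [joinVectors_update_left, AlternatingMap.map_update_add]
  map_update_smul' {inst} u i c x := by
    rw [Subsingleton.elim inst (instDecidableEqFin k)]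
    simp only [joinVectors_update_left, AlternatingMap.map_update_smul]
  map_eq_zero_of_eq' u i j hu hij := by
    refine f.map_eq_zero_of_eq _ (i := Fin.cast h (Fin.castAdd l i))
      (j := Fin.cast h (Fin.castAdd l j)) (by simp [joinVectors, hu]) fun hh => hij ?_
    have := congrArg Fin.val hh
    simp at this
    omega

theorem joinLeft_apply {k l : ℕ} (h : k + l = 7) (f : V [⋀^Fin 7]→ₗ[ℝ] ℝ) (w : Fin l → V)
    (u : Fin k → V) : joinLeft h f w u = f (joinVectors h u w) := rfl

theorem hodgeStar_apply (b : Basis (Fin 7) ℝ V) {k l : ℕ} (h : k + l = 7)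
    (β : V [⋀^Fin k]→L[ℝ] ℝ) (w : Fin l → V) :
    hodgeStar b h β w = (1 / (k.factorial : ℝ)) *
      ∑ i : Fin k → Fin 7, β (fun a => b (i a)) * b.det (joinVectors h (fun a => b (i a)) w) :=
  rfl

theorem hodgeStar_congr {b b' : Basis (Fin 7) ℝ V}
    (hG : ∀ X Y, ∑ i, b.repr X i * b.repr Y i = ∑ i, b'.repr X i * b'.repr Y i)
    (hdet : b.det = b'.det) {k l : ℕ} (h : k + l = 7) (β : V [⋀^Fin k]→L[ℝ] ℝ) :
    hodgeStar b h β = hodgeStar b' h β := by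
  ext w
  simp only [hodgeStar_apply]
  congr 1
  have := sum_multilinear_eq_of_orthogonal hG β.toMultilinearMap
    (joinLeft h b.det w).toMultilinearMap
  rw [hdet] at this ⊢
  exact this

/-- Comparing the two frame relations, the metrics differ by the factor `D = b.det b'`. Taking
determinants then forces `D = 1`, orientation included. -/
theorem IsG2Frame.unique {φ : V [⋀^Fin 3]→L[ℝ] ℝ} {b b' : Basis (Fin 7) ℝ V}
    (hb : IsG2Frame φ b) (hb' : IsG2Frame φ b') :
    (∀ X Y, ∑ i, b.repr X i * b.repr Y i = ∑ i, b'.repr X i * b'.repr Y i) ∧ b.det = b'.det := by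
  have hd : b.det = b.det b' • b'.det := AlternatingMap.eq_smul_basis_det b' b.det
  have h1 : ∀ X Y, (∑ i, b.repr X i * b.repr Y i) * b.det b' = ∑ i, b'.repr X i * b'.repr Y i := by
    intro X Y
    have := congrArg (fun f => f b') ((hb X Y).symm.trans (hb' X Y))
    simpa [b'.det_self] using this
  have hD : b.det b' = 1 := by
    have h2 : b.det b' • ((b.toMatrix b').transpose * b.toMatrix b') = 1 := by
      ext i j
      have := h1 (b' i) (b' j)
      rw [Matrix.smul_apply, Matrix.mul_apply, smul_eq_mul, mul_comm]
      simp only [Matrix.transpose_apply, Basis.toMatrix_apply]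
      rw [this]
      simp [Finsupp.single_apply, Matrix.one_apply]
    have h3 := congrArg Matrix.det h2
    rw [Matrix.det_smul, Matrix.det_mul, Matrix.det_transpose, Matrix.det_one, ← b.det_apply] at h3
    simp only [Fintype.card_fin] at h3
    -- Seven factors come from scaling a `7 × 7` matrix and two from the Gram determinant; the
    -- exponent is odd, so the sign of the determinant is determined too.
    have h4 : (b.det b') ^ 9 = 1 := by rw [← h3]; ring
    exact (Odd.strictMono_pow (by decide : Odd 9)).injective (by simpa using h4)
  rw [hD] at h1 hd
  exact ⟨fun X Y => by rw [← h1, mul_one], by simpa using hd⟩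

theorem g2Star_eq {φ : V [⋀^Fin 3]→L[ℝ] ℝ} {b : Basis (Fin 7) ℝ V} (hb : IsG2Frame φ b)
    {k l : ℕ} (h : k + l = 7) (β : V [⋀^Fin k]→L[ℝ] ℝ) :
    g2Star φ h β = hodgeStar b h β := by
  have hφ : IsPositiveForm φ := ⟨b, hb⟩
  rw [g2Star, dif_pos hφ]
  have := hφ.choose_spec.unique hb
  exact hodgeStar_congr this.1 this.2 h β

theorem wedge_compLinearMap {k l : ℕ} (α : W [⋀^Fin k]→ₗ[ℝ] ℝ) (β : W [⋀^Fin l]→ₗ[ℝ] ℝ)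
    (L : V →ₗ[ℝ] W) :
    wedge (α.compLinearMap L) (β.compLinearMap L) = (wedge α β).compLinearMap L := by
  ext v
  simp only [wedge, AlternatingMap.domDomCongr_apply, LinearMap.compAlternatingMap_apply,
    AlternatingMap.compLinearMap_apply, AlternatingMap.domCoprod_apply, sum_apply]
  congr 1
  refine Finset.sum_congr rfl fun σ _ => ?_
  induction σ using Quotient.inductionOn'
  simp [AlternatingMap.domCoprod.summand_mk'', MultilinearMap.domCoprod_apply]

theorem bryantForm_comp (φ : W [⋀^Fin 3]→L[ℝ] ℝ) (L : V →L[ℝ] W) (X Y : V) :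
    bryantForm (φ.compContinuousLinearMap L) X Y =
      (bryantForm φ (L X) (L Y)).compLinearMap L.toLinearMap := by
  have h (X : V) : (φ.compContinuousLinearMap L).toAlternatingMap.curryLeft X =
      (φ.toAlternatingMap.curryLeft (L X)).compLinearMap L.toLinearMap := by
    ext v
    simp only [AlternatingMap.curryLeft_apply_apply, AlternatingMap.compLinearMap_apply]
    change φ (L ∘ _) = φ _
    congr 1
    funext i
    refine Fin.cases ?_ (fun i => ?_) i <;> simp
  have h' : (φ.compContinuousLinearMap L).toAlternatingMap =
      φ.toAlternatingMap.compLinearMap L.toLinearMap := rfl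
  unfold bryantForm
  rw [h, h, h', wedge_compLinearMap, wedge_compLinearMap]
  ext v
  simp only [AlternatingMap.smul_apply, AlternatingMap.compLinearMap_apply]

theorem IsG2Frame.map {φ : W [⋀^Fin 3]→L[ℝ] ℝ} (L : V ≃L[ℝ] W) {b : Basis (Fin 7) ℝ V}
    (hb : IsG2Frame (φ.compContinuousLinearMap (L : V →L[ℝ] W)) b) :
    IsG2Frame φ (b.map L.toLinearEquiv) := by
  intro X Y
  have h := hb (L.symm X) (L.symm Y)
  rw [bryantForm_comp] at h
  ext v
  have h2 := congrArg (fun f => f (L.symm ∘ v)) h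
  simp only [AlternatingMap.compLinearMap_apply, AlternatingMap.smul_apply] at h2
  have e1 : (fun i => (L : V →L[ℝ] W).toLinearMap ((L.symm ∘ v) i)) = v := by funext i; simp
  rw [e1] at h2
  simpa [Basis.det_map] using h2

theorem hodgeStar_map (L : V ≃L[ℝ] W) (b : Basis (Fin 7) ℝ V) {k l : ℕ} (h : k + l = 7)
    (β : W [⋀^Fin k]→L[ℝ] ℝ) :
    (hodgeStar (b.map L.toLinearEquiv) h β).compContinuousLinearMap (L : V →L[ℝ] W) =
      hodgeStar b h (β.compContinuousLinearMap (L : V →L[ℝ] W)) := by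
  ext w
  simp only [ContinuousAlternatingMap.compContinuousLinearMap_apply, hodgeStar_apply]
  congr 1
  refine Finset.sum_congr rfl fun i _ => ?_
  rw [Basis.det_map]
  congr 1
  congr 1
  funext j
  simp only [Function.comp_apply, joinVectors, Basis.map_apply]
  refine Fin.addCases (fun a => ?_) (fun a => ?_) (Fin.cast h.symm j) <;> simp

theorem isPositiveForm_comp_iff (φ : W [⋀^Fin 3]→L[ℝ] ℝ) (L : V ≃L[ℝ] W) :
    IsPositiveForm (φ.compContinuousLinearMap (L : V →L[ℝ] W)) ↔ IsPositiveForm φ := by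
  constructor
  · rintro ⟨b, hb⟩
    exact ⟨_, hb.map L⟩
  · rintro ⟨b, hb⟩
    have : φ = (φ.compContinuousLinearMap (L : V →L[ℝ] W)).compContinuousLinearMap
        (L.symm : W →L[ℝ] V) := by
      ext v
      simp [Function.comp_def]
    rw [this] at hb
    exact ⟨_, hb.map L.symm⟩

/-- A frame is carried along by `L`. If the form is not positive, both sides take the default value
`0`. -/
theorem g2Star_comp (φ : W [⋀^Fin 3]→L[ℝ] ℝ) (L : V ≃L[ℝ] W) {k l : ℕ} (h : k + l = 7)
    (β : W [⋀^Fin k]→L[ℝ] ℝ) :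
    g2Star (φ.compContinuousLinearMap (L : V →L[ℝ] W)) h
        (β.compContinuousLinearMap (L : V →L[ℝ] W)) =
      (g2Star φ h β).compContinuousLinearMap (L : V →L[ℝ] W) := by
  by_cases hp : IsPositiveForm (φ.compContinuousLinearMap (L : V →L[ℝ] W))
  · obtain ⟨b, hb⟩ := hp
    rw [g2Star_eq hb, g2Star_eq (hb.map L), hodgeStar_map]
  · have hp' : ¬ IsPositiveForm φ := by rwa [← isPositiveForm_comp_iff φ L]
    rw [g2Star, dif_neg hp, g2Star, dif_neg hp']
    rfl

end Frames

end G2Sphere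

namespace G2Sphere

/-! ### Components of alternating forms, with index sets encoded as bit masks -/

section Components

open Module

variable {V : Type*} [NormedAddCommGroup V] [NormedSpace ℝ V]

/-- The sign of `j - i`. -/
def orderSign (i j : Fin 7) : ℤ := if i < j then 1 else if j < i then -1 else 0

/-- The sign of the permutation sorting the multi-index `j`, or `0` if `j` has a repetition. -/
def indexSign {k : ℕ} (j : Fin k → Fin 7) : ℤ :=
  ∏ a, ∏ b ∈ Finset.Ioi a, orderSign (j a) (j b)

/-- The set of values of a multi-index, encoded in binary. -/
def indexMask {k : ℕ} (j : Fin k → Fin 7) : ℕ := ∑ a, 2 ^ (j a : ℕ)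

theorem indexSign_of_not_injective {k : ℕ} {j : Fin k → Fin 7} (hj : ¬ Function.Injective j) :
    indexSign j = 0 := by
  simp only [Function.Injective] at hj
  push Not at hj
  obtain ⟨a, b, hab, hne⟩ := hj
  wlog hlt : a < b generalizing a b
  · exact this b a hab.symm hne.symm (lt_of_le_of_ne (not_lt.mp hlt) hne.symm)
  refine Finset.prod_eq_zero (Finset.mem_univ a) (Finset.prod_eq_zero (Finset.mem_Ioi.mpr hlt) ?_)
  simp [orderSign, hab]

theorem indexSign_comp_perm {k : ℕ} {m : Fin k → Fin 7} (hm : StrictMono m)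
    (σ : Equiv.Perm (Fin k)) : indexSign (m ∘ σ) = (Equiv.Perm.sign σ : ℤ) := by
  rw [Equiv.Perm.sign_eq_prod_prod_Ioi]
  push_cast
  refine Finset.prod_congr rfl fun a _ => Finset.prod_congr rfl fun b hb => ?_
  have hne : σ a ≠ σ b := fun h => (Finset.mem_Ioi.mp hb).ne (σ.injective h)
  simp only [orderSign, Function.comp_apply, hm.lt_iff_lt]
  rcases lt_or_gt_of_ne hne with h | h
  · simp [h]
  · simp [h, h.not_gt]

theorem indexMask_comp_perm {k : ℕ} (m : Fin k → Fin 7) (σ : Equiv.Perm (Fin k)) :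
    indexMask (m ∘ σ) = indexMask m :=
  Equiv.sum_comp σ fun a => 2 ^ (m a : ℕ)

theorem eq_of_indexMask_eq {k : ℕ} {j j' : Fin k → Fin 7} (hj : StrictMono j)
    (hj' : StrictMono j') (h : indexMask j = indexMask j') : j = j' := by
  have key (j : Fin k → Fin 7) (hj : StrictMono j) :
      indexMask j = ∑ i ∈ Finset.univ.image fun a => (j a : ℕ), 2 ^ i := by
    rw [Finset.sum_image]
    · rfl
    · intro a _ b _ hab
      exact hj.injective (Fin.ext hab)
  rw [key j hj, key j' hj'] at h
  have h2 := Finset.geomSum_injective le_rfl h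
  refine (hj.range_inj hj').mp ?_
  ext x
  have := congrArg (fun s => (x : ℕ) ∈ s) h2
  simpa [Fin.val_inj] using this

open Classical in
/-- The component of an alternating form along the basis vectors in the set encoded by `m`. -/
noncomputable def component {k : ℕ} (e : Basis (Fin 7) ℝ V) (f : V [⋀^Fin k]→ₗ[ℝ] ℝ) (m : ℕ) : ℝ :=
  if h : ∃ j : Fin k → Fin 7, StrictMono j ∧ indexMask j = m then f (e ∘ h.choose) else 0

theorem component_indexMask {k : ℕ} (e : Basis (Fin 7) ℝ V) (f : V [⋀^Fin k]→ₗ[ℝ] ℝ)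
    {j : Fin k → Fin 7} (hj : StrictMono j) : component e f (indexMask j) = f (e ∘ j) := by
  have h : ∃ j' : Fin k → Fin 7, StrictMono j' ∧ indexMask j' = indexMask j := ⟨j, hj, rfl⟩
  rw [component, dif_pos h, eq_of_indexMask_eq h.choose_spec.1 hj h.choose_spec.2]

/-- Sorting the multi-index costs the sign of the sorting permutation. Sign and mask are computable,
so later identities between components can be settled by `decide`. -/
theorem apply_basis {k : ℕ} (e : Basis (Fin 7) ℝ V) (f : V [⋀^Fin k]→ₗ[ℝ] ℝ)
    (j : Fin k → Fin 7) : f (e ∘ j) = indexSign j * component e f (indexMask j) := by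
  by_cases hj : Function.Injective j
  · set σ := Tuple.sort j with hσ
    have hm : StrictMono (j ∘ σ) :=
      (Tuple.monotone_sort j).strictMono_of_injective (hj.comp σ.injective)
    have h1 : j = (j ∘ σ) ∘ σ.symm := by funext a; simp
    conv_rhs => rw [h1]
    rw [indexSign_comp_perm hm, indexMask_comp_perm, component_indexMask e f hm,
      ← Function.comp_assoc, f.map_perm]
    rw [Equiv.Perm.sign_symm]
    rcases Int.units_eq_one_or (Equiv.Perm.sign σ) with h | h <;> simp [h]
  · rw [indexSign_of_not_injective hj]
    simp only [Function.Injective] at hj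
    push Not at hj
    obtain ⟨a, b, hab, hne⟩ := hj
    rw [f.map_eq_zero_of_eq (e ∘ j) (by simp [hab]) hne]
    simp

theorem det_basis (b : Basis (Fin 7) ℝ V) (j : Fin 7 → Fin 7) : b.det (b ∘ j) = indexSign j := by
  by_cases hj : Function.Injective j
  · have h := indexSign_comp_perm (m := id) strictMono_id
      (Equiv.ofBijective j (Finite.injective_iff_bijective.mp hj))
    have h1 : id ∘ (Equiv.ofBijective j (Finite.injective_iff_bijective.mp hj)) = j := rfl
    rw [h1] at h
    rw [h]
    have := b.det.map_perm b (Equiv.ofBijective j (Finite.injective_iff_bijective.mp hj))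
    rw [b.det_self] at this
    rw [show b ∘ j = b ∘ (Equiv.ofBijective j (Finite.injective_iff_bijective.mp hj)) from rfl,
      this, Units.smul_def]
    simp
  · rw [apply_basis b b.det, indexSign_of_not_injective hj]
    simp

theorem joinVectors_comp {k l : ℕ} (h : k + l = 7) {A B : Type*} (b : A → B) (i : Fin k → A)
    (j : Fin l → A) : joinVectors h (b ∘ i) (b ∘ j) = b ∘ joinVectors h i j := by
  funext x
  simp only [joinVectors, Function.comp_apply]
  refine Fin.addCases (fun a => ?_) (fun a => ?_) (Fin.cast h.symm x) <;> simp

/-- The determinant vanishes unless `i` enumerates the complement of `j`, that is, unless `i = s ∘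
σ`; the sign of `σ` then occurs twice, so all `k!` surviving terms agree. -/
theorem sum_mul_det_joinVectors (b : Basis (Fin 7) ℝ V) {k l : ℕ} (h : k + l = 7)
    (γ : V [⋀^Fin k]→ₗ[ℝ] ℝ) {s : Fin k → Fin 7} {j : Fin l → Fin 7}
    (hs : Function.Injective (joinVectors h s j)) :
    ∑ i : Fin k → Fin 7, γ (b ∘ i) * b.det (joinVectors h (b ∘ i) (b ∘ j)) =
      k.factorial * (indexSign (joinVectors h s j) * γ (b ∘ s)) := by
  have join_left (s : Fin k → Fin 7) (a : Fin k) :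
      joinVectors h s j (Fin.cast h (Fin.castAdd l a)) = s a := by simp [joinVectors]
  have join_right (s : Fin k → Fin 7) (a : Fin l) :
      joinVectors h s j (Fin.cast h (Fin.natAdd k a)) = j a := by simp [joinVectors]
  have hsinj : Function.Injective s := by
    intro a a' haa
    have := hs ((join_left s a).trans (haa.trans (join_left s a').symm))
    exact Fin.castAdd_injective _ _ (Fin.cast_injective _ this)
  have hsurj := Finite.injective_iff_surjective.mp hs
  rw [← Fintype.sum_of_injective (fun σ : Equiv.Perm (Fin k) => s ∘ σ)
    (fun σ τ hst => Equiv.ext fun a => hsinj (congrFun hst a))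
    (fun _ => indexSign (joinVectors h s j) * γ (b ∘ s))]
  · simp [Fintype.card_perm]
  · intro i hi
    by_cases hinj : Function.Injective (joinVectors h i j)
    · exfalso
      apply hi
      have hex (a : Fin k) : ∃ c, s c = i a := by
        obtain ⟨x, hx⟩ := hsurj (i a)
        obtain ⟨y, rfl⟩ : ∃ y, x = Fin.cast h y := ⟨Fin.cast h.symm x, by simp⟩
        induction y using Fin.addCases with
        | left c => exact ⟨c, (join_left s c).symm.trans hx⟩
        | right c =>
          exfalso
          rw [join_right] at hx
          have := hinj ((join_left i a).trans (hx.symm.trans (join_right i c).symm))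
          have := congrArg Fin.val this
          simp at this
          omega
      choose σ hσ using hex
      have hσinj : Function.Injective σ := by
        intro a a' haa
        have h1 : i a = i a' := by rw [← hσ a, ← hσ a', haa]
        have := hinj ((join_left i a).trans (h1.trans (join_left i a').symm))
        exact Fin.castAdd_injective _ _ (Fin.cast_injective _ this)
      exact ⟨Equiv.ofBijective σ (Finite.injective_iff_bijective.mp hσinj), funext hσ⟩
    · rw [joinVectors_comp, det_basis, indexSign_of_not_injective hinj]
      simp
  · intro σ
    have h1 : b.det (joinVectors h (b ∘ s ∘ σ) (b ∘ j)) =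
        Equiv.Perm.sign σ • b.det (joinVectors h (b ∘ s) (b ∘ j)) := by
      have := (joinLeft h b.det (b ∘ j)).map_perm (b ∘ s) σ
      simpa only [joinLeft_apply, Function.comp_assoc] using this
    rw [h1, joinVectors_comp, det_basis, ← Function.comp_assoc, γ.map_perm]
    rcases Int.units_eq_one_or (Equiv.Perm.sign σ) with h | h <;> simp [h, mul_comm]

theorem hodgeStar_basis (b : Basis (Fin 7) ℝ V) {k l : ℕ} (h : k + l = 7)
    (β : V [⋀^Fin k]→L[ℝ] ℝ) {s : Fin k → Fin 7} {j : Fin l → Fin 7}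
    (hs : Function.Injective (joinVectors h s j)) :
    hodgeStar b h β (b ∘ j) = indexSign (joinVectors h s j) * β (b ∘ s) := by
  rw [hodgeStar_apply]
  have := sum_mul_det_joinVectors b h β.toAlternatingMap hs
  have h2 : (k.factorial : ℝ) ≠ 0 := by positivity
  rw [one_div, inv_mul_eq_iff_eq_mul₀ h2]
  exact this

/-- The shuffle sum, multiplied by `k! l!`, is the alternating sum over all permutations. These
correspond to the pairs `(i, j)` that together exhaust the seven indices; the determinant kills all
other pairs. -/
theorem wedge_basis (b : Basis (Fin 7) ℝ V) {k l : ℕ} (h : k + l = 7)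
    (γ : V [⋀^Fin k]→ₗ[ℝ] ℝ) (β : V [⋀^Fin l]→ₗ[ℝ] ℝ) :
    k.factorial * l.factorial * wedge γ β (fun x => b (Fin.cast h x)) =
      ∑ j : Fin l → Fin 7, β (b ∘ j) *
        ∑ i : Fin k → Fin 7, γ (b ∘ i) * b.det (joinVectors h (b ∘ i) (b ∘ j)) := by
  set e : Fin k ⊕ Fin l ≃ Fin 7 := finSumFinEquiv.trans (finCongr h) with he
  have h1 : (k.factorial * l.factorial * wedge γ β (fun x => b (Fin.cast h x)) : ℝ) =
      ∑ σ : Equiv.Perm (Fin k ⊕ Fin l), (Equiv.Perm.sign σ : ℤ) *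
        (γ (fun a => b (e (σ (Sum.inl a)))) * β (fun a => b (e (σ (Sum.inr a))))) := by
    have h2 := congrArg (fun f => LinearMap.mul' ℝ ℝ (f fun x => b (e x)))
      (MultilinearMap.domCoprod_alternization_eq γ β)
    simp only [Fintype.card_fin, AlternatingMap.smul_apply, map_nsmul] at h2
    rw [nsmul_eq_mul] at h2
    push_cast at h2
    change _ = k.factorial * l.factorial * wedge γ β (fun x => b (Fin.cast h x)) at h2
    rw [← h2, MultilinearMap.alternatization_apply, map_sum]
    refine Finset.sum_congr rfl fun σ _ => ?_
    rw [Units.smul_def, map_zsmul, zsmul_eq_mul]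
    simp [MultilinearMap.domCoprod_apply]
  rw [h1]
  simp only [Finset.mul_sum]
  rw [Finset.sum_comm, ← Fintype.sum_prod_type',
    ← Equiv.sum_comp (Equiv.sumArrowEquivProdArrow (Fin k) (Fin l) (Fin 7))]
  have hjoin (f : Fin k ⊕ Fin l → Fin 7) :
      joinVectors h (f ∘ Sum.inl) (f ∘ Sum.inr) = f ∘ e.symm := by
    funext x
    obtain ⟨x, rfl⟩ := e.surjective x
    rcases x with a | a <;> simp [joinVectors, he]
  refine Fintype.sum_of_injective (fun σ : Equiv.Perm (Fin k ⊕ Fin l) => e ∘ σ)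
    (fun σ τ hst => Equiv.ext fun a => e.injective (congrFun hst a)) _ _ ?_ ?_
  · intro f hf
    change β (b ∘ (f ∘ Sum.inr)) * (γ (b ∘ (f ∘ Sum.inl)) *
      b.det (joinVectors h (b ∘ (f ∘ Sum.inl)) (b ∘ (f ∘ Sum.inr)))) = 0
    rw [joinVectors_comp, hjoin, det_basis, indexSign_of_not_injective]
    · simp
    · intro hinj
      apply hf
      have hfinj : Function.Injective f := by
        intro a a' haa
        exact e.injective (hinj (by simpa using haa))
      have hb : Function.Bijective (e.symm ∘ f) :=
        Finite.injective_iff_bijective.mp (e.symm.injective.comp hfinj)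
      exact ⟨Equiv.ofBijective _ hb, funext fun x => by simp⟩
  · intro σ
    change _ = β (b ∘ ((e ∘ σ) ∘ Sum.inr)) * (γ (b ∘ ((e ∘ σ) ∘ Sum.inl)) *
      b.det (joinVectors h (b ∘ ((e ∘ σ) ∘ Sum.inl)) (b ∘ ((e ∘ σ) ∘ Sum.inr))))
    rw [joinVectors_comp, hjoin]
    have hdet : b.det (b ∘ ((e ∘ σ) ∘ e.symm)) = (Equiv.Perm.sign σ : ℤ) := by
      have := b.det.map_perm b ((e.symm.trans σ).trans e)
      rw [b.det_self] at this
      rw [show b ∘ ((e ∘ σ) ∘ e.symm) = b ∘ ((e.symm.trans σ).trans e) from rfl, this]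
      rw [Equiv.Perm.sign_symm_trans_trans, Units.smul_def]
      simp
    rw [hdet]
    simp only [Function.comp_def]
    ring

end Components

end G2Sphere

namespace G2Sphere

/-! ### Isometries that fix `φ` and `η`: compatibility with `⋆_φ`, `d` and `δ_φ` -/

section Equivariance

theorem norm_coe_S7 (x : S7) : ‖(x : H2)‖ = 1 := mem_sphere_zero_iff_norm.mp x.2

theorem coe_S7_ne_zero (x : S7) : (x : H2) ≠ 0 := by
  intro h
  have := norm_coe_S7 x
  rw [h, norm_zero] at this
  exact zero_ne_one this

theorem coe_proj_TS (x : S7) (v : H2) :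
    ((TS x).orthogonalProjectionOnto v : H2) = v - ⟪(x : H2), v⟫_ℝ • (x : H2) := by
  rw [Submodule.coe_orthogonalProjectionOnto_apply, Submodule.starProjection_orthogonal_val,
    Submodule.starProjection_unit_singleton ℝ (norm_coe_S7 x)]

theorem SForm.pullRadial_of_ne_zero {k : ℕ} (η : SForm k) {y : H2} (hy : y ≠ 0) :
    η.pullRadial y = (η (radial y hy)).compContinuousLinearMap (radialDeriv y hy) := dif_pos hy

/-- On the sphere, `r^* η` is `η` composed with the orthogonal projections onto the tangent
spaces. -/
theorem SForm.pullRadial_smul_coe {k : ℕ} (η : SForm k) (x : S7) {c : ℝ} (hc : 0 < c) :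
    η.pullRadial (c • (x : H2)) =
      (η x).compContinuousLinearMap (c⁻¹ • (TS x).orthogonalProjectionOnto) := by
  have hne : c • (x : H2) ≠ 0 := smul_ne_zero hc.ne' (coe_S7_ne_zero x)
  have hn : ‖c • (x : H2)‖ = c := by rw [norm_smul, norm_coe_S7, mul_one, Real.norm_of_nonneg hc.le]
  have hr : radial (c • (x : H2)) hne = x := by
    apply Subtype.ext
    change ‖c • (x : H2)‖⁻¹ • c • (x : H2) = x
    rw [hn, smul_smul, inv_mul_cancel₀ hc.ne', one_smul]
  rw [SForm.pullRadial_of_ne_zero η hne]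
  unfold radialDeriv
  rw [hn]
  have key (z : S7) (hz : z = x) :
      (η z).compContinuousLinearMap (c⁻¹ • (TS z).orthogonalProjectionOnto) =
        (η x).compContinuousLinearMap (c⁻¹ • (TS x).orthogonalProjectionOnto) := by
    subst hz
    rfl
  exact key _ hr

theorem SForm.pullRadial_coe {k : ℕ} (η : SForm k) (x : S7) :
    η.pullRadial (x : H2) =
      (η x).compContinuousLinearMap ((TS x).orthogonalProjectionOnto) := by
  have := η.pullRadial_smul_coe x one_pos
  rw [one_smul] at this
  rw [this]
  ext v
  simp only [ContinuousAlternatingMap.compContinuousLinearMap_apply]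
  congr 1
  funext i
  change (1 : ℝ)⁻¹ • (TS x).orthogonalProjectionOnto (v i) = _
  rw [inv_one, one_smul]
  rfl

theorem SForm.pullRadial_coe_apply {k : ℕ} (η : SForm k) (x : S7) (v : Fin k → TS x) :
    η.pullRadial (x : H2) (fun i => (v i : H2)) = η x v := by
  rw [SForm.pullRadial_coe, ContinuousAlternatingMap.compContinuousLinearMap_apply]
  congr 1
  funext i
  simp

theorem SForm.pullRadial_smul {k : ℕ} (η : SForm k) (x : S7) {c : ℝ} (hc : 0 < c)
    (v : Fin k → H2) :
    η.pullRadial (c • (x : H2)) v = η.pullRadial (x : H2) (fun i => c⁻¹ • v i) := by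
  rw [SForm.pullRadial_smul_coe η x hc, SForm.pullRadial_coe]
  simp [Function.comp_def]

theorem coe_tangentMap (g : H2 ≃ₗᵢ[ℝ] H2) (x : S7) (v : TS x) : (tangentMap g x v : H2) = g v := rfl

theorem proj_sphereMap (g : H2 ≃ₗᵢ[ℝ] H2) (x : S7) (v : H2) :
    (TS (sphereMap g x)).orthogonalProjectionOnto (g v) =
      tangentMap g x ((TS x).orthogonalProjectionOnto v) := by
  apply Subtype.ext
  rw [coe_tangentMap, coe_proj_TS, coe_proj_TS, map_sub, map_smul]
  change _ - ⟪g x, g v⟫_ℝ • g x = _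
  rw [g.inner_map_map]

/-- The pullback of `η` by `g` equals `η`. -/
def SForm.IsFixedBy {k : ℕ} (g : H2 ≃ₗᵢ[ℝ] H2) (η : SForm k) : Prop :=
  ∀ x, (η (sphereMap g x)).compContinuousLinearMap (tangentMap g x) = η x

theorem exists_smul_coe_S7 {y : H2} (hy : y ≠ 0) : ∃ (x : S7) (c : ℝ), 0 < c ∧ y = c • (x : H2) :=
  ⟨radial y hy, ‖y‖, norm_pos_iff.mpr hy, by
    change y = ‖y‖ • ‖y‖⁻¹ • y
    rw [smul_smul, mul_inv_cancel₀ (norm_ne_zero_iff.mpr hy), one_smul]⟩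

theorem SForm.IsFixedBy.pullRadial {k : ℕ} {g : H2 ≃ₗᵢ[ℝ] H2} {η : SForm k} (h : η.IsFixedBy g)
    (y : H2) (v : Fin k → H2) : η.pullRadial (g y) (fun i => g (v i)) = η.pullRadial y v := by
  by_cases hy : y = 0
  · subst hy
    rw [map_zero]
    simp [SForm.pullRadial]
  obtain ⟨x, c, hc, rfl⟩ := exists_smul_coe_S7 hy
  rw [map_smul]
  change η.pullRadial (c • (sphereMap g x : H2)) _ = _
  rw [SForm.pullRadial_smul_coe _ _ hc, SForm.pullRadial_smul_coe _ _ hc, ← h x]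
  simp only [ContinuousAlternatingMap.compContinuousLinearMap_apply]
  congr 1
  funext i
  simp [proj_sphereMap]

theorem tangentMap_injective (g : H2 ≃ₗᵢ[ℝ] H2) (x : S7) :
    Function.Injective (tangentMap g x) := fun _ _ h =>
  Subtype.ext (g.injective (congrArg Subtype.val h))

theorem tangentMap_surjective (g : H2 ≃ₗᵢ[ℝ] H2) (x : S7) :
    Function.Surjective (tangentMap g x) := by
  intro w
  refine ⟨⟨g.symm w, ?_⟩, Subtype.ext (by rw [coe_tangentMap]; simp)⟩
  have hw := (Submodule.mem_orthogonal_singleton_iff_inner_right).mp w.2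
  rw [Submodule.mem_orthogonal_singleton_iff_inner_right, ← g.inner_map_map,
    LinearIsometryEquiv.apply_symm_apply]
  exact hw

/-- `tangentMap` as an equivalence. -/
noncomputable def tangentEquiv (g : H2 ≃ₗᵢ[ℝ] H2) (x : S7) : TS x ≃L[ℝ] TS (sphereMap g x) :=
  (LinearEquiv.ofBijective (tangentMap g x).toLinearMap
    ⟨tangentMap_injective g x, tangentMap_surjective g x⟩).toContinuousLinearEquiv

theorem coe_tangentEquiv (g : H2 ≃ₗᵢ[ℝ] H2) (x : S7) :
    (tangentEquiv g x : TS x →L[ℝ] TS (sphereMap g x)) = tangentMap g x := rfl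

theorem SForm.IsFixedBy.star {g : H2 ≃ₗᵢ[ℝ] H2} {φ : SForm 3} (hφ : φ.IsFixedBy g) {k l : ℕ}
    (h : k + l = 7) {η : SForm k} (hη : η.IsFixedBy g) : (SForm.star φ h η).IsFixedBy g := by
  intro x
  have := g2Star_comp (φ (sphereMap g x)) (tangentEquiv g x) h (η (sphereMap g x))
  rw [coe_tangentEquiv, hφ x, hη x] at this
  exact this.symm

/-- The radial pullback equals its own conjugate by the linear equivalences `g` and `Ψ`. The chain
rule for linear equivalences needs no differentiability, so no regularity of `η` enters. -/
theorem SForm.IsFixedBy.d {g : H2 ≃ₗᵢ[ℝ] H2} {k : ℕ} {η : SForm k} (hη : η.IsFixedBy g) :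
    (SForm.d η).IsFixedBy g := by
  set Ψ : (H2 [⋀^Fin k]→L[ℝ] ℝ) ≃L[ℝ] (H2 [⋀^Fin k]→L[ℝ] ℝ) :=
    g.toContinuousLinearEquiv.symm.continuousAlternatingMapCongrLeft with hΨ
  have h1 : η.pullRadial = Ψ ∘ (η.pullRadial ∘ g.toContinuousLinearEquiv) := by
    funext y
    ext v
    exact (hη.pullRadial y v).symm
  have h2 (y u : H2) (v : Fin k → H2) : fderiv ℝ η.pullRadial y u v =
      fderiv ℝ η.pullRadial (g y) (g u) (fun i => g (v i)) := by
    have h3 : fderiv ℝ η.pullRadial y = (Ψ : (H2 [⋀^Fin k]→L[ℝ] ℝ) →L[ℝ] (H2 [⋀^Fin k]→L[ℝ] ℝ)) ∘L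
        fderiv ℝ (η.pullRadial ∘ g.toContinuousLinearEquiv) y :=
      (congrArg (fun F => fderiv ℝ F y) h1).trans
        (ContinuousLinearEquiv.comp_fderiv (𝕜 := ℝ) (E := H2 [⋀^Fin k]→L[ℝ] ℝ)
          (F := H2 [⋀^Fin k]→L[ℝ] ℝ) (G := H2) Ψ)
    have h4 : fderiv ℝ (η.pullRadial ∘ g.toContinuousLinearEquiv) y =
        (fderiv ℝ η.pullRadial (g y)) ∘L (g.toContinuousLinearEquiv : H2 →L[ℝ] H2) :=
      ContinuousLinearEquiv.comp_right_fderiv (𝕜 := ℝ) (E := H2) (F := H2)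
        (G := H2 [⋀^Fin k]→L[ℝ] ℝ) g.toContinuousLinearEquiv
    rw [h3, h4]
    rfl
  intro x
  ext v
  simp only [ContinuousAlternatingMap.compContinuousLinearMap_apply, SForm.d, extDeriv,
    ContinuousAlternatingMap.alternatizeUncurryFin_apply]
  refine Finset.sum_congr rfl fun i _ => ?_
  rw [h2 (x : H2)]
  rfl

theorem SForm.IsFixedBy.smul {g : H2 ≃ₗᵢ[ℝ] H2} {k : ℕ} {η : SForm k} (hη : η.IsFixedBy g) (c : ℝ) :
    (c • η).IsFixedBy g := by
  intro x
  rw [Pi.smul_apply, Pi.smul_apply, ← hη x]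
  rfl

theorem SForm.IsFixedBy.codiff {g : H2 ≃ₗᵢ[ℝ] H2} {φ : SForm 3} (hφ : φ.IsFixedBy g) {k l : ℕ}
    (h : k + 1 + l = 7) {η : SForm (k + 1)} (hη : η.IsFixedBy g) :
    (SForm.codiff φ h η).IsFixedBy g :=
  (hφ.star _ (hφ.star h hη).d).smul _

end Equivariance

end G2Sphere

namespace G2Sphere

/-! ### Transitivity of `Sp(2)` and the exterior derivative at the base point -/

section BasePoint

/-- The vector of `ℍ²` with the given entries. -/
noncomputable def vec (a b : ℍ[ℝ]) : H2 := WithLp.toLp 2 ![a, b]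

@[simp] theorem vec_zero (a b : ℍ[ℝ]) : vec a b 0 = a := rfl

@[simp] theorem vec_one (a b : ℍ[ℝ]) : vec a b 1 = b := rfl

theorem ext_H2 {v w : H2} (h0 : v 0 = w 0) (h1 : v 1 = w 1) : v = w := by
  ext i : 1
  fin_cases i
  · exact h0
  · exact h1

theorem norm_sq_H2 (v : H2) : ‖v‖ ^ 2 = ‖v 0‖ ^ 2 + ‖v 1‖ ^ 2 := by
  rw [PiLp.norm_sq_eq_of_L2, Fin.sum_univ_two]

theorem inner_H2 (v w : H2) : ⟪v, w⟫_ℝ = ⟪v 0, w 0⟫_ℝ + ⟪v 1, w 1⟫_ℝ := by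
  rw [PiLp.inner_apply, Fin.sum_univ_two]

/-- The point `(1, 0)` of `S⁷`. -/
noncomputable def basePoint : S7 :=
  ⟨vec 1 0, by
    rw [mem_sphere_zero_iff_norm, ← sq_eq_sq₀ (norm_nonneg _) zero_le_one, norm_sq_H2]
    simp⟩

@[simp] theorem basePoint_zero : (basePoint : H2) 0 = 1 := rfl

@[simp] theorem basePoint_one : (basePoint : H2) 1 = 0 := rfl

theorem mem_TS_basePoint {v : H2} : v ∈ TS basePoint ↔ (v 0).re = 0 := by
  rw [Submodule.mem_orthogonal_singleton_iff_inner_right, inner_H2]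
  simp [Quaternion.inner_def]

theorem quaternion_mul_star_self (a : ℍ[ℝ]) : a * star a = ((‖a‖ ^ 2 : ℝ) : ℍ[ℝ]) := by
  rw [Quaternion.self_mul_star, Quaternion.normSq_eq_norm_mul_self, sq]

theorem quaternion_star_mul_self (a : ℍ[ℝ]) : star a * a = ((‖a‖ ^ 2 : ℝ) : ℍ[ℝ]) := by
  rw [Quaternion.star_mul_self, Quaternion.normSq_eq_norm_mul_self, sq]

theorem quatLinear_zero (A : Matrix (Fin 2) (Fin 2) ℍ[ℝ]) (q : ℍ[ℝ]) (x : H2) :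
    quatLinear A q x 0 = (A 0 0 * x 0 + A 0 1 * x 1) * star q := by
  simp [quatLinear, Matrix.mulVec, dotProduct, Fin.sum_univ_two]

theorem quatLinear_apply_one (A : Matrix (Fin 2) (Fin 2) ℍ[ℝ]) (q : ℍ[ℝ]) (x : H2) :
    quatLinear A q x 1 = (A 1 0 * x 0 + A 1 1 * x 1) * star q := by
  simp [quatLinear, Matrix.mulVec, dotProduct, Fin.sum_univ_two]

theorem quatAction_apply (A : Sp2) (q : Sp1) (x : H2) :
    quatAction (A, q) x = quatLinear A q x := rfl

theorem quatAction_mem_Sp2U1 (A : Sp2) {q : Sp1} (hq : q ∈ U1) : quatAction (A, q) ∈ Sp2U1 :=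
  ⟨(A, q), ⟨trivial, hq⟩, rfl⟩

theorem quatAction_mem_Sp2Sp1 (A : Sp2) (q : Sp1) : quatAction (A, q) ∈ Sp2Sp1 := ⟨(A, q), rfl⟩

/-- A matrix in `Sp(2)` whose first column is the normalisation of `y`, if `y₀ ≠ 0`. -/
noncomputable def columnMatrix (y : H2) : Matrix (Fin 2) (Fin 2) ℍ[ℝ] :=
  !![‖y‖⁻¹ • y 0, -((‖y‖⁻¹ * ‖y 0‖⁻¹) • (y 0 * star (y 1)));
     ‖y‖⁻¹ • y 1, (‖y‖⁻¹ * ‖y 0‖) • (1 : ℍ[ℝ])]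

theorem norm_ne_zero_of_apply_zero {y : H2} (hy : y 0 ≠ 0) : ‖y‖ ≠ 0 := by
  rw [norm_ne_zero_iff]
  rintro rfl
  exact hy rfl

theorem columnMatrix_mem {y : H2} (hy : y 0 ≠ 0) :
    columnMatrix y ∈ unitary (Matrix (Fin 2) (Fin 2) ℍ[ℝ]) := by
  have hn : ‖y 0‖ ≠ 0 := norm_ne_zero_iff.mpr hy
  have hr : ‖y‖ ≠ 0 := norm_ne_zero_of_apply_zero hy
  have hsum := norm_sq_H2 y
  have hA : star (columnMatrix y) =
      !![‖y‖⁻¹ • star (y 0), ‖y‖⁻¹ • star (y 1);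
        -((‖y‖⁻¹ * ‖y 0‖⁻¹) • (y 1 * star (y 0))), (‖y‖⁻¹ * ‖y 0‖) • (1 : ℍ[ℝ])] := by
    ext1 i j
    fin_cases i <;> fin_cases j <;>
      simp [columnMatrix, Matrix.star_apply]
  have h0 : y 0 * star (y 0) = (‖y 0‖ ^ 2) • (1 : ℍ[ℝ]) := by
    rw [quaternion_mul_star_self, ← Quaternion.coe_mul_eq_smul, mul_one]
  have h0' : star (y 0) * y 0 = (‖y 0‖ ^ 2) • (1 : ℍ[ℝ]) := by
    rw [quaternion_star_mul_self, ← Quaternion.coe_mul_eq_smul, mul_one]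
  have h1 : y 1 * star (y 1) = (‖y 1‖ ^ 2) • (1 : ℍ[ℝ]) := by
    rw [quaternion_mul_star_self, ← Quaternion.coe_mul_eq_smul, mul_one]
  have h1' : star (y 1) * y 1 = (‖y 1‖ ^ 2) • (1 : ℍ[ℝ]) := by
    rw [quaternion_star_mul_self, ← Quaternion.coe_mul_eq_smul, mul_one]
  have k1 : star (y 0) * (y 0 * star (y 1)) = (‖y 0‖ ^ 2) • star (y 1) := by
    rw [← mul_assoc, h0', smul_mul_assoc, one_mul]
  have k2 : y 1 * star (y 0) * y 0 = (‖y 0‖ ^ 2) • y 1 := by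
    rw [mul_assoc, h0', mul_smul_comm, mul_one]
  have k3 : y 1 * star (y 0) * (y 0 * star (y 1)) = (‖y 0‖ ^ 2 * ‖y 1‖ ^ 2) • (1 : ℍ[ℝ]) := by
    rw [mul_assoc, k1, mul_smul_comm, h1, smul_smul]
  have k4 : y 0 * star (y 1) * (y 1 * star (y 0)) = (‖y 0‖ ^ 2 * ‖y 1‖ ^ 2) • (1 : ℍ[ℝ]) := by
    rw [mul_assoc, ← mul_assoc (star (y 1)), h1', smul_mul_assoc, one_mul, mul_smul_comm, h0,
      smul_smul, mul_comm]
  rw [Unitary.mem_iff, hA]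
  constructor
  · ext1 i j
    fin_cases i <;> fin_cases j <;>
      simp only [columnMatrix, Matrix.mul_fin_two, Fin.zero_eta, Fin.mk_one, Matrix.of_apply,
        Matrix.cons_val_zero, Matrix.cons_val_one, Matrix.one_apply_eq, ne_eq, zero_ne_one,
        one_ne_zero, not_false_eq_true, Matrix.one_apply_ne, Matrix.cons_val_fin_one,
        smul_mul_assoc, mul_smul_comm, neg_mul, mul_neg, h0', h1', k1, k2, k3,
        mul_one, one_mul, smul_neg, neg_neg] <;>
      match_scalars <;> field_simp <;> linarith
  · ext1 i j
    fin_cases i <;> fin_cases j <;>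
      simp only [columnMatrix, Matrix.mul_fin_two, Fin.zero_eta, Fin.mk_one, Matrix.of_apply,
        Matrix.cons_val_zero, Matrix.cons_val_one, Matrix.one_apply_eq, ne_eq, zero_ne_one,
        one_ne_zero, not_false_eq_true, Matrix.one_apply_ne, Matrix.cons_val_fin_one,
        smul_mul_assoc, mul_smul_comm, neg_mul, mul_neg, h0, h1, k4,
        mul_one, one_mul, smul_neg, neg_neg] <;>
      match_scalars <;> field_simp <;> linarith

/-- `columnMatrix` serves wherever the first coordinate is nonzero; on the remaining points an
antidiagonal matrix does. -/
theorem exists_quatAction_basePoint (x : S7) :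
    ∃ A : Sp2, sphereMap (quatAction (A, 1)) basePoint = x := by
  by_cases hx : (x : H2) 0 = 0
  · have hb : ‖(x : H2) 1‖ = 1 := by
      have := norm_sq_H2 (x : H2)
      rw [norm_coe_S7, hx, norm_zero] at this
      exact (sq_eq_sq₀ (norm_nonneg _) zero_le_one).mp (by linarith)
    have h1 : (x : H2) 1 * star ((x : H2) 1) = 1 := by
      rw [quaternion_mul_star_self, hb]; simp
    have h2 : star ((x : H2) 1) * (x : H2) 1 = 1 := by
      rw [quaternion_star_mul_self, hb]; simp
    have hmem : !![0, 1; (x : H2) 1, 0] ∈ unitary (Matrix (Fin 2) (Fin 2) ℍ[ℝ]) := by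
      have hs : star !![0, 1; (x : H2) 1, 0] = !![0, star ((x : H2) 1); 1, 0] := by
        ext1 i j
        fin_cases i <;> fin_cases j <;> simp [Matrix.star_apply]
      rw [Unitary.mem_iff, hs]
      constructor <;> rw [Matrix.mul_fin_two, Matrix.one_fin_two] <;> simp [h1, h2]
    refine ⟨⟨_, hmem⟩, Subtype.ext (ext_H2 ?_ ?_)⟩
    · change quatLinear _ _ _ 0 = _
      rw [quatLinear_zero]
      simp [hx]
    · change quatLinear _ _ _ 1 = _
      rw [quatLinear_apply_one]
      simp
  · refine ⟨⟨_, columnMatrix_mem hx⟩, Subtype.ext (ext_H2 ?_ ?_)⟩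
    · change quatLinear _ _ _ 0 = _
      rw [quatLinear_zero]
      simp [columnMatrix]
    · change quatLinear _ _ _ 1 = _
      rw [quatLinear_apply_one]
      simp [columnMatrix]

theorem starModule_quaternion : StarModule ℝ ℍ[ℝ] := ⟨fun r a => by simp⟩

/-- The inclusion of the `i`-th summand of `ℍ²`. -/
noncomputable def inclusion (i : Fin 2) : ℍ[ℝ] →L[ℝ] H2 :=
  ((PiLp.continuousLinearEquiv 2 ℝ fun _ : Fin 2 => ℍ[ℝ]).symm : (Fin 2 → ℍ[ℝ]) →L[ℝ] H2) ∘L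
    ContinuousLinearMap.single ℝ (fun _ : Fin 2 => ℍ[ℝ]) i

/-- Multiplication by `a` from the `j`-th to the `i`-th summand of `ℍ²`, as a function of `a`. -/
noncomputable def mulEntry (i j : Fin 2) : ℍ[ℝ] →L[ℝ] H2 →L[ℝ] H2 :=
  ContinuousLinearMap.compL ℝ H2 ℍ[ℝ] H2 (inclusion i) ∘L
    (ContinuousLinearMap.compL ℝ H2 ℍ[ℝ] ℍ[ℝ]).flip (PiLp.proj 2 (fun _ : Fin 2 => ℍ[ℝ]) j) ∘L
      ContinuousLinearMap.mul ℝ ℍ[ℝ]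

theorem mulEntry_apply (i j : Fin 2) (a : ℍ[ℝ]) (v : H2) :
    mulEntry i j a v = inclusion i (a * v j) := rfl

theorem inclusion_apply (i : Fin 2) (a : ℍ[ℝ]) (j : Fin 2) :
    inclusion i a j = (Pi.single i a : Fin 2 → ℍ[ℝ]) j := rfl

set_option synthInstance.maxHeartbeats 200000 in
/-- A quaternionic `2 × 2` matrix as a linear map of `ℍ²`. -/
noncomputable def mulMatrix : (ℍ[ℝ] × ℍ[ℝ]) × (ℍ[ℝ] × ℍ[ℝ]) →L[ℝ] H2 →L[ℝ] H2 :=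
  ((mulEntry 0 0).coprod (mulEntry 0 1)).coprod ((mulEntry 1 0).coprod (mulEntry 1 1))

/-- The linear map `‖y‖⁻¹ A⁻¹`, where `A ∈ Sp(2)` is the matrix `columnMatrix y`. -/
noncomputable def columnInverse (y : H2) : H2 →L[ℝ] H2 :=
  mulMatrix (((‖y‖ ^ 2)⁻¹ • star (y 0), (‖y‖ ^ 2)⁻¹ • star (y 1)),
    ((‖y‖ ^ 2)⁻¹ • -(‖y 0‖⁻¹ • (y 1 * star (y 0))), (‖y‖ ^ 2)⁻¹ • ‖y 0‖ • (1 : ℍ[ℝ])))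

theorem columnInverse_zero (y v : H2) :
    columnInverse y v 0 = (‖y‖ ^ 2)⁻¹ • (star (y 0) * v 0 + star (y 1) * v 1) := by
  simp [columnInverse, mulMatrix, mulEntry_apply, inclusion_apply, smul_add]

theorem columnInverse_one (y v : H2) :
    columnInverse y v 1 = (‖y‖ ^ 2)⁻¹ • (‖y 0‖ • v 1 - ‖y 0‖⁻¹ • (y 1 * star (y 0) * v 0)) := by
  simp [columnInverse, mulMatrix, mulEntry_apply, inclusion_apply, sub_eq_add_neg,
    add_comm]

theorem columnInverse_quatLinear {y : H2} (hy : y 0 ≠ 0) (v : H2) :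
    columnInverse y (quatLinear (columnMatrix y) 1 v) = ‖y‖⁻¹ • v := by
  have hn : ‖y 0‖ ≠ 0 := norm_ne_zero_iff.mpr hy
  have hr : ‖y‖ ≠ 0 := norm_ne_zero_of_apply_zero hy
  have hsum := norm_sq_H2 y
  have m0 (z : ℍ[ℝ]) : star (y 0) * (y 0 * z) = (‖y 0‖ ^ 2) • z := by
    rw [← mul_assoc, quaternion_star_mul_self, Quaternion.coe_mul_eq_smul]
  have m1 (z : ℍ[ℝ]) : star (y 1) * (y 1 * z) = (‖y 1‖ ^ 2) • z := by
    rw [← mul_assoc, quaternion_star_mul_self, Quaternion.coe_mul_eq_smul]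
  have m2 (z : ℍ[ℝ]) : y 1 * (star (y 1) * z) = (‖y 1‖ ^ 2) • z := by
    rw [← mul_assoc, quaternion_mul_star_self, Quaternion.coe_mul_eq_smul]
  apply ext_H2
  · rw [columnInverse_zero, quatLinear_zero, quatLinear_apply_one]
    simp only [columnMatrix, Matrix.of_apply, Matrix.cons_val_zero, Matrix.cons_val_one,
      Matrix.cons_val_fin_one, star_one, mul_one, mul_add, smul_mul_assoc, mul_smul_comm, neg_mul,
      mul_neg, mul_assoc, m0, m1, one_mul, PiLp.smul_apply]
    match_scalars
    · field_simp; linarith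
    · field_simp; ring
  · rw [columnInverse_one, quatLinear_zero, quatLinear_apply_one]
    simp only [columnMatrix, Matrix.of_apply, Matrix.cons_val_zero, Matrix.cons_val_one,
      Matrix.cons_val_fin_one, star_one, mul_one, mul_add, smul_mul_assoc, mul_smul_comm, neg_mul,
      mul_neg, mul_assoc, m0, m2, one_mul, PiLp.smul_apply]
    match_scalars
    · field_simp; ring
    · field_simp; linarith

theorem differentiableAt_columnInverse : DifferentiableAt ℝ columnInverse (basePoint : H2) := by
  have := starModule_quaternion
  have h0 : DifferentiableAt (F := ℍ[ℝ]) ℝ (fun y : H2 => y 0) (basePoint : H2) := by fun_prop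
  have h1 : DifferentiableAt (F := ℍ[ℝ]) ℝ (fun y : H2 => y 1) (basePoint : H2) := by fun_prop
  have hn : DifferentiableAt ℝ (fun y : H2 => ‖y 0‖) (basePoint : H2) := h0.norm ℝ (by simp)
  have hn' : DifferentiableAt ℝ (fun y : H2 => ‖y 0‖⁻¹) (basePoint : H2) := hn.fun_inv (by simp)
  have hr : DifferentiableAt ℝ (fun y : H2 => (‖y‖ ^ 2)⁻¹) (basePoint : H2) :=
    (differentiableAt_id.norm_sq ℝ).fun_inv (by simp)
  have hs0 := h0.star
  have hs1 := h1.star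
  have hm := (hn'.fun_smul (h1.fun_mul hs0)).fun_neg
  have hone := hn.fun_smul (differentiableAt_const (𝕜 := ℝ) (1 : ℍ[ℝ]) (x := (basePoint : H2)))
  have hpair := (((hr.fun_smul hs0).prodMk (hr.fun_smul hs1)).prodMk
    ((hr.fun_smul hm).prodMk (hr.fun_smul hone)))
  exact DifferentiableAt.comp (F := (ℍ[ℝ] × ℍ[ℝ]) × (ℍ[ℝ] × ℍ[ℝ])) (G := H2 →L[ℝ] H2)
    (g := fun a => mulMatrix a) _ (ContinuousLinearMap.differentiableAt
      (E := (ℍ[ℝ] × ℍ[ℝ]) × (ℍ[ℝ] × ℍ[ℝ])) (F := H2 →L[ℝ] H2) mulMatrix) hpair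

theorem hasDerivAt_norm_one_add_smul {E : Type*} [NormedAddCommGroup E] [InnerProductSpace ℝ E]
    {x u : E} (hx : ‖x‖ = 1) (hu : ⟪x, u⟫_ℝ = 0) :
    HasDerivAt (fun t : ℝ => ‖x + t • u‖) 0 0 := by
  have h (t : ℝ) : ‖x + t • u‖ = √(1 + t ^ 2 * ‖u‖ ^ 2) := by
    rw [← Real.sqrt_sq (norm_nonneg (x + t • u)), norm_add_sq_real, hx, inner_smul_right, hu,
      norm_smul, mul_pow, Real.norm_eq_abs, sq_abs]
    simp
  simp only [h]
  have h2 : HasDerivAt (fun t : ℝ => 1 + t ^ 2 * ‖u‖ ^ 2) (0 : ℝ) 0 := by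
    have := ((hasDerivAt_pow 2 (0 : ℝ)).mul_const (‖u‖ ^ 2)).const_add 1
    simpa using this
  simpa using h2.sqrt (by simp)

/-- Along a tangent direction both `‖y‖` and `‖y 0‖` are stationary at the base point, since `u` is
orthogonal to it and `u 0` is imaginary. Hence only the quaternionic entries of the matrix
contribute. -/
theorem fderiv_columnInverse {u : H2} (hu : u ∈ TS basePoint) (v : H2) :
    fderiv ℝ columnInverse (basePoint : H2) u v =
      vec (star (u 0) * v 0 + star (u 1) * v 1) (-(u 1 * v 0)) := by
  have := starModule_quaternion
  have hline : HasDerivAt (fun t : ℝ => (basePoint : H2) + t • u) u 0 := by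
    simpa using ((hasDerivAt_id (0 : ℝ)).smul_const u).const_add (basePoint : H2)
  have hd : HasDerivAt (fun t : ℝ => columnInverse ((basePoint : H2) + t • u) v)
      (fderiv ℝ columnInverse (basePoint : H2) u v) 0 := by
    have hf : HasFDerivAt columnInverse (fderiv ℝ columnInverse (basePoint : H2))
        ((basePoint : H2) + (0 : ℝ) • u) := by
      simpa using differentiableAt_columnInverse.hasFDerivAt
    have h := HasFDerivAt.comp_hasDerivAt (E := H2 →L[ℝ] H2) (F := H2) (0 : ℝ) hf hline
    exact ((ContinuousLinearMap.apply ℝ H2 v).hasFDerivAt.comp_hasDerivAt (0 : ℝ) h)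
  have hcoord (i : Fin 2) : HasDerivAt
      (fun t : ℝ => columnInverse ((basePoint : H2) + t • u) v i)
      (fderiv ℝ columnInverse (basePoint : H2) u v i) 0 :=
    (PiLp.proj 2 (fun _ : Fin 2 => ℍ[ℝ]) (𝕜 := ℝ) i).hasFDerivAt.comp_hasDerivAt (0 : ℝ) hd
  have hN : HasDerivAt (fun t : ℝ => (‖(basePoint : H2) + t • u‖ ^ 2)⁻¹) 0 0 := by
    have h1 := hasDerivAt_norm_one_add_smul (norm_coe_S7 basePoint)
      ((Submodule.mem_orthogonal_singleton_iff_inner_right).mp hu)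
    simpa [norm_coe_S7] using (h1.fun_pow 2).fun_inv (by simp)
  have hn : HasDerivAt (fun t : ℝ => ‖((basePoint : H2) + t • u) 0‖) 0 0 :=
    hasDerivAt_norm_one_add_smul (x := (1 : ℍ[ℝ])) (u := u 0) (by simp)
      (by simpa [Quaternion.inner_def] using mem_TS_basePoint.mp hu)
  have hn' : HasDerivAt (fun t : ℝ => ‖((basePoint : H2) + t • u) 0‖⁻¹) 0 0 := by
    simpa using hn.fun_inv (by simp)
  have h0 : HasDerivAt (F := ℍ[ℝ]) (fun t : ℝ => ((basePoint : H2) + t • u) 0) (u 0) 0 :=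
    (PiLp.proj 2 (fun _ : Fin 2 => ℍ[ℝ]) (𝕜 := ℝ) 0).hasFDerivAt.comp_hasDerivAt (0 : ℝ) hline
  have h1 : HasDerivAt (F := ℍ[ℝ]) (fun t : ℝ => ((basePoint : H2) + t • u) 1) (u 1) 0 :=
    (PiLp.proj 2 (fun _ : Fin 2 => ℍ[ℝ]) (𝕜 := ℝ) 1).hasFDerivAt.comp_hasDerivAt (0 : ℝ) hline
  apply ext_H2
  · refine (hcoord 0).unique ?_
    simp only [columnInverse_zero]
    have := hN.fun_smul ((h0.star.mul_const (v 0)).fun_add (h1.star.mul_const (v 1)))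
    simpa [norm_coe_S7] using this
  · refine (hcoord 1).unique ?_
    simp only [columnInverse_one]
    have := hN.fun_smul ((hn.fun_smul (hasDerivAt_const (0 : ℝ) (v 1))).fun_sub
      (hn'.fun_smul ((h1.fun_mul h0.star).mul_const (v 0))))
    simpa [norm_coe_S7] using this

/-- An `Sp(2)`-invariant form near the base point is determined by its value there. -/
theorem SForm.pullRadial_eq_columnInverse {k : ℕ} {η : SForm k}
    (hη : ∀ A : Sp2, η.IsFixedBy (quatAction (A, 1))) {y : H2} (hy : y 0 ≠ 0) :
    η.pullRadial y =
      (η.pullRadial (basePoint : H2)).compContinuousLinearMap (columnInverse y) := by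
  set A : Sp2 := ⟨_, columnMatrix_mem hy⟩ with hA
  have hr : ‖y‖ ≠ 0 := norm_ne_zero_of_apply_zero hy
  have hrpos : 0 < ‖y‖ := lt_of_le_of_ne (norm_nonneg _) hr.symm
  ext v
  have hw (i : Fin k) : quatAction (A, 1) ((quatAction (A, 1)).symm (v i)) = v i :=
    LinearIsometryEquiv.apply_symm_apply _ _
  have hy' : quatAction (A, 1) (‖y‖ • (basePoint : H2)) = y := by
    rw [map_smul]
    apply ext_H2
    · change ‖y‖ • quatLinear (columnMatrix y) 1 _ 0 = _
      rw [quatLinear_zero]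
      simp [columnMatrix, hr]
    · change ‖y‖ • quatLinear (columnMatrix y) 1 _ 1 = _
      rw [quatLinear_apply_one]
      simp [columnMatrix, hr]
  have h1 := (hη A).pullRadial (‖y‖ • (basePoint : H2)) (fun i => (quatAction (A, 1)).symm (v i))
  simp only [hw] at h1
  rw [hy', SForm.pullRadial_smul _ _ hrpos] at h1
  rw [h1, ContinuousAlternatingMap.compContinuousLinearMap_apply]
  congr 1
  funext i
  have := columnInverse_quatLinear hy ((quatAction (A, 1)).symm (v i))
  rw [← this]
  change columnInverse y (quatAction (A, 1) _) = _
  rw [hw]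
  rfl

theorem SForm.pullRadial_eventuallyEq_columnInverse {k : ℕ} {η : SForm k}
    (hη : ∀ A : Sp2, η.IsFixedBy (quatAction (A, 1))) :
    η.pullRadial =ᶠ[𝓝 (basePoint : H2)] fun y =>
      (η.pullRadial (basePoint : H2)).compContinuousLinearMap (columnInverse y) := by
  have : ∀ᶠ y : H2 in 𝓝 (basePoint : H2), y 0 ≠ 0 := by
    have hc : ContinuousAt (fun y : H2 => y 0) (basePoint : H2) := by fun_prop
    exact hc.eventually_ne (by simp)
  filter_upwards [this] with y hy using SForm.pullRadial_eq_columnInverse hη hy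

/-- The exterior derivative of an `Sp(2)`-invariant form at the base point. -/
theorem SForm.d_basePoint {k : ℕ} {η : SForm k}
    (hη : ∀ A : Sp2, η.IsFixedBy (quatAction (A, 1))) (v : Fin (k + 1) → TS basePoint) :
    SForm.d η basePoint v = ∑ i : Fin (k + 1), (-1) ^ (i : ℕ) * ∑ a : Fin k,
      η basePoint (Function.update (i.removeNth v) a ((TS basePoint).orthogonalProjectionOnto
        (vec (Star.star ((v i : H2) 0) * (i.removeNth v a : H2) 0 +
          Star.star ((v i : H2) 1) * (i.removeNth v a : H2) 1)
          (-((v i : H2) 1 * (i.removeNth v a : H2) 0))))) := by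
  have hev := SForm.pullRadial_eventuallyEq_columnInverse hη
  have hdiff : DifferentiableAt ℝ (fun y : H2 =>
      (η.pullRadial (basePoint : H2)).compContinuousLinearMap (columnInverse y))
      (basePoint : H2) :=
    (differentiableAt_const _).continuousAlternatingMapCompContinuousLinearMap
      differentiableAt_columnInverse
  change extDeriv η.pullRadial (basePoint : H2) (fun i => (v i : H2)) = _
  -- Near the base point the form is its frozen value composed with `columnInverse y`, so only the
  -- inserted linear maps are differentiated, one argument at a time.
  rw [hev.extDeriv_eq, extDeriv_apply hdiff]
  refine Finset.sum_congr rfl fun i _ => ?_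
  rw [zsmul_eq_mul]
  push_cast
  congr 1
  have hone (w : H2) : columnInverse (basePoint : H2) w = w := by
    apply ext_H2
    · rw [columnInverse_zero]; simp
    · rw [columnInverse_one]; simp
  have hcol (w : H2) : DifferentiableAt ℝ (fun y => columnInverse y w) (basePoint : H2) :=
    differentiableAt_columnInverse.clm_apply (differentiableAt_const _)
  have hderiv := fderiv_continuousAlternatingMap_apply_apply (𝕜 := ℝ)
    (f := fun _ : H2 => η.pullRadial (basePoint : H2))
    (g := fun (a : Fin k) (y : H2) => columnInverse y (i.removeNth v a)) (x := (basePoint : H2))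
    (differentiableAt_const _) (fun a => hcol _) (v i : H2)
  have hzero : fderiv ℝ (fun _ : H2 => η.pullRadial (basePoint : H2)) (basePoint : H2) (v i)
      (fun a => columnInverse (basePoint : H2) (i.removeNth v a)) = 0 := by
    rw [fderiv_fun_const]
    rfl
  rw [hzero, zero_add] at hderiv
  simp only [hone] at hderiv
  refine Eq.trans hderiv (Finset.sum_congr rfl fun a _ => ?_)
  have hfd : fderiv ℝ (fun y => columnInverse y (i.removeNth v a : H2)) (basePoint : H2) (v i) =
      fderiv ℝ columnInverse (basePoint : H2) (v i) (i.removeNth v a) := by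
    rw [fderiv_clm_apply differentiableAt_columnInverse (differentiableAt_const _)]
    simp
  rw [hfd, fderiv_columnInverse (v i).2, SForm.pullRadial_coe,
    ContinuousAlternatingMap.compContinuousLinearMap_apply]
  congr 1
  funext c
  by_cases hc : c = a
  · subst hc
    simp
  · simp [Function.update_of_ne hc]

end BasePoint

end G2Sphere

namespace G2Sphere

/-! ### A frame at the base point and the structure constants of `d` -/

section TangentBasis

open Module

/-- The quaternion with the given coordinates. -/
def quat (a b c d : ℝ) : ℍ[ℝ] := ⟨a, b, c, d⟩

@[simp] theorem quat_re (a b c d : ℝ) : (quat a b c d).re = a := rfl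

@[simp] theorem quat_imI (a b c d : ℝ) : (quat a b c d).imI = b := rfl

@[simp] theorem quat_imJ (a b c d : ℝ) : (quat a b c d).imJ = c := rfl

@[simp] theorem quat_imK (a b c d : ℝ) : (quat a b c d).imK = d := rfl

/-- The Kronecker symbol. -/
def kronecker (i j : Fin 7) : ℤ := if i = j then 1 else 0

/-- The vectors `(i, 0), (j, 0), (k, 0), (0, 1), (0, i), (0, j), (0, k)` of `ℍ²`. -/
noncomputable def frameVector (i : Fin 7) : H2 :=
  vec (quat 0 (kronecker i 0) (kronecker i 1) (kronecker i 2))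
    (quat (kronecker i 3) (kronecker i 4) (kronecker i 5) (kronecker i 6))

/-- The coordinates of a tangent vector at the base point. -/
noncomputable def tangentCoords : TS basePoint ≃ₗ[ℝ] (Fin 7 → ℝ) where
  toFun v := ![((v : H2) 0).imI, ((v : H2) 0).imJ, ((v : H2) 0).imK, ((v : H2) 1).re,
    ((v : H2) 1).imI, ((v : H2) 1).imJ, ((v : H2) 1).imK]
  map_add' v w := by
    ext i
    fin_cases i <;> simp
  map_smul' c v := by
    ext i
    fin_cases i <;> simp
  invFun c := ⟨vec (quat 0 (c 0) (c 1) (c 2)) (quat (c 3) (c 4) (c 5) (c 6)), mem_TS_basePoint.mpr rfl⟩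
  left_inv v := by
    have hv := mem_TS_basePoint.mp v.2
    apply Subtype.ext
    apply ext_H2
    · ext <;> simp [hv]
    · ext <;> simp
  right_inv c := by
    ext i
    fin_cases i <;> simp

/-- The basis of the tangent space at the base point given by `frameVector`. -/
noncomputable def tangentBasis : Basis (Fin 7) ℝ (TS basePoint) := Basis.ofEquivFun tangentCoords

theorem coe_tangentBasis (i : Fin 7) : (tangentBasis i : H2) = frameVector i := by
  rw [tangentBasis, Basis.coe_ofEquivFun]
  apply ext_H2 <;> ext <;> simp [tangentCoords, frameVector, kronecker, Pi.single_apply, eq_comm]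

/-- The sign in `-D_{eᵢ} eⱼ = ± eₗ`, or `0`. -/
def connectionSign (i j : Fin 7) : ℤ :=
  ![![0, -1, 1, 0, 0, 0, 0], ![1, 0, -1, 0, 0, 0, 0], ![-1, 1, 0, 0, 0, 0, 0],
    ![-1, -1, -1, 0, 1, 1, 1], ![1, -1, 1, -1, 0, -1, 1], ![1, 1, -1, -1, 1, 0, -1],
    ![-1, 1, 1, -1, -1, 1, 0]] i j

/-- The index `l` in `-D_{eᵢ} eⱼ = ± eₗ`. -/
def connectionIndex (i j : Fin 7) : Fin 7 :=
  ![![0, 2, 1, 0, 0, 0, 0], ![2, 0, 0, 0, 0, 0, 0], ![1, 0, 0, 0, 0, 0, 0],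
    ![4, 5, 6, 0, 0, 1, 2], ![3, 6, 5, 0, 0, 2, 1], ![6, 3, 4, 1, 2, 0, 0],
    ![5, 4, 3, 2, 1, 0, 0]] i j

theorem proj_basePoint_eq {w : H2} {v : TS basePoint} (h0 : w 0 - ((w 0).re : ℍ[ℝ]) = (v : H2) 0)
    (h1 : w 1 = (v : H2) 1) : (TS basePoint).orthogonalProjectionOnto w = v := by
  apply Subtype.ext
  rw [coe_proj_TS]
  have hi : ⟪(basePoint : H2), w⟫_ℝ = (w 0).re := by
    rw [inner_H2]
    simp [Quaternion.inner_def]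
  rw [hi]
  apply ext_H2
  · rw [← h0]
    simp only [PiLp.sub_apply, PiLp.smul_apply, basePoint_zero]
    rw [← Quaternion.coe_mul_eq_smul, mul_one]
  · simp [h1]

theorem proj_connection (i j : Fin 7) :
    (TS basePoint).orthogonalProjectionOnto
      (vec (star ((tangentBasis i : H2) 0) * (tangentBasis j : H2) 0 +
        star ((tangentBasis i : H2) 1) * (tangentBasis j : H2) 1)
        (-((tangentBasis i : H2) 1 * (tangentBasis j : H2) 0))) =
      (connectionSign i j : ℝ) • tangentBasis (connectionIndex i j) := by
  apply proj_basePoint_eq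
  · rw [Submodule.coe_smul, PiLp.smul_apply, vec_zero]
    simp only [coe_tangentBasis, frameVector, vec_zero, vec_one]
    -- All coordinates are integers, so the 49 pairs of frame vectors are a finite check.
    ext <;> simp <;> norm_cast <;> revert i j <;> decide
  · rw [Submodule.coe_smul, PiLp.smul_apply, vec_one]
    simp only [coe_tangentBasis, frameVector, vec_zero, vec_one]
    ext <;> simp <;> norm_cast <;> revert i j <;> decide

/-- The components of a form at the base point. -/
noncomputable def SForm.comp {k : ℕ} (η : SForm k) (m : ℕ) : ℝ :=
  component tangentBasis (η basePoint).toAlternatingMap m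

theorem SForm.apply_tangentBasis {k : ℕ} (η : SForm k) (j : Fin k → Fin 7) :
    η basePoint (tangentBasis ∘ j) = indexSign j * η.comp (indexMask j) :=
  apply_basis tangentBasis (η basePoint).toAlternatingMap j

theorem SForm.comp_indexMask {k : ℕ} (η : SForm k) {j : Fin k → Fin 7} (hj : StrictMono j) :
    η.comp (indexMask j) = η basePoint (tangentBasis ∘ j) :=
  component_indexMask tangentBasis (η basePoint).toAlternatingMap hj

/-- The terms of a component of an exterior derivative, as coefficients and masks. -/
def derivTerms {k : ℕ} (j : Fin (k + 1) → Fin 7) : List (ℤ × ℕ) :=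
  ((List.ofFn fun i : Fin (k + 1) => List.ofFn fun a : Fin k =>
    let j' := Function.update (i.removeNth j) a (connectionIndex (j i) (i.removeNth j a))
    ((-1) ^ (i : ℕ) * (connectionSign (j i) (i.removeNth j a) * indexSign j'), indexMask j')).flatten).filter
      fun p => p.1 ≠ 0

theorem sum_filter_ne_zero (l : List (ℤ × ℕ)) (c : ℕ → ℝ) :
    ((l.filter fun p => p.1 ≠ 0).map fun p => (p.1 : ℝ) * c p.2).sum =
      (l.map fun p => (p.1 : ℝ) * c p.2).sum := by
  induction l with
  | nil => rfl
  | cons p l ih =>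
    by_cases hp : p.1 = 0
    · simp only [List.map_cons, List.sum_cons, ← ih]
      simp [hp]
    · simp only [List.map_cons, List.sum_cons, ← ih]
      simp [hp]

/-- The table turns each derivative term into a signed frame vector, so a component of `d η` becomes
an explicit integral combination of components of `η`. -/
theorem SForm.comp_d {k : ℕ} {η : SForm k} (hη : ∀ A : Sp2, η.IsFixedBy (quatAction (A, 1)))
    {j : Fin (k + 1) → Fin 7} (hj : StrictMono j) :
    (SForm.d η).comp (indexMask j) =
      ((derivTerms j).map fun p => (p.1 : ℝ) * η.comp p.2).sum := by
  rw [SForm.comp_indexMask _ hj, SForm.d_basePoint hη, derivTerms, sum_filter_ne_zero,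
    List.map_flatten, List.sum_flatten, List.map_map, List.map_ofFn, List.sum_ofFn]
  refine Finset.sum_congr rfl fun i _ => ?_
  simp only [Function.comp_apply, List.map_ofFn, List.sum_ofFn]
  rw [Finset.mul_sum]
  refine Finset.sum_congr rfl fun a _ => ?_
  have h1 : i.removeNth (tangentBasis ∘ j) a = tangentBasis (i.removeNth j a) := rfl
  have h2 := proj_connection (j i) (i.removeNth j a)
  simp only [h1]
  rw [h2, ContinuousAlternatingMap.map_update_smul]
  have h3 : Function.update (i.removeNth (tangentBasis ∘ j)) a
      (tangentBasis (connectionIndex (j i) (i.removeNth j a))) =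
      tangentBasis ∘ Function.update (i.removeNth j) a
        (connectionIndex (j i) (i.removeNth j a)) := by
    rw [Function.comp_update]
    rfl
  rw [h3, SForm.apply_tangentBasis, smul_eq_mul]
  push_cast
  ring

end TangentBasis

end G2Sphere

namespace G2Sphere

/-! ### Isotropy elements as signed permutations, and the surviving components -/

section Isotropy

open Module

/-- Coordinates of quaternions `u`, before normalisation. -/
def isotropyFst (n : Fin 4) : Fin 4 → ℤ :=
  ![![1, 0, 0, 0], ![1, 0, 0, 0], ![1, 1, 0, 0], ![1, 1, 1, 1]] n

/-- Coordinates of quaternions `p`, before normalisation. -/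
def isotropySnd (n : Fin 4) : Fin 4 → ℤ :=
  ![![0, 1, 0, 0], ![0, 0, 1, 0], ![1, 1, 0, 0], ![1, 1, 1, 1]] n

/-- The squared norms of `isotropyFst` and `isotropySnd`. -/
def isotropyNorm (n : Fin 4) : ℤ := ![1, 1, 2, 4] n

/-- The map `(v, w) ↦ (u v u⁻¹, p w u⁻¹)` is a signed permutation of the frame; its signs. -/
def isotropySign (n : Fin 4) : Fin 7 → ℤ :=
  ![![1, 1, 1, 1, -1, 1, -1], ![1, 1, 1, 1, -1, -1, 1], ![1, 1, -1, 1, 1, 1, -1],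
    ![1, 1, 1, 1, 1, 1, 1]] n

/-- The map `(v, w) ↦ (u v u⁻¹, p w u⁻¹)` is a signed permutation of the frame; its permutation. -/
def isotropyIndex (n : Fin 4) : Fin 7 → Fin 7 :=
  ![![0, 1, 2, 4, 3, 6, 5], ![0, 1, 2, 5, 6, 3, 4], ![0, 2, 1, 3, 4, 6, 5],
    ![1, 2, 0, 3, 5, 6, 4]] n

/-- The quaternion with the given integral coordinates. -/
def intQuat (c : Fin 4 → ℤ) : ℍ[ℝ] := quat (c 0) (c 1) (c 2) (c 3)

theorem isotropyFst_mul (n : Fin 4) (j : Fin 7) :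
    intQuat (isotropyFst n) * frameVector j 0 * star (intQuat (isotropyFst n)) =
      ((isotropyNorm n * isotropySign n j : ℤ) : ℝ) • frameVector (isotropyIndex n j) 0 := by
  simp only [frameVector, vec_zero, intQuat]
  ext <;> simp <;> norm_cast <;> revert n j <;> decide

theorem isotropySnd_mul (n : Fin 4) (j : Fin 7) :
    intQuat (isotropySnd n) * frameVector j 1 * star (intQuat (isotropyFst n)) =
      ((isotropyNorm n * isotropySign n j : ℤ) : ℝ) • frameVector (isotropyIndex n j) 1 := by
  simp only [frameVector, vec_one, intQuat]
  ext <;> simp <;> norm_cast <;> revert n j <;> decide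

theorem intQuat_mul_star {c : Fin 4 → ℤ} {N : ℤ}
    (h : c 0 * c 0 + c 1 * c 1 + c 2 * c 2 + c 3 * c 3 = N) :
    intQuat c * star (intQuat c) = ((N : ℝ) : ℍ[ℝ]) := by
  rw [← h]
  simp only [intQuat]
  ext <;> simp <;> ring

theorem intQuat_star_mul {c : Fin 4 → ℤ} {N : ℤ}
    (h : c 0 * c 0 + c 1 * c 1 + c 2 * c 2 + c 3 * c 3 = N) :
    star (intQuat c) * intQuat c = ((N : ℝ) : ℍ[ℝ]) := by
  rw [← h]
  simp only [intQuat]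
  ext <;> simp <;> ring

theorem smul_intQuat_mem {c : Fin 4 → ℤ} {N : ℤ}
    (h : c 0 * c 0 + c 1 * c 1 + c 2 * c 2 + c 3 * c 3 = N) {r : ℝ} (hr : r * r * N = 1) :
    r • intQuat c ∈ unitary ℍ[ℝ] := by
  have := starModule_quaternion
  rw [Unitary.mem_iff]
  have h1 : ((r * r) • ((N : ℝ) : ℍ[ℝ])) = 1 := by
    rw [← Quaternion.coe_mul_eq_smul, ← Quaternion.coe_mul, hr, Quaternion.coe_one]
  constructor
  · rw [star_smul, star_trivial, smul_mul_smul_comm, intQuat_star_mul h, h1]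
  · rw [star_smul, star_trivial, smul_mul_smul_comm, intQuat_mul_star h, h1]

theorem diagonal_mem {u p : ℍ[ℝ]} (hu : u ∈ unitary ℍ[ℝ]) (hp : p ∈ unitary ℍ[ℝ]) :
    Matrix.diagonal ![u, p] ∈ unitary (Matrix (Fin 2) (Fin 2) ℍ[ℝ]) := by
  rw [Unitary.mem_iff] at *
  simp only [Matrix.star_eq_conjTranspose, Matrix.diagonal_conjTranspose,
    Matrix.diagonal_mul_diagonal]
  constructor
  · rw [← Matrix.diagonal_one]
    congr 1
    funext i
    fin_cases i
    · exact hu.1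
    · exact hp.1
  · rw [← Matrix.diagonal_one]
    congr 1
    funext i
    fin_cases i
    · exact hu.2
    · exact hp.2

/-- `g` fixes the base point and acts on the frame as the `n`-th signed permutation. -/
def IsIsotropy (n : Fin 4) (g : H2 ≃ₗᵢ[ℝ] H2) : Prop :=
  sphereMap g basePoint = basePoint ∧
    ∀ j, g (frameVector j) = (isotropySign n j : ℝ) • frameVector (isotropyIndex n j)

/-- The element is `(diag(u, p), u)` with `u`, `p` the normalised integral quaternions; it fixes
`(1, 0)` because `u u⁻¹ = 1`. Only for `n = 3`, which permutes the three imaginary units cyclically,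
does `u` fail to be complex. -/
theorem exists_isIsotropy (n : Fin 4) :
    ∃ g, IsIsotropy n g ∧ g ∈ Sp2Sp1 ∧ (n ≠ 3 → g ∈ Sp2U1) := by
  have h1 : isotropyFst n 0 * isotropyFst n 0 + isotropyFst n 1 * isotropyFst n 1 +
    isotropyFst n 2 * isotropyFst n 2 + isotropyFst n 3 * isotropyFst n 3 = isotropyNorm n := by
    revert n; decide
  have h2 : isotropySnd n 0 * isotropySnd n 0 + isotropySnd n 1 * isotropySnd n 1 +
    isotropySnd n 2 * isotropySnd n 2 + isotropySnd n 3 * isotropySnd n 3 = isotropyNorm n := by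
    revert n; decide
  have hN : (0 : ℝ) < isotropyNorm n := by
    have : 0 < isotropyNorm n := by revert n; decide
    exact_mod_cast this
  obtain ⟨r, hr⟩ : ∃ r : ℝ, r * r * isotropyNorm n = 1 :=
    ⟨(√(isotropyNorm n))⁻¹, by
      rw [← mul_inv, Real.mul_self_sqrt hN.le, inv_mul_cancel₀ hN.ne']⟩
  have hu := smul_intQuat_mem h1 hr
  have hp := smul_intQuat_mem h2 hr
  have := starModule_quaternion
  set A : Sp2 := ⟨_, diagonal_mem hu hp⟩ with hA
  set q : Sp1 := ⟨_, hu⟩ with hq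
  have hg0 (x : H2) : quatAction (A, q) x 0 =
      (r * r) • (intQuat (isotropyFst n) * x 0 * star (intQuat (isotropyFst n))) := by
    rw [quatAction_apply, quatLinear_zero]
    simp only [hA, hq, Matrix.diagonal_apply_eq, Matrix.diagonal_apply_ne _ (zero_ne_one' (Fin 2)),
      zero_mul, add_zero, star_smul, star_trivial, Matrix.cons_val_zero]
    rw [smul_mul_assoc, smul_mul_smul_comm]
  have hg1 (x : H2) : quatAction (A, q) x 1 =
      (r * r) • (intQuat (isotropySnd n) * x 1 * star (intQuat (isotropyFst n))) := by
    rw [quatAction_apply, quatLinear_apply_one]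
    simp only [hA, hq, Matrix.diagonal_apply_eq, Matrix.diagonal_apply_ne _ (one_ne_zero' (Fin 2)),
      zero_mul, zero_add, star_smul, star_trivial, Matrix.cons_val_one, Matrix.cons_val_fin_one]
    rw [smul_mul_assoc, smul_mul_smul_comm]
  refine ⟨quatAction (A, q), ⟨?_, fun j => ?_⟩, quatAction_mem_Sp2Sp1 _ _, fun hn => ?_⟩
  · apply Subtype.ext
    change quatAction (A, q) basePoint = basePoint
    apply ext_H2
    · rw [hg0, basePoint_zero, mul_one, intQuat_mul_star h1, ← Quaternion.coe_mul_eq_smul,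
        ← Quaternion.coe_mul, hr, Quaternion.coe_one]
    · rw [hg1, basePoint_one, mul_zero, zero_mul, smul_zero]
  · apply ext_H2
    · rw [hg0, isotropyFst_mul, smul_smul, PiLp.smul_apply]
      push_cast
      rw [← mul_assoc, hr, one_mul]
    · rw [hg1, isotropySnd_mul, smul_smul, PiLp.smul_apply]
      push_cast
      rw [← mul_assoc, hr, one_mul]
  · refine quatAction_mem_Sp2U1 _ ?_
    have h3 : isotropyFst n 2 = 0 ∧ isotropyFst n 3 = 0 := by clear * - hn; revert n; decide
    change (r • intQuat (isotropyFst n)).imJ = 0 ∧ (r • intQuat (isotropyFst n)).imK = 0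
    simp [intQuat, h3.1, h3.2]

/-- The product of the signs along a word of signed permutations. -/
def wordSign {k : ℕ} : List (Fin 4) → (Fin k → Fin 7) → ℤ
  | [], _ => 1
  | n :: w, j => (∏ a, isotropySign n (j a)) * wordSign w (isotropyIndex n ∘ j)

/-- The action of a word of signed permutations on multi-indices. -/
def wordIndex {k : ℕ} : List (Fin 4) → (Fin k → Fin 7) → Fin k → Fin 7
  | [], j => j
  | n :: w, j => wordIndex w (isotropyIndex n ∘ j)

theorem apply_eq_wordSign_mul {k : ℕ} {T : (Fin k → Fin 7) → ℝ} (w : List (Fin 4))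
    (hT : ∀ n ∈ w, ∀ j, T j = ((∏ a, isotropySign n (j a) : ℤ) : ℝ) * T (isotropyIndex n ∘ j))
    (j : Fin k → Fin 7) : T j = wordSign w j * T (wordIndex w j) := by
  induction w generalizing j with
  | nil => simp [wordSign, wordIndex]
  | cons n w ih =>
    rw [hT n (by simp), ih (fun m hm => hT m (List.mem_cons_of_mem _ hm)), wordSign, wordIndex]
    push_cast
    ring

theorem SForm.IsFixedBy.apply_tangentBasis {k : ℕ} {η : SForm k} {n : Fin 4} {g : H2 ≃ₗᵢ[ℝ] H2}
    (hη : η.IsFixedBy g) (hg : IsIsotropy n g) (j : Fin k → Fin 7) :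
    η basePoint (tangentBasis ∘ j) = ((∏ a, isotropySign n (j a) : ℤ) : ℝ) *
      η basePoint (tangentBasis ∘ (isotropyIndex n ∘ j)) := by
  have h := hη.pullRadial basePoint fun a => (tangentBasis (j a) : H2)
  rw [SForm.pullRadial_coe_apply] at h
  have h0 : g (basePoint : H2) = (basePoint : H2) := congrArg Subtype.val hg.1
  have h1 : (fun a => g (tangentBasis (j a) : H2)) = fun a =>
      (((isotropySign n (j a) : ℝ) • tangentBasis (isotropyIndex n (j a)) : TS basePoint) : H2) := by
    funext a
    rw [coe_tangentBasis, hg.2, Submodule.coe_smul, coe_tangentBasis]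
  rw [h0, h1, SForm.pullRadial_coe_apply, ContinuousAlternatingMap.map_smul_univ] at h
  change η basePoint (fun a => tangentBasis (j a)) = _
  rw [← h, smul_eq_mul]
  push_cast
  rfl

theorem SForm.comp_eq {k : ℕ} {η : SForm k} {G : Subgroup (H2 ≃ₗᵢ[ℝ] H2)} (hη : η.IsInvariant G)
    (w : List (Fin 4)) (hw : ∀ n ∈ w, ∃ g ∈ G, IsIsotropy n g) {j : Fin k → Fin 7}
    (hj : StrictMono j) :
    η.comp (indexMask j) =
      (wordSign w j * indexSign (wordIndex w j) : ℤ) * η.comp (indexMask (wordIndex w j)) := by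
  rw [SForm.comp_indexMask _ hj]
  have h := apply_eq_wordSign_mul (T := fun j => η basePoint (tangentBasis ∘ j)) w
    (fun n hn j => by
      obtain ⟨g, hg, hi⟩ := hw n hn
      exact SForm.IsFixedBy.apply_tangentBasis (hη g hg) hi j) j
  rw [h, SForm.apply_tangentBasis]
  push_cast
  ring

theorem Sp2U1_isotropy {w : List (Fin 4)} (hw : 3 ∉ w) : ∀ n ∈ w, ∃ g ∈ Sp2U1, IsIsotropy n g := by
  intro n hn
  obtain ⟨g, h1, -, h3⟩ := exists_isIsotropy n
  exact ⟨g, h3 (by rintro rfl; exact hw hn), h1⟩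

theorem SForm.comp_eq_of_word {k : ℕ} {η : SForm k} (hη : η.IsInvariant Sp2U1)
    (w : List (Fin 4)) (j : Fin k → Fin 7) (z : ℤ) (m' m : ℕ)
    (h : indexMask j = m' ∧ 3 ∉ w ∧ (∀ a b, a < b → j a < j b) ∧ wordSign w j * indexSign (wordIndex w j) = z ∧
      indexMask (wordIndex w j) = m) : η.comp m' = z * η.comp m := by
  rw [← h.1, SForm.comp_eq hη w (Sp2U1_isotropy h.2.1) h.2.2.1, h.2.2.2.1, h.2.2.2.2]

/-- The components of an invariant 3-form that need not vanish. -/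
def threeMasks : List ℕ := [7, 25, 42, 74, 97, 50, 82, 44, 76, 52, 84]

theorem SForm.comp_three {η : SForm 3} (hη : η.IsInvariant Sp2U1) :
    η.comp 97 = -η.comp 25 ∧ η.comp 50 = -η.comp 74 ∧ η.comp 82 = η.comp 42 ∧
      η.comp 44 = -η.comp 74 ∧ η.comp 76 = η.comp 42 ∧ η.comp 52 = -η.comp 42 ∧
      η.comp 84 = -η.comp 74 := by
  refine ⟨?_, ?_, ?_, ?_, ?_, ?_, ?_⟩
  · simpa using SForm.comp_eq_of_word hη [1] ![0, 5, 6] (-1) 97 25 (by decide)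
  · simpa using SForm.comp_eq_of_word hη [0] ![1, 4, 5] (-1) 50 74 (by decide)
  · simpa using SForm.comp_eq_of_word hη [0] ![1, 4, 6] 1 82 42 (by decide)
  · simpa using SForm.comp_eq_of_word hη [2] ![2, 3, 5] (-1) 44 74 (by decide)
  · simpa using SForm.comp_eq_of_word hη [2] ![2, 3, 6] 1 76 42 (by decide)
  · simpa using SForm.comp_eq_of_word hη [0, 2] ![2, 4, 5] (-1) 52 42 (by decide)
  · simpa using SForm.comp_eq_of_word hη [0, 2] ![2, 4, 6] (-1) 84 74 (by decide)

theorem eq_vecCons_three (j : Fin 3 → Fin 7) : j = ![j 0, j 1, j 2] := by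
  funext a
  fin_cases a <;> rfl

/-- The square of a signed permutation used here acts diagonally by signs, so it kills every
component on which the product of signs is `-1`. A finite check shows that only eleven components
escape. -/
theorem indexMask_mem_or (j : Fin 3 → Fin 7) (hj : StrictMono j) : indexMask j ∈ threeMasks ∨
    ∃ n : Fin 4, n ≠ 3 ∧ wordSign [n, n] j * indexSign (wordIndex [n, n] j) = -1 ∧
      indexMask (wordIndex [n, n] j) = indexMask j := by
  have key : ∀ a b c : Fin 7, a < b → b < c → indexMask ![a, b, c] ∈ threeMasks ∨
    ∃ n : Fin 4, n ≠ 3 ∧ wordSign [n, n] ![a, b, c] * indexSign (wordIndex [n, n] ![a, b, c]) = -1 ∧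
      indexMask (wordIndex [n, n] ![a, b, c]) = indexMask ![a, b, c] := by
    decide +kernel
  rw [eq_vecCons_three j]
  exact key _ _ _ (hj (by decide)) (hj (by decide))

theorem SForm.comp_eq_zero {η : SForm 3} (hη : η.IsInvariant Sp2U1) {j : Fin 3 → Fin 7}
    (hj : StrictMono j) (h : indexMask j ∉ threeMasks) : η.comp (indexMask j) = 0 := by
  obtain ⟨n, hn, h1, h2⟩ := (indexMask_mem_or j hj).resolve_left h
  have := SForm.comp_eq_of_word hη [n, n] j (-1) (indexMask j) (indexMask j)
    ⟨rfl, by simpa using hn.symm, fun a b hab => hj hab, h1, h2⟩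
  push_cast at this
  linarith

/-- An invariant 3-form is determined at the base point by four components. -/
theorem SForm.eq_basePoint {η θ : SForm 3} (hη : η.IsInvariant Sp2U1) (hθ : θ.IsInvariant Sp2U1)
    (h : ∀ m ∈ [7, 25, 42, 74], η.comp m = θ.comp m) : η basePoint = θ basePoint := by
  obtain ⟨a1, a2, a3, a4, a5, a6, a7⟩ := SForm.comp_three hη
  obtain ⟨b1, b2, b3, b4, b5, b6, b7⟩ := SForm.comp_three hθ
  simp only [List.mem_cons, List.not_mem_nil, or_false, forall_eq_or_imp, forall_eq] at h
  obtain ⟨h1, h2, h3, h4⟩ := h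
  have hm : ∀ m ∈ threeMasks, η.comp m = θ.comp m := by
    simp only [threeMasks, List.mem_cons, List.not_mem_nil, or_false, forall_eq_or_imp, forall_eq,
      a1, a2, a3, a4, a5, a6, a7, b1, b2, b3, b4, b5, b6, b7, h1, h2, h3, h4, and_self]
  have key (j : Fin 3 → Fin 7) : η basePoint (tangentBasis ∘ j) = θ basePoint (tangentBasis ∘ j) := by
    by_cases hj : Function.Injective j
    · have hm' : StrictMono (j ∘ Tuple.sort j) :=
        (Tuple.monotone_sort j).strictMono_of_injective (hj.comp (Tuple.sort j).injective)
      rw [SForm.apply_tangentBasis, SForm.apply_tangentBasis, ← indexMask_comp_perm j (Tuple.sort j)]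
      refine congrArg _ ?_
      by_cases hmem : indexMask (j ∘ Tuple.sort j) ∈ threeMasks
      · exact hm _ hmem
      · rw [SForm.comp_eq_zero hη hm' hmem, SForm.comp_eq_zero hθ hm' hmem]
    · rw [SForm.apply_tangentBasis, SForm.apply_tangentBasis, indexSign_of_not_injective hj]
      simp
  have h2 : (η basePoint).toAlternatingMap = (θ basePoint).toAlternatingMap :=
    Module.Basis.ext_alternating tangentBasis fun j _ => key j
  exact ContinuousAlternatingMap.toAlternatingMap_injective h2

theorem SForm.eq_of_eq_basePoint {k : ℕ} {η θ : SForm k} (hη : η.IsInvariant Sp2U1)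
    (hθ : θ.IsInvariant Sp2U1) (h : η basePoint = θ basePoint) : η = θ := by
  funext x
  obtain ⟨A, rfl⟩ := exists_quatAction_basePoint x
  have hA := quatAction_mem_Sp2U1 A (one_mem U1)
  ext w
  obtain ⟨v, rfl⟩ : ∃ v, w = tangentMap (quatAction (A, 1)) basePoint ∘ v := by
    choose v hv using fun i => tangentMap_surjective (quatAction (A, 1)) basePoint (w i)
    exact ⟨v, (funext hv).symm⟩
  have h1 := congrArg (fun f => f v) (hη _ hA basePoint)
  have h2 := congrArg (fun f => f v) (hθ _ hA basePoint)
  exact h1.trans ((congrArg (fun f => f v) h).trans h2.symm)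

/-- The cyclic permutation of the imaginary units, available only in the larger group, identifies
the first vertical direction with the second. -/
theorem SForm.comp_of_Sp2Sp1 {η : SForm 3} (hη : η.IsInvariant Sp2U1) (h : η.IsInvariant Sp2Sp1) :
    η.comp 42 = η.comp 25 ∧ η.comp 74 = 0 := by
  obtain ⟨g, hg, hmem, -⟩ := exists_isIsotropy 3
  have hw : ∀ n ∈ [(3 : Fin 4)], ∃ g ∈ Sp2Sp1, IsIsotropy n g := by
    simpa using ⟨g, hmem, hg⟩
  have e1 (j : Fin 3 → Fin 7) (m' m : ℕ)
      (h2 : indexMask j = m' ∧ (∀ a b, a < b → j a < j b) ∧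
        wordSign [3] j * indexSign (wordIndex [3] j) = 1 ∧ indexMask (wordIndex [3] j) = m) :
      η.comp m' = η.comp m := by
    rw [← h2.1, SForm.comp_eq h [3] hw h2.2.1, h2.2.2.1, h2.2.2.2, Int.cast_one, one_mul]
  refine ⟨(e1 ![0, 3, 4] 25 42 (by decide)).symm, ?_⟩
  -- The mask 28 is the index set `{2, 3, 4}`, which is not in `threeMasks`.
  rw [e1 ![1, 3, 6] 74 28 (by decide)]
  exact SForm.comp_eq_zero (j := ![2, 3, 4]) hη (by decide) (by decide)

theorem SForm.comp_two {η : SForm 2} (hη : η.IsInvariant Sp2U1) :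
    η.comp 96 = -η.comp 24 := by
  simpa using SForm.comp_eq_of_word hη [1] ![5, 6] (-1) 96 24 (by decide)

theorem SForm.comp_four {η : SForm 4} (hη : η.IsInvariant Sp2U1) :
    η.comp 83 = -η.comp 53 ∧ η.comp 77 = -η.comp 53 ∧ η.comp 43 = -η.comp 53 := by
  refine ⟨?_, ?_, ?_⟩
  · simpa using SForm.comp_eq_of_word hη [2] ![0, 1, 4, 6] (-1) 83 53 (by decide)
  · simpa using SForm.comp_eq_of_word hη [0] ![0, 2, 3, 6] (-1) 77 53 (by decide)
  · simpa using SForm.comp_eq_of_word hη [0, 2] ![0, 1, 3, 5] (-1) 43 53 (by decide)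

end Isotropy

end G2Sphere


namespace G2Sphere

/-! ### Explicit wedge products -/

section Bryant

open Module

variable {V : Type*} [NormedAddCommGroup V] [NormedSpace ℝ V]

theorem sum_perm_succ {n : ℕ} (F : Equiv.Perm (Fin (n + 1)) → ℝ) :
    ∑ σ : Equiv.Perm (Fin (n + 1)), F σ =
      ∑ i : Fin (n + 1), ∑ σ : Equiv.Perm (Fin n), F (Equiv.Perm.decomposeFin.symm (i, σ)) := by
  rw [← Fintype.sum_prod_type', ← Equiv.sum_comp Equiv.Perm.decomposeFin.symm]

/-- The order of the 24 terms is the one obtained by splitting off the image of `0` repeatedly with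
`decomposeFin`. -/
theorem sum_perm_four (F : Fin 4 → Fin 4 → Fin 4 → Fin 4 → ℝ) :
    ∑ σ : Equiv.Perm (Fin 4), ((Equiv.Perm.sign σ : ℤ) : ℝ) * F (σ 0) (σ 1) (σ 2) (σ 3) =
      F 0 1 2 3 + -F 0 1 3 2 + (-F 0 2 1 3 + F 0 2 3 1 + (-F 0 3 2 1 + F 0 3 1 2)) +
      (-F 1 0 2 3 + F 1 0 3 2 + (F 1 2 0 3 + -F 1 2 3 0 + (F 1 3 2 0 + -F 1 3 0 2)) +
      (-F 2 1 0 3 + F 2 1 3 0 + (F 2 0 1 3 + -F 2 0 3 1 + (F 2 3 0 1 + -F 2 3 1 0)) +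
      (-F 3 1 2 0 + F 3 1 0 2 + (F 3 2 1 0 + -F 3 2 0 1 + (F 3 0 2 1 + -F 3 0 1 2))))) := by
  simp only [sum_perm_succ, Fin.sum_univ_succ, Finset.univ_unique, Finset.sum_singleton]
  simp [Equiv.Perm.decomposeFin.symm_sign]
  rfl

theorem wedge_two_two (α β : V [⋀^Fin 2]→ₗ[ℝ] ℝ) (v : Fin 4 → V) :
    wedge α β v = α ![v 0, v 1] * β ![v 2, v 3] - α ![v 0, v 2] * β ![v 1, v 3] +
      α ![v 0, v 3] * β ![v 1, v 2] + α ![v 1, v 2] * β ![v 0, v 3] -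
      α ![v 1, v 3] * β ![v 0, v 2] + α ![v 2, v 3] * β ![v 0, v 1] := by
  have h2 := congrArg (fun f => LinearMap.mul' ℝ ℝ (f (v ∘ finSumFinEquiv)))
    (MultilinearMap.domCoprod_alternization_eq α β)
  simp only [Fintype.card_fin, AlternatingMap.smul_apply, map_nsmul] at h2
  rw [nsmul_eq_mul] at h2
  change _ = _ * wedge α β v at h2
  rw [MultilinearMap.alternatization_apply, map_sum,
    ← Equiv.sum_comp (finSumFinEquiv (m := 2) (n := 2)).symm.permCongr] at h2
  have h3 : ∀ σ : Equiv.Perm (Fin 4), LinearMap.mul' ℝ ℝ (Equiv.Perm.sign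
      ((finSumFinEquiv (m := 2) (n := 2)).symm.permCongr σ) • (MultilinearMap.domDomCongr
        ((finSumFinEquiv (m := 2) (n := 2)).symm.permCongr σ) (α.toMultilinearMap.domCoprod β.toMultilinearMap))
          (v ∘ finSumFinEquiv)) = ((Equiv.Perm.sign σ : ℤ) : ℝ) *
      (fun a b c d => α ![v a, v b] * β ![v c, v d]) (σ 0) (σ 1) (σ 2) (σ 3) := by
    intro σ
    rw [Units.smul_def, map_zsmul, zsmul_eq_mul, Equiv.Perm.sign_permCongr]
    congr 1
    simp only [MultilinearMap.domDomCongr_apply, MultilinearMap.domCoprod_apply,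
      LinearMap.mul'_apply]
    refine congrArg₂ (fun x y => α x * β y) ?_ ?_ <;> funext a <;> fin_cases a <;>
      exact congrArg v ((finSumFinEquiv (m := 2) (n := 2)).apply_symm_apply _)
  rw [Finset.sum_congr rfl fun σ _ => h3 σ] at h2
  replace h2 := (sum_perm_four fun a b c d => α ![v a, v b] * β ![v c, v d]).symm.trans h2
  have sα (x y : V) : α ![y, x] = -α ![x, y] := by
    have := α.map_swap ![x, y] (zero_ne_one' (Fin 2))
    rw [← this]
    congr 1
    funext a
    fin_cases a <;> rfl
  have sβ (x y : V) : β ![y, x] = -β ![x, y] := by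
    have := β.map_swap ![x, y] (zero_ne_one' (Fin 2))
    rw [← this]
    congr 1
    funext a
    fin_cases a <;> rfl
  have h4 : ((Nat.factorial 2 * Nat.factorial 2 : ℕ) : ℝ) = 4 := by norm_num [Nat.factorial]
  simp only [sα (v 0) (v 1), sα (v 0) (v 2), sα (v 0) (v 3), sα (v 1) (v 2), sα (v 1) (v 3),
    sα (v 2) (v 3), sβ (v 0) (v 1), sβ (v 0) (v 2), sβ (v 0) (v 3), sβ (v 1) (v 2),
    sβ (v 1) (v 3), sβ (v 2) (v 3), h4] at h2
  linarith

/-- Each increasing multi-index has `k!` rearrangements, on which the product takes the same value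
because the sign is squared; repeated indices contribute zero. -/
theorem sum_mul_eq_sum_strictMono {k : ℕ} (b : Basis (Fin 7) ℝ V) (f g : V [⋀^Fin k]→ₗ[ℝ] ℝ) :
    ∑ j : Fin k → Fin 7, f (b ∘ j) * g (b ∘ j) =
      k.factorial * ∑ j : Fin k → Fin 7 with StrictMono j, f (b ∘ j) * g (b ∘ j) := by
  have h1 : k.factorial * ∑ j : Fin k → Fin 7 with StrictMono j, f (b ∘ j) * g (b ∘ j) =
      ∑ p ∈ (Finset.univ.filter fun j : Fin k → Fin 7 => StrictMono j) ×ˢ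
        (Finset.univ : Finset (Equiv.Perm (Fin k))),
          f (b ∘ (p.1 ∘ p.2)) * g (b ∘ (p.1 ∘ p.2)) := by
    rw [Finset.sum_product, Finset.mul_sum]
    refine Finset.sum_congr rfl fun j _ => ?_
    have h2 (σ : Equiv.Perm (Fin k)) : f (b ∘ (j ∘ σ)) * g (b ∘ (j ∘ σ)) = f (b ∘ j) * g (b ∘ j) := by
      have hf := f.map_perm (b ∘ j) σ
      have hg := g.map_perm (b ∘ j) σ
      change f (b ∘ (j ∘ σ)) = _ at hf
      change g (b ∘ (j ∘ σ)) = _ at hg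
      rw [hf, hg]
      rcases Int.units_eq_one_or (Equiv.Perm.sign σ) with h | h <;> simp [h]
    simp [h2, Fintype.card_perm]
  rw [h1]
  symm
  refine Finset.sum_of_injOn (fun p => p.1 ∘ p.2) ?_ (fun _ _ => Finset.mem_univ _) ?_
    fun _ _ => rfl
  · rintro ⟨m, σ⟩ hm ⟨m', σ'⟩ hm' h
    simp only [Finset.coe_product, Set.mem_prod, Finset.mem_coe, Finset.mem_filter,
      Finset.mem_univ, true_and, and_true] at hm hm'
    simp only at h
    have h3 : m = m' := eq_of_indexMask_eq hm hm' (by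
      rw [← indexMask_comp_perm m σ, h, indexMask_comp_perm])
    subst h3
    congr 1
    exact Equiv.ext fun a => hm.injective (congrFun h a)
  · intro j _ hj
    rw [apply_basis, indexSign_of_not_injective]
    · simp
    · intro hinj
      apply hj
      refine ⟨(j ∘ Tuple.sort j, (Tuple.sort j).symm), ?_, ?_⟩
      · simpa using (Tuple.monotone_sort j).strictMono_of_injective
          (hinj.comp (Tuple.sort j).injective)
      · funext a
        simp

/-- An alternating `7`-form as a form in its last `l` arguments. -/
def joinRight {k l : ℕ} (h : k + l = 7) (f : V [⋀^Fin 7]→ₗ[ℝ] ℝ) (u : Fin k → V) :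
    V [⋀^Fin l]→ₗ[ℝ] ℝ where
  toFun w := f (joinVectors h u w)
  map_update_add' {inst} w i x y := by
    rw [Subsingleton.elim inst (instDecidableEqFin l)]
    simp only [joinVectors_update, AlternatingMap.map_update_add]
  map_update_smul' {inst} w i c x := by
    rw [Subsingleton.elim inst (instDecidableEqFin l)]
    simp only [joinVectors_update, AlternatingMap.map_update_smul]
  map_eq_zero_of_eq' w i j hw hij := by
    refine f.map_eq_zero_of_eq _ (i := Fin.cast h (Fin.natAdd k i))
      (j := Fin.cast h (Fin.natAdd k j)) ?_ ?_
    · simp [joinVectors, hw]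
    · intro hh
      have := congrArg Fin.val hh
      simp at this
      omega

/-- The wedge product of a `k`-form and an `l`-form on a basis, as a sum over a list of
pairs of complementary multi-indices that contains all those where the `l`-form does not vanish. -/
theorem wedge_basis_eq_sum (b : Basis (Fin 7) ℝ V) {k l : ℕ} (h : k + l = 7)
    (γ : V [⋀^Fin k]→ₗ[ℝ] ℝ) (β : V [⋀^Fin l]→ₗ[ℝ] ℝ) (L : List ((Fin k → Fin 7) × (Fin l → Fin 7)))
    (hL : ∀ p ∈ L, Function.Injective (joinVectors h p.1 p.2) ∧ StrictMono p.2)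
    (hd : (L.map Prod.snd).Nodup)
    (hβ : ∀ j : Fin l → Fin 7, StrictMono j → j ∉ L.map Prod.snd → β (b ∘ j) = 0) :
    wedge γ β (fun x => b (Fin.cast h x)) =
      (L.map fun p => (indexSign (joinVectors h p.1 p.2) : ℝ) * γ (b ∘ p.1) * β (b ∘ p.2)).sum := by
  have h1 := wedge_basis b h γ β
  have h2 : ∀ j : Fin l → Fin 7, (∑ i : Fin k → Fin 7, γ (b ∘ i) *
      b.det (joinVectors h (b ∘ i) (b ∘ j))) =
        (∑ i : Fin k → Fin 7, γ (b ∘ i) • joinRight h b.det (b ∘ i)) (b ∘ j) := by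
    intro j
    exact (map_sum (AddMonoidHom.mk' (fun f : V [⋀^Fin l]→ₗ[ℝ] ℝ => f (b ∘ j)) fun _ _ => rfl)
      (fun i => γ (b ∘ i) • joinRight h b.det (b ∘ i)) Finset.univ).symm
  simp only [h2] at h1
  rw [sum_mul_eq_sum_strictMono, ← Finset.sum_subset (s₁ := (L.map Prod.snd).toFinset),
    List.sum_toFinset _ hd, List.map_map] at h1
  · have h3 : (L.map ((fun j => β (b ∘ j) * (∑ i : Fin k → Fin 7, γ (b ∘ i) •
        joinRight h b.det (b ∘ i)) (b ∘ j)) ∘ Prod.snd)).sum = k.factorial *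
          (L.map fun p => (indexSign (joinVectors h p.1 p.2) : ℝ) * γ (b ∘ p.1) *
            β (b ∘ p.2)).sum := by
      rw [← List.sum_map_mul_left]
      congr 1
      refine List.map_congr_left fun p hp => ?_
      rw [Function.comp_apply, ← h2, sum_mul_det_joinVectors b h γ (hL p hp).1]
      ring
    rw [h3] at h1
    have hk : (k.factorial : ℝ) ≠ 0 := by positivity
    have hl : (l.factorial : ℝ) ≠ 0 := by positivity
    apply mul_left_cancel₀ (mul_ne_zero hk hl)
    rw [h1]
    ring
  · intro j hj
    rw [List.mem_toFinset, List.mem_map] at hj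
    obtain ⟨p, hp, rfl⟩ := hj
    simpa using (hL p hp).2
  · intro j hj hj'
    rw [hβ j (by simpa using hj) (by simpa using hj'), zero_mul]

theorem bryantForm_apply (φ : V [⋀^Fin 3]→L[ℝ] ℝ) (X Y : V) (v : Fin 7 → V) :
    bryantForm φ X Y v = 1 / 6 * wedge (k := 4) (l := 3)
      (wedge (k := 2) (l := 2) (φ.toAlternatingMap.curryLeft X) (φ.toAlternatingMap.curryLeft Y))
        φ.toAlternatingMap v := by
  rw [bryantForm, AlternatingMap.smul_apply, smul_eq_mul]

end Bryant

/-! ### Tables for evaluating the cubic form of an invariant 3-form -/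

section Terms

open Module

/-- The non-vanishing components of an invariant 3-form, in terms of four of them. -/
def threeTable : List (ℕ × ℤ × ℕ) :=
  [(7, 1, 7), (25, 1, 25), (42, 1, 42), (74, 1, 74), (97, -1, 25), (50, -1, 74), (82, 1, 42),
    (44, -1, 74), (76, 1, 42), (52, -1, 42), (84, -1, 74)]

/-- The value of an invariant 3-form on frame vectors, as a multiple of one of four components. -/
def threeValue (j : Fin 3 → Fin 7) : ℤ × ℕ :=
  (indexSign j * ((threeTable.lookup (indexMask j)).getD (0, 0)).1,
    ((threeTable.lookup (indexMask j)).getD (0, 0)).2)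

theorem SForm.apply_three {η : SForm 3} (hη : η.IsInvariant Sp2U1) (j : Fin 3 → Fin 7) :
    η basePoint (tangentBasis ∘ j) = (threeValue j).1 * η.comp (threeValue j).2 := by
  rw [SForm.apply_tangentBasis]
  by_cases hj : Function.Injective j
  · have hm' : StrictMono (j ∘ Tuple.sort j) :=
      (Tuple.monotone_sort j).strictMono_of_injective (hj.comp (Tuple.sort j).injective)
    obtain ⟨m, hm⟩ : ∃ m, m = indexMask j := ⟨_, rfl⟩
    have h2 := SForm.comp_eq_zero hη hm'
    rw [indexMask_comp_perm, ← hm] at h2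
    rw [threeValue, ← hm]
    obtain ⟨a1, a2, a3, a4, a5, a6, a7⟩ := SForm.comp_three hη
    by_cases hmem : m ∈ threeMasks
    · simp only [threeMasks, List.mem_cons, List.not_mem_nil, or_false] at hmem
      rcases hmem with rfl | rfl | rfl | rfl | rfl | rfl | rfl | rfl | rfl | rfl | rfl <;>
        simp [threeTable, List.lookup, a1, a2, a3, a4, a5, a6, a7]
    · rw [h2 hmem]
      have h3 : threeTable.lookup m = none := by
        rw [List.lookup_eq_none_iff]
        intro p hp
        simp only [bne_iff_ne]
        rintro rfl
        apply hmem
        exact (by decide : ∀ p ∈ threeTable, p.1 ∈ threeMasks) p hp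
      simp [h3]
  · rw [threeValue, indexSign_of_not_injective hj]
    simp

/-- The multi-indices where an invariant 3-form need not vanish, and their complements. -/
def threeIndices : List ((Fin 4 → Fin 7) × (Fin 3 → Fin 7)) :=
  [(![3, 4, 5, 6], ![0, 1, 2]), (![1, 2, 5, 6], ![0, 3, 4]), (![0, 2, 4, 6], ![1, 3, 5]),
    (![0, 2, 4, 5], ![1, 3, 6]), (![1, 2, 3, 4], ![0, 5, 6]), (![0, 2, 3, 6], ![1, 4, 5]),
    (![0, 2, 3, 5], ![1, 4, 6]), (![0, 1, 4, 6], ![2, 3, 5]), (![0, 1, 4, 5], ![2, 3, 6]),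
    (![0, 1, 3, 6], ![2, 4, 5]), (![0, 1, 3, 5], ![2, 4, 6])]

/-- The shuffles of type `(2, 2)` and their signs. -/
def shuffles : List (ℤ × Fin 4 × Fin 4 × Fin 4 × Fin 4) :=
  [(1, 0, 1, 2, 3), (-1, 0, 2, 1, 3), (1, 0, 3, 1, 2), (1, 1, 2, 0, 3), (-1, 1, 3, 0, 2),
    (1, 2, 3, 0, 1)]

/-- The terms of `ι_X φ ∧ ι_X φ ∧ φ` for the `i`-th frame vector `X`: coefficients and components. -/
def bryantTerms (i : Fin 7) : List (ℤ × ℕ × ℕ × ℕ) :=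
  (threeIndices.flatMap fun p => shuffles.map fun q =>
    (indexSign (joinVectors (k := 4) (l := 3) rfl p.1 p.2) * q.1 *
      (threeValue ![i, p.1 q.2.1, p.1 q.2.2.1]).1 *
        (threeValue ![i, p.1 q.2.2.2.1, p.1 q.2.2.2.2]).1 * (threeValue p.2).1,
      (threeValue ![i, p.1 q.2.1, p.1 q.2.2.1]).2,
        (threeValue ![i, p.1 q.2.2.2.1, p.1 q.2.2.2.2]).2, (threeValue p.2).2)).filter
    fun t => t.1 ≠ 0

theorem sum_filter_bryantTerms (l : List (ℤ × ℕ × ℕ × ℕ)) (c : ℕ → ℝ) :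
    ((l.filter fun t => t.1 ≠ 0).map fun t => (t.1 : ℝ) * c t.2.1 * c t.2.2.1 * c t.2.2.2).sum =
      (l.map fun t => (t.1 : ℝ) * c t.2.1 * c t.2.2.1 * c t.2.2.2).sum := by
  induction l with
  | nil => rfl
  | cons p l ih =>
    by_cases hp : p.1 = 0
    · simp only [List.map_cons, List.sum_cons, ← ih]
      simp [hp]
    · simp only [List.map_cons, List.sum_cons, ← ih]
      simp [hp]

theorem indexSign_threeIndices (p : (Fin 4 → Fin 7) × (Fin 3 → Fin 7)) (hp : p ∈ threeIndices) :
    indexSign (joinVectors (k := 4) (l := 3) rfl p.1 p.2) ≠ 0 := by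
  simp only [threeIndices, List.mem_cons, List.not_mem_nil, or_false] at hp
  rcases hp with rfl | rfl | rfl | rfl | rfl | rfl | rfl | rfl | rfl | rfl | rfl <;> decide

theorem strictMono_threeIndices (p : (Fin 4 → Fin 7) × (Fin 3 → Fin 7)) (hp : p ∈ threeIndices) :
    StrictMono p.2 := by
  have key : p.2 0 < p.2 1 ∧ p.2 1 < p.2 2 := by
    simp only [threeIndices, List.mem_cons, List.not_mem_nil, or_false] at hp
    rcases hp with rfl | rfl | rfl | rfl | rfl | rfl | rfl | rfl | rfl | rfl | rfl <;> decide
  rw [Fin.strictMono_iff_lt_succ]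
  intro i
  fin_cases i
  · exact key.1
  · exact key.2

theorem nodup_threeIndices : (threeIndices.map Prod.snd).Nodup := by
  decide

theorem threeValue_eq_zero (j : Fin 3 → Fin 7) (hj : StrictMono j)
    (h : j ∉ threeIndices.map Prod.snd) : (threeValue j).1 = 0 := by
  have key : ∀ a b c : Fin 7, a < b → b < c → ![a, b, c] ∈ threeIndices.map Prod.snd ∨
      (threeValue ![a, b, c]).1 = 0 := by
    decide +kernel
  rw [eq_vecCons_three j] at h ⊢
  exact (key _ _ _ (hj (by decide)) (hj (by decide))).resolve_left h

end Terms

end G2Sphere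

namespace G2Sphere

/-! ### The diagonal values of the cubic form -/

section BryantTerms

open Module

variable {V : Type*} [NormedAddCommGroup V] [NormedSpace ℝ V]

/-- Only the eleven index triples in `threeIndices` enter through the last factor, and six shuffles
through the 4-form, so the value is a finite list that the kernel can evaluate. -/
theorem bryantForm_basis (b : Basis (Fin 7) ℝ V) (φ : V [⋀^Fin 3]→L[ℝ] ℝ) (c : ℕ → ℝ)
    (h : ∀ j : Fin 3 → Fin 7, φ (b ∘ j) = (threeValue j).1 * c (threeValue j).2) (i : Fin 7) :
    bryantForm φ (b i) (b i) b = 1 / 6 * ((bryantTerms i).map fun t =>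
        (t.1 : ℝ) * c t.2.1 * c t.2.2.1 * c t.2.2.2).sum := by
  have h0 := wedge_basis_eq_sum b (rfl : 4 + 3 = 7)
    (wedge (k := 2) (l := 2) (φ.toAlternatingMap.curryLeft (b i)) (φ.toAlternatingMap.curryLeft (b i)))
    φ.toAlternatingMap threeIndices
    (fun p hp => ⟨not_not.mp fun hn => indexSign_threeIndices p hp (indexSign_of_not_injective hn),
      strictMono_threeIndices p hp⟩)
    nodup_threeIndices (fun j hj hj' => by
      change φ (b ∘ j) = 0
      rw [h, threeValue_eq_zero j hj hj', Int.cast_zero, zero_mul])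
  simp only [Fin.cast_eq_self] at h0
  have h2 (x y : Fin 7) : φ.toAlternatingMap.curryLeft (b i) ![b x, b y] =
      (threeValue ![i, x, y]).1 * c (threeValue ![i, x, y]).2 := by
    rw [← h]
    have h5 : Matrix.vecCons (b i) ![b x, b y] = b ∘ ![i, x, y] := by
      funext a
      fin_cases a <;> rfl
    rw [AlternatingMap.curryLeft_apply_apply, h5]
    rfl
  have h3 (j : Fin 3 → Fin 7) : φ.toAlternatingMap (b ∘ j) = _ := h j
  have h4 : bryantForm φ (b i) (b i) b = 1 / 6 * wedge (k := 4) (l := 3)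
    (wedge (k := 2) (l := 2) (φ.toAlternatingMap.curryLeft (b i)) (φ.toAlternatingMap.curryLeft (b i)))
      φ.toAlternatingMap (fun x => b x) := by
    rw [bryantForm_apply]
  rw [h4, h0]
  rw [bryantTerms, sum_filter_bryantTerms, List.map_flatMap, List.flatMap_def, List.sum_flatten,
      List.map_map]
  refine congrArg (fun l : List ℝ => 1 / 6 * l.sum) (List.map_congr_left fun p _ => ?_)
  rw [wedge_two_two]
  simp only [Function.comp_apply, h2, h3, shuffles, List.map_cons, List.map_nil, List.sum_cons, List.sum_nil]
  push_cast
  ring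

end BryantTerms

end G2Sphere

namespace G2Sphere

/-! ### Invariance of the metric and its diagonal form -/

section Metric

open Module

variable {V : Type*} [NormedAddCommGroup V] [NormedSpace ℝ V]

/-- The inner product for which `b` is orthonormal. -/
noncomputable def gram (b : Basis (Fin 7) ℝ V) : V →ₗ[ℝ] V →ₗ[ℝ] ℝ :=
  ∑ i, (b.coord i).smulRight (b.coord i)

theorem gram_apply (b : Basis (Fin 7) ℝ V) (X Y : V) :
    gram b X Y = ∑ i, b.repr X i * b.repr Y i := by
  simp [gram]

theorem gram_comm (b : Basis (Fin 7) ℝ V) (X Y : V) : gram b X Y = gram b Y X := by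
  simp only [gram_apply, mul_comm]

theorem gram_self_pos (b : Basis (Fin 7) ℝ V) {X : V} (hX : X ≠ 0) : 0 < gram b X X := by
  rw [gram_apply]
  have h0 : b.repr X ≠ 0 := by simpa using hX
  obtain ⟨i, hi⟩ := Finsupp.ne_iff.mp h0
  exact Finset.sum_pos' (fun i _ => mul_self_nonneg _) ⟨i, Finset.mem_univ _, mul_self_pos.mpr hi⟩

theorem sq_det_eq_prod_gram (b e : Basis (Fin 7) ℝ V) (h : ∀ i j, i ≠ j → gram b (e i) (e j) = 0) :
    b.det e ^ 2 = ∏ i, gram b (e i) (e i) := by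
  have h1 : (b.toMatrix e).transpose * b.toMatrix e = Matrix.diagonal fun i => gram b (e i) (e i) := by
    ext i j
    have h2 : ((b.toMatrix e).transpose * b.toMatrix e) i j = gram b (e i) (e j) := by
      rw [gram_apply]
      rfl
    rw [h2]
    by_cases hij : i = j
    · subst hij
      simp
    · rw [h i j hij, Matrix.diagonal_apply_ne _ hij]
  have h3 := congrArg Matrix.det h1
  rw [Matrix.det_mul, Matrix.det_transpose, Matrix.det_diagonal] at h3
  rw [Basis.det_apply, sq, h3]

/-- Dividing `e i` by `c i` gives a basis with the same inner product and volume form as `b`, which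
can therefore replace `b` in the Hodge star. The lengths may be negative: that is how the
orientation of `e` is recorded. -/
theorem g2Star_eq_scaled {φ : V [⋀^Fin 3]→L[ℝ] ℝ} {b e : Basis (Fin 7) ℝ V} (hb : IsG2Frame φ b)
    (h : ∀ i j, i ≠ j → gram b (e i) (e j) = 0) {c : Fin 7 → ℝ} (hc : ∀ i, c i ≠ 0)
    (hg : ∀ i, gram b (e i) (e i) = c i ^ 2) (hd : b.det e = ∏ i, c i) {k l : ℕ} (hkl : k + l = 7)
    (β : V [⋀^Fin k]→L[ℝ] ℝ) {s : Fin k → Fin 7} {j : Fin l → Fin 7}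
    (hs : Function.Injective (joinVectors hkl s j)) :
    g2Star φ hkl β (e ∘ j) =
      indexSign (joinVectors hkl s j) * (∏ a, c (j a)) / (∏ a, c (s a)) * β (e ∘ s) := by
  set b0 : Basis (Fin 7) ℝ V := e.isUnitSMul fun i => (hc i).isUnit.inv with hb0
  have e0 (i : Fin 7) : e i = c i • b0 i := by
    rw [hb0, Basis.isUnitSMul_apply, smul_smul, mul_inv_cancel₀ (hc i), one_smul]
  have r0 (X : V) (i : Fin 7) : b0.repr X i = c i * e.repr X i := by
    have h1 : X = ∑ i, (c i * e.repr X i) • b0 i := by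
      conv_lhs => rw [← e.sum_repr X]
      refine Finset.sum_congr rfl fun i _ => ?_
      rw [e0 i, smul_smul, mul_comm]
    conv_lhs => rw [h1]
    rw [b0.repr_sum_self]
  have hG : gram b = gram b0 := by
    refine LinearMap.ext_basis e e fun i j => ?_
    rw [gram_apply b0]
    simp only [r0, Basis.repr_self]
    by_cases hij : i = j
    · subst hij
      rw [hg, Finset.sum_eq_single i]
      · simp [sq]
      · intro k _ hk
        simp [hk.symm]
      · simp
    · rw [h i j hij, Finset.sum_eq_zero]
      intro k _
      by_cases hk : k = i
      · subst hk
        simp [Ne.symm hij]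
      · simp [Finsupp.single_apply, Ne.symm hk]
  have hdet : b.det = b0.det := by
    rw [b.det.eq_smul_basis_det e, b0.det.eq_smul_basis_det e, hd]
    congr 1
    have h1 : (e : Fin 7 → V) = fun i => c i • b0 i := funext e0
    rw [h1, AlternatingMap.map_smul_univ, b0.det_self, smul_eq_mul, mul_one]
  have h2 : g2Star φ hkl β = hodgeStar b0 hkl β := by
    rw [g2Star_eq hb]
    refine hodgeStar_congr (fun X Y => ?_) hdet hkl β
    rw [← gram_apply, ← gram_apply, hG]
  have h3 {m : ℕ} (j : Fin m → Fin 7) : e ∘ j = fun a => c (j a) • (b0 ∘ j) a :=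
    funext fun a => e0 (j a)
  have hsc : ∏ a, c (s a) ≠ 0 := Finset.prod_ne_zero_iff.mpr fun a _ => hc (s a)
  rw [h2, h3 j, h3 s, ContinuousAlternatingMap.map_smul_univ, ContinuousAlternatingMap.map_smul_univ,
    hodgeStar_basis b0 hkl β hs, smul_eq_mul, smul_eq_mul]
  field_simp

theorem SForm.IsFixedBy.exists_frame {φ : SForm 3} {g : H2 ≃ₗᵢ[ℝ] H2} (hφ : φ.IsFixedBy g)
    {x x' : S7} (hx : sphereMap g x = x') {b : Basis (Fin 7) ℝ (TS x)} (hb : IsG2Frame (φ x) b) :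
    ∃ b' : Basis (Fin 7) ℝ (TS x'), IsG2Frame (φ x') b' ∧
      ∀ (v : TS x) (w : TS x'), (w : H2) = g v → b'.repr w = b.repr v := by
  -- Keeping `x'` free lets the equation of points be eliminated, so that the two tangent spaces
  -- become the same type.
  subst hx
  refine ⟨b.map (tangentEquiv g x).toLinearEquiv, IsG2Frame.map (tangentEquiv g x) ?_, ?_⟩
  · rw [coe_tangentEquiv, hφ x]
    exact hb
  · intro v w hw
    have : w = tangentEquiv g x v := Subtype.ext hw
    subst this
    simp

theorem gram_isotropy {φ : SForm 3} {n : Fin 4} {g : H2 ≃ₗᵢ[ℝ] H2} (hφ : φ.IsFixedBy g)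
    (hg : IsIsotropy n g) {b : Basis (Fin 7) ℝ (TS basePoint)} (hb : IsG2Frame (φ basePoint) b)
    (j : Fin 2 → Fin 7) : gram b (tangentBasis (j 0)) (tangentBasis (j 1)) =
      ((∏ a, isotropySign n (j a) : ℤ) : ℝ) *
        gram b (tangentBasis ((isotropyIndex n ∘ j) 0)) (tangentBasis ((isotropyIndex n ∘ j) 1)) := by
  obtain ⟨b', hb', hr⟩ := hφ.exists_frame hg.1 hb
  have h1 : gram b = gram b' := by
    ext X Y
    rw [gram_apply, gram_apply, (hb.unique hb').1]
  have h2 (i : Fin 7) : b'.repr ((isotropySign n i : ℝ) • tangentBasis (isotropyIndex n i)) =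
      b.repr (tangentBasis i) := by
    apply hr
    rw [Submodule.coe_smul, coe_tangentBasis, coe_tangentBasis, hg.2]
  have h3 : gram b (tangentBasis (j 0)) (tangentBasis (j 1)) =
      gram b' ((isotropySign n (j 0) : ℝ) • tangentBasis (isotropyIndex n (j 0)))
        ((isotropySign n (j 1) : ℝ) • tangentBasis (isotropyIndex n (j 1))) := by
    rw [gram_apply, gram_apply, h2, h2]
  rw [h3, h1, map_smul, map_smul, LinearMap.smul_apply, Fin.prod_univ_two]
  simp only [smul_eq_mul, Function.comp_apply]
  push_cast
  ring

theorem gram_word {φ : SForm 3} (hφ : φ.IsInvariant Sp2U1)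
    {b : Basis (Fin 7) ℝ (TS basePoint)} (hb : IsG2Frame (φ basePoint) b) {w : List (Fin 4)}
    (hw : 3 ∉ w) (j : Fin 2 → Fin 7) : gram b (tangentBasis (j 0)) (tangentBasis (j 1)) =
      wordSign w j * gram b (tangentBasis (wordIndex w j 0)) (tangentBasis (wordIndex w j 1)) := by
  refine apply_eq_wordSign_mul (T := fun j => gram b (tangentBasis (j 0)) (tangentBasis (j 1))) w
    (fun n hn j => ?_) j
  obtain ⟨g, hg, hi⟩ := Sp2U1_isotropy hw n hn
  exact gram_isotropy (hφ g hg) hi hb j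

/-- By uniqueness the metric inherits the isotropy symmetry. For each pair of distinct frame vectors
some word fixes or swaps the pair with total sign `-1`; for each diagonal entry some word moves it
to one of three representatives. -/
theorem gram_tangentBasis {φ : SForm 3} (hφ : φ.IsInvariant Sp2U1)
    {b : Basis (Fin 7) ℝ (TS basePoint)} (hb : IsG2Frame (φ basePoint) b) :
    (∀ i j, i ≠ j → gram b (tangentBasis i) (tangentBasis j) = 0) ∧
      ∀ i, gram b (tangentBasis i) (tangentBasis i) =
        gram b (tangentBasis (![0, 1, 1, 3, 3, 3, 3] i)) (tangentBasis (![0, 1, 1, 3, 3, 3, 3] i)) := by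
  constructor
  · have key : ∀ i j : Fin 7, i ≠ j → ∃ w ∈ [[0], [1], [2], [0, 0], [2, 2], [0, 1]],
        3 ∉ w ∧ wordSign w ![i, j] = -1 ∧
          ((wordIndex w ![i, j] 0 = i ∧ wordIndex w ![i, j] 1 = j) ∨
            (wordIndex w ![i, j] 0 = j ∧ wordIndex w ![i, j] 1 = i)) := by
      decide +kernel
    intro i j hij
    obtain ⟨w, -, h3, hs, hw⟩ := key i j hij
    have h1 := gram_word hφ hb h3 ![i, j]
    rw [hs] at h1
    simp only [Matrix.cons_val_zero, Matrix.cons_val_one, Matrix.cons_val_fin_one] at h1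
    push_cast at h1
    rcases hw with ⟨h4, h5⟩ | ⟨h4, h5⟩
    · rw [h4, h5] at h1
      linarith
    · rw [h4, h5, gram_comm b (tangentBasis j)] at h1
      linarith
  · have key : ∀ i : Fin 7, ∃ w ∈ [[], [0], [1], [2], [0, 1]], 3 ∉ w ∧ wordSign w ![i, i] = 1 ∧
        wordIndex w ![i, i] 0 = ![0, 1, 1, 3, 3, 3, 3] i ∧
          wordIndex w ![i, i] 1 = ![0, 1, 1, 3, 3, 3, 3] i := by
      decide +kernel
    intro i
    obtain ⟨w, -, h3, hs, h4, h5⟩ := key i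
    have h1 := gram_word hφ hb h3 ![i, i]
    rw [hs, h4, h5] at h1
    simpa using h1

end Metric

end G2Sphere

namespace G2Sphere

/-! ### The parameters `p`, `q`, `R` of an invariant positive form -/

section MetricParameters

open Module

/-- The signed lengths of the frame vectors. -/
noncomputable def frameLength (σ p q R : ℝ) : Fin 7 → ℝ := ![σ * p, q, q, √R, √R, √R, √R]

/-- `φ` has, at the base point, the metric `diag(p², q², q², R, R, R, R)` and the components
that correspond to it. -/
structure HasMetric (φ : SForm 3) (σ s p q R : ℝ) : Prop where
  sq_orientation : σ * σ = 1
  sq_sign : s * s = 1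
  p_pos : 0 < p
  q_pos : 0 < q
  R_pos : 0 < R
  comp_vertical : φ.comp 7 = s * (p * q ^ 2)
  comp_mixed : φ.comp 25 = s * (p * R)
  comp_sq_add : φ.comp 42 ^ 2 + φ.comp 74 ^ 2 = q ^ 2 * R ^ 2
  star_basis : ∀ {k l : ℕ} (hkl : k + l = 7) (β : TS basePoint [⋀^Fin k]→L[ℝ] ℝ)
    {s : Fin k → Fin 7} {j : Fin l → Fin 7}, Function.Injective (joinVectors hkl s j) →
    g2Star (φ basePoint) hkl β (tangentBasis ∘ j) = indexSign (joinVectors hkl s j) *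
      (∏ a, frameLength σ p q R (j a)) / (∏ a, frameLength σ p q R (s a)) * β (tangentBasis ∘ s)

theorem parameters_of_bryant {a b N D G0 G1 G3 : ℝ} (h0 : 0 < G0) (h1 : 0 < G1) (h3 : 0 < G3)
    (hD : D ^ 2 = G0 * G1 ^ 2 * G3 ^ 4) (e0 : G0 * D = -(a * b ^ 2)) (e1 : G1 * D = -(a * N))
    (e3 : G3 * D = -(b * N)) :
    ∃ σ s p q : ℝ, σ * σ = 1 ∧ s * s = 1 ∧ 0 < p ∧ 0 < q ∧ G0 = p ^ 2 ∧ G1 = q ^ 2 ∧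
      D = σ * p * q ^ 2 * G3 ^ 2 ∧ a = s * (p * q ^ 2) ∧ b = s * (p * G3) ∧
        N = q ^ 2 * G3 ^ 2 := by
  obtain ⟨p, hp, rfl⟩ : ∃ p, 0 < p ∧ G0 = p ^ 2 := ⟨√G0, Real.sqrt_pos.mpr h0, (Real.sq_sqrt h0.le).symm⟩
  obtain ⟨q, hq, rfl⟩ : ∃ q, 0 < q ∧ G1 = q ^ 2 := ⟨√G1, Real.sqrt_pos.mpr h1, (Real.sq_sqrt h1.le).symm⟩
  obtain ⟨σ, hσ, hDσ⟩ : ∃ σ : ℝ, σ * σ = 1 ∧ D = σ * p * q ^ 2 * G3 ^ 2 := by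
    have h2 : D ^ 2 = (p * q ^ 2 * G3 ^ 2) ^ 2 := by rw [hD]; ring
    rcases sq_eq_sq_iff_eq_or_eq_neg.mp h2 with h | h
    · exact ⟨1, by norm_num, by rw [h]; ring⟩
    · exact ⟨-1, by norm_num, by rw [h]; ring⟩
  have hσ0 : σ ≠ 0 := by
    rintro rfl
    norm_num at hσ
  subst hDσ
  have hN : N ≠ 0 := by
    rintro rfl
    rw [mul_zero, neg_zero] at e1
    have : q ^ 2 * (σ * p * q ^ 2 * G3 ^ 2) ≠ 0 := by positivity
    exact this e1
  -- Eliminate `D` from `e1` and `e3`, then cancel `N`.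
  have h4 : a * G3 = b * q ^ 2 := by
    apply mul_right_cancel₀ hN
    linear_combination G3 * e1 - q ^ 2 * e3
  have ha : a = -σ * (p * q ^ 2) := by
    -- With `b` eliminated, `e0` determines the cube of `a`, hence `a` with its sign; the common
    -- sign of the components comes out as `-σ`.
    have h5 : a ^ 3 = (-σ * (p * q ^ 2)) ^ 3 := by
      have hG : G3 ^ 2 ≠ 0 := by positivity
      apply mul_right_cancel₀ hG
      have h6 : a ^ 3 * G3 ^ 2 = a * b ^ 2 * q ^ 4 := by
        calc a ^ 3 * G3 ^ 2 = a * (a * G3) ^ 2 := by ring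
          _ = _ := by rw [h4]; ring
      have h7 : σ ^ 3 = σ := by linear_combination σ * hσ
      rw [h6, mul_pow, neg_pow, h7]
      linear_combination q ^ 4 * e0
    exact (Odd.strictMono_pow (by decide : Odd 3)).injective h5
  have hb : b = -σ * (p * G3) := by
    apply mul_right_cancel₀ (pow_ne_zero 2 hq.ne')
    rw [← h4, ha]
    ring
  refine ⟨σ, -σ, p, q, hσ, by linear_combination hσ, hp, hq, rfl, rfl, rfl, ha, hb, ?_⟩
  have h8 : σ * p * G3 ≠ 0 := by positivity
  apply mul_left_cancel₀ h8
  rw [hb] at e3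
  linear_combination -e3

/-- The defining relation, evaluated on one vector from each of the three metric blocks, gives three
equations. Together with the Gram determinant they determine the components up to a sign and a
rotation in the last two. -/
theorem exists_hasMetric {φ : SForm 3} (hφ : φ.IsInvariant Sp2U1)
    (hp : IsPositiveForm (φ basePoint)) : ∃ σ s p q R, HasMetric φ σ s p q R := by
  obtain ⟨b, hb⟩ := hp
  obtain ⟨g1, g2⟩ := gram_tangentBasis hφ hb
  have hpos (i : Fin 7) := gram_self_pos b (tangentBasis.ne_zero i)
  have hB (i : Fin 7) := congrArg (fun f => f tangentBasis) (hb (tangentBasis i) (tangentBasis i))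
  simp only [AlternatingMap.smul_apply, smul_eq_mul, ← gram_apply,
    bryantForm_basis tangentBasis (φ basePoint) φ.comp (SForm.apply_three hφ)] at hB
  -- After division by 6 the three lists sum to `-a b²`, `-a (c² + e²)` and `-b (c² + e²)`.
  have t0 : bryantTerms 0 = [(-1, 25, 25, 7), (-1, 25, 25, 7), (-1, 7, 25, 25), (-1, 25, 7, 25),
      (-1, 7, 25, 25), (-1, 25, 7, 25)] := by decide +kernel
  have t1 : bryantTerms 1 = [(-1, 42, 42, 7), (-1, 74, 74, 7), (-1, 74, 74, 7), (-1, 42, 42, 7),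
      (-1, 7, 42, 42), (-1, 42, 7, 42), (-1, 7, 74, 74), (-1, 74, 7, 74), (-1, 7, 74, 74),
      (-1, 74, 7, 74), (-1, 7, 42, 42), (-1, 42, 7, 42)] := by decide +kernel
  have t3 : bryantTerms 3 = [(-1, 42, 42, 25), (-1, 74, 74, 25), (-1, 74, 74, 25),
      (-1, 42, 42, 25), (-1, 25, 42, 42), (-1, 42, 25, 42), (-1, 25, 74, 74), (-1, 74, 25, 74),
      (-1, 25, 74, 74), (-1, 74, 25, 74), (-1, 25, 42, 42), (-1, 42, 25, 42)] := by decide +kernel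
  have hdet := sq_det_eq_prod_gram b tangentBasis g1
  have k0 := hB 0
  have k1 := hB 1
  have k3 := hB 3
  simp only [t0, t1, t3, List.map_cons, List.map_nil, List.sum_cons, List.sum_nil] at k0 k1 k3
  push_cast at k0 k1 k3
  simp only [Fin.prod_univ_seven] at hdet
  have d2 := g2 2
  have d4 := g2 4
  have d5 := g2 5
  have d6 := g2 6
  simp only [Matrix.cons_val] at d2 d4 d5 d6
  rw [d2, d4, d5, d6] at hdet
  obtain ⟨σ, s, p, q, hσ, hs, hp0, hq0, e0, e1, eD, ha, hb', hN⟩ :=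
    parameters_of_bryant (a := φ.comp 7) (b := φ.comp 25) (N := φ.comp 42 ^ 2 + φ.comp 74 ^ 2)
      (D := b.det tangentBasis) (hpos 0) (hpos 1) (hpos 3) (by rw [hdet]; ring)
      (by rw [← k0]; ring) (by rw [← k1]; ring) (by rw [← k3]; ring)
  set R := gram b (tangentBasis 3) (tangentBasis 3) with hR
  have hRpos : 0 < R := hpos 3
  have hsq := Real.sq_sqrt hRpos.le
  have hσ0 : σ ≠ 0 := by
    rintro rfl
    norm_num at hσ
  have hr0 : √R ≠ 0 := (Real.sqrt_pos.mpr hRpos).ne'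
  refine ⟨σ, s, p, q, R, hσ, hs, hp0, hq0, hRpos, ha, hb', hN, ?_⟩
  intro k l hkl β s j hinj
  -- The orientation sign sits in the first length, so the product of the lengths is the signed
  -- determinant.
  refine g2Star_eq_scaled hb g1 (c := frameLength σ p q R) ?_ ?_ ?_ hkl β hinj
  · intro i
    fin_cases i <;> simp [frameLength, hσ0, hp0.ne', hq0.ne', hr0]
  · intro i
    rw [g2 i]
    fin_cases i <;> simp [frameLength, e0, e1, ← hR, hsq]
    linear_combination (-p ^ 2) * hσ
  · rw [eD, Fin.prod_univ_seven]
    simp only [frameLength, Matrix.cons_val]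
    have : √R * √R = R := Real.mul_self_sqrt hRpos.le
    linear_combination (-(σ * p * q ^ 2) * (√R * √R + R)) * this

end MetricParameters

end G2Sphere

namespace G2Sphere

/-! ### The Laplacian in components -/

section LaplacianComponents

open Module

theorem SForm.IsInvariant.fixed {k : ℕ} {η : SForm k} (hη : η.IsInvariant Sp2U1) (A : Sp2) :
    η.IsFixedBy (quatAction (A, 1)) := hη _ (quatAction_mem_Sp2U1 A (one_mem U1))

theorem SForm.IsInvariant.d {k : ℕ} {η : SForm k} (hη : η.IsInvariant Sp2U1) :
    (SForm.d η).IsInvariant Sp2U1 := fun g hg => SForm.IsFixedBy.d (hη g hg)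

theorem SForm.IsInvariant.star {φ : SForm 3} (hφ : φ.IsInvariant Sp2U1) {k l : ℕ} (h : k + l = 7)
    {η : SForm k} (hη : η.IsInvariant Sp2U1) : (SForm.star φ h η).IsInvariant Sp2U1 :=
  fun g hg => SForm.IsFixedBy.star (hφ g hg) h (hη g hg)

theorem SForm.IsInvariant.codiff {φ : SForm 3} (hφ : φ.IsInvariant Sp2U1) {k l : ℕ}
    (h : k + 1 + l = 7) {η : SForm (k + 1)} (hη : η.IsInvariant Sp2U1) :
    (SForm.codiff φ h η).IsInvariant Sp2U1 :=
  fun g hg => SForm.IsFixedBy.codiff (hφ g hg) h (hη g hg)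

theorem SForm.comp_add {k : ℕ} (η θ : SForm k) (m : ℕ) :
    (η + θ).comp m = η.comp m + θ.comp m := by
  simp only [SForm.comp, component]
  split_ifs
  · rfl
  · rw [add_zero]

theorem SForm.comp_smul {k : ℕ} (c : ℝ) (η : SForm k) (m : ℕ) :
    (c • η).comp m = c * η.comp m := by
  simp only [SForm.comp, component]
  split_ifs
  · rfl
  · rw [mul_zero]

theorem SForm.comp_d_eq {k : ℕ} {η : SForm k} (hη : η.IsInvariant Sp2U1) (j : Fin (k + 1) → Fin 7)
    (m : ℕ) (L : List (ℤ × ℕ))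
    (h : indexMask j = m ∧ (∀ a b, a < b → j a < j b) ∧ derivTerms j = L) :
    (SForm.d η).comp m = (L.map fun p => (p.1 : ℝ) * η.comp p.2).sum := by
  rw [← h.1, SForm.comp_d hη.fixed h.2.1, h.2.2]

theorem HasMetric.comp_star {φ : SForm 3} {σ s p q R : ℝ} (H : HasMetric φ σ s p q R) {k l : ℕ}
    (hkl : k + l = 7) (η : SForm k) (i : Fin k → Fin 7) (j : Fin l → Fin 7) (z : ℤ) (m m' : ℕ)
    (h : indexMask j = m ∧ indexMask i = m' ∧ (∀ a b, a < b → j a < j b) ∧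
      (∀ a b, a < b → i a < i b) ∧ indexSign (joinVectors hkl i j) = z ∧ z ≠ 0) :
    (SForm.star φ hkl η).comp m = z * (∏ a, frameLength σ p q R (j a)) /
      (∏ a, frameLength σ p q R (i a)) * η.comp m' := by
  obtain ⟨rfl, rfl, hj, hi, rfl, hz⟩ := h
  rw [SForm.comp_indexMask _ fun a b => hj a b, SForm.comp_indexMask _ fun a b => hi a b]
  refine H.star_basis hkl (η basePoint) ?_
  by_contra hn
  exact hz (indexSign_of_not_injective hn)

/-- The effect of `-σ ⋆ d` on the components of an invariant 3-form, up to its last component. -/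
noncomputable def starDeriv (p q R a b c : ℝ) : ℝ × ℝ × ℝ :=
  (2 * (p * q ^ 2 / R ^ 2) * (2 * b + 4 * c), p / q ^ 2 * (2 * a - 2 * b + 4 * c),
    (2 * a + 2 * b) / p)

/-- The last component of `η` never enters, and `⋆ d η` has none: the operator lives on the first
three. This decouples the Laplacian. -/
theorem HasMetric.comp_star_d {φ : SForm 3} {σ s p q R : ℝ} (H : HasMetric φ σ s p q R)
    {η : SForm 3} (hη : η.IsInvariant Sp2U1) :
    (SForm.star φ rfl (SForm.d η) : SForm 3).comp 7 =
        -σ * (starDeriv p q R (η.comp 7) (η.comp 25) (η.comp 42)).1 ∧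
      (SForm.star φ rfl (SForm.d η) : SForm 3).comp 25 =
        -σ * (starDeriv p q R (η.comp 7) (η.comp 25) (η.comp 42)).2.1 ∧
      (SForm.star φ rfl (SForm.d η) : SForm 3).comp 42 =
        -σ * (starDeriv p q R (η.comp 7) (η.comp 25) (η.comp 42)).2.2 ∧
      (SForm.star φ rfl (SForm.d η) : SForm 3).comp 74 = 0 := by
  obtain ⟨a1, a2, a3, a4, a5, a6, a7⟩ := SForm.comp_three hη
  have hp := H.p_pos
  have hq := H.q_pos
  have hR := H.R_pos
  have hσ := H.sq_orientation
  have hσ0 : σ ≠ 0 := by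
    rintro rfl
    norm_num at hσ
  obtain ⟨r, hr, hrR⟩ : ∃ r, 0 < r ∧ R = r ^ 2 := ⟨√R, Real.sqrt_pos.mpr hR, (Real.sq_sqrt hR.le).symm⟩
  have hsq : √(r ^ 2) = r := Real.sqrt_sq hr.le
  refine ⟨?_, ?_, ?_, ?_⟩
  · rw [H.comp_star rfl (SForm.d η) ![3, 4, 5, 6] ![0, 1, 2] 1 7 120 (by decide),
      SForm.comp_d_eq hη ![3, 4, 5, 6] 120 [(1, 97), (-1, 82), (1, 52), (1, 97), (-1, 76), (-1, 42),
        (-1, 82), (-1, 76), (-1, 25), (1, 52), (-1, 42), (-1, 25)] (by decide)]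
    simp only [List.map_cons, List.map_nil, List.sum_cons, List.sum_nil, Fin.prod_univ_succ, a1, a3,
      a5, a6, starDeriv, frameLength, hsq, hrR]
    simp
    field_simp
    ring
  · rw [H.comp_star rfl (SForm.d η) ![1, 2, 5, 6] ![0, 3, 4] 1 25 102 (by decide),
      SForm.comp_d_eq hη ![1, 2, 5, 6] 102 [(-1, 97), (-1, 97), (-1, 76), (-1, 82), (-1, 7),
        (1, 52), (-1, 42), (-1, 7)] (by decide)]
    simp only [List.map_cons, List.map_nil, List.sum_cons, List.sum_nil, Fin.prod_univ_succ, a1, a3,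
      a5, a6, starDeriv, frameLength, hsq, hrR]
    simp
    field_simp
    ring
  · rw [H.comp_star rfl (SForm.d η) ![0, 2, 4, 6] ![1, 3, 5] 1 42 85 (by decide),
      SForm.comp_d_eq hη ![0, 2, 4, 6] 85 [(1, 82), (1, 82), (-1, 76), (1, 97), (-1, 7), (1, 52),
        (-1, 25), (-1, 7)] (by decide)]
    simp only [List.map_cons, List.map_nil, List.sum_cons, List.sum_nil, Fin.prod_univ_succ, a1, a3,
      a5, a6, starDeriv, frameLength, hsq, hrR]
    simp
    field_simp
    linear_combination 2 * (η.comp 7 + η.comp 25) * hσ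
  · rw [H.comp_star rfl (SForm.d η) ![0, 2, 4, 5] ![1, 3, 6] (-1) 74 53 (by decide),
      SForm.comp_d_eq hη ![0, 2, 4, 5] 53 [(1, 50), (1, 50), (-1, 44), (-1, 84)] (by decide)]
    simp only [List.map_cons, List.map_nil, List.sum_cons, List.sum_nil, a2, a4, a7]
    simp

/-- For an invariant 2-form the derivative terms of the first three components are empty lists. The
last one involves only the 2-form components 6 and 24, up to sign, and for `δ_φ φ` both are
multiples of `φ.comp 74`. -/
theorem HasMetric.comp_d_codiff {φ : SForm 3} {σ s p q R : ℝ} (H : HasMetric φ σ s p q R)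
    (hφ : φ.IsInvariant Sp2U1) :
    (SForm.d (SForm.codiff (k := 2) (l := 4) φ rfl φ)).comp 7 = 0 ∧
      (SForm.d (SForm.codiff (k := 2) (l := 4) φ rfl φ)).comp 25 = 0 ∧
      (SForm.d (SForm.codiff (k := 2) (l := 4) φ rfl φ)).comp 42 = 0 ∧
      (SForm.d (SForm.codiff (k := 2) (l := 4) φ rfl φ)).comp 74 =
        8 * (2 * q ^ 2 / R ^ 2 + 1 / q ^ 2) * φ.comp 74 := by
  have hi := hφ.codiff (k := 2) (l := 4) rfl hφ
  refine ⟨?_, ?_, ?_, ?_⟩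
  · simpa using SForm.comp_d_eq hi ![0, 1, 2] 7 [] (by decide)
  · simpa using SForm.comp_d_eq hi ![0, 3, 4] 25 [] (by decide)
  · simpa using SForm.comp_d_eq hi ![1, 3, 5] 42 [] (by decide)
  have hp := H.p_pos
  have hq := H.q_pos
  have hR := H.R_pos
  have hσ := H.sq_orientation
  have hσ0 : σ ≠ 0 := by
    rintro rfl
    norm_num at hσ
  obtain ⟨r, hr, hrR⟩ : ∃ r, 0 < r ∧ R = r ^ 2 := ⟨√R, Real.sqrt_pos.mpr hR, (Real.sq_sqrt hR.le).symm⟩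
  have hsq : √(r ^ 2) = r := Real.sqrt_sq hr.le
  have hs : (SForm.star φ rfl φ : SForm 4).IsInvariant Sp2U1 := hφ.star rfl hφ
  obtain ⟨f1, f2, f3⟩ := SForm.comp_four hs
  have c6 : (SForm.codiff (k := 2) (l := 4) φ rfl φ).comp 6 = -(8 * q ^ 2 / R ^ 2) * φ.comp 74 := by
    rw [SForm.codiff, SForm.comp_smul,
      H.comp_star _ (SForm.d (SForm.star φ rfl φ : SForm 4)) ![0, 3, 4, 5, 6] ![1, 2] 1 6 121 (by decide),
      SForm.comp_d_eq hs ![0, 3, 4, 5, 6] 121 [(1, 83), (-1, 53), (1, 77), (1, 43), (1, 83), (1, 77),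
        (-1, 53), (1, 43)] (by decide)]
    simp only [List.map_cons, List.map_nil, List.sum_cons, List.sum_nil, f1, f2, f3]
    rw [H.comp_star rfl φ ![1, 3, 6] ![0, 2, 4, 5] (-1) 53 74 (by decide)]
    simp only [Fin.prod_univ_succ, frameLength, hrR]
    simp [hsq]
    field_simp
    ring
  have c24 : (SForm.codiff (k := 2) (l := 4) φ rfl φ).comp 24 = -(4 / q ^ 2) * φ.comp 74 := by
    rw [SForm.codiff, SForm.comp_smul,
      H.comp_star _ (SForm.d (SForm.star φ rfl φ : SForm 4)) ![0, 1, 2, 5, 6] ![3, 4] 1 24 103 (by decide),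
      SForm.comp_d_eq hs ![0, 1, 2, 5, 6] 103 [(1, 77), (1, 83), (-1, 53), (1, 43)] (by decide)]
    simp only [List.map_cons, List.map_nil, List.sum_cons, List.sum_nil, f1, f2, f3]
    rw [H.comp_star rfl φ ![1, 3, 6] ![0, 2, 4, 5] (-1) 53 74 (by decide)]
    simp only [Fin.prod_univ_succ, frameLength, hrR]
    simp [hsq]
    field_simp
    ring
  rw [SForm.comp_d_eq hi ![1, 3, 6] 74 [(1, 96), (-1, 6), (-1, 24), (-1, 6)] (by decide)]
  simp only [List.map_cons, List.map_nil, List.sum_cons, List.sum_nil, SForm.comp_two hi, c6, c24]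
  push_cast
  ring

/-- On 4-forms `δ_φ = ⋆ d ⋆`, so the second summand of the Laplacian is `(⋆ d)² φ`, where the
orientation sign is squared away. -/
theorem HasMetric.comp_g2Laplacian {φ : SForm 3} {σ s p q R : ℝ} (H : HasMetric φ σ s p q R)
    (hφ : φ.IsInvariant Sp2U1) :
    ∃ a b c, (a, b, c) = starDeriv p q R (φ.comp 7) (φ.comp 25) (φ.comp 42) ∧
      ((SForm.g2Laplacian φ).comp 7, (SForm.g2Laplacian φ).comp 25, (SForm.g2Laplacian φ).comp 42) =
        starDeriv p q R a b c ∧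
      (SForm.g2Laplacian φ).comp 74 = 8 * (2 * q ^ 2 / R ^ 2 + 1 / q ^ 2) * φ.comp 74 := by
  obtain ⟨d1, d2, d3, d4⟩ := H.comp_d_codiff hφ
  have hθ : (SForm.star φ rfl (SForm.d φ) : SForm 3).IsInvariant Sp2U1 := hφ.star rfl hφ.d
  obtain ⟨s1, s2, s3, s4⟩ := H.comp_star_d hφ
  obtain ⟨t1, t2, t3, t4⟩ := H.comp_star_d hθ
  have hc (m : ℕ) : (SForm.g2Laplacian φ).comp m =
      (SForm.d (SForm.codiff (k := 2) (l := 4) φ rfl φ)).comp m +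
        (SForm.star φ rfl (SForm.d (SForm.star φ rfl (SForm.d φ) : SForm 3)) : SForm 3).comp m := by
    rw [SForm.g2Laplacian, SForm.hodgeLaplacian, SForm.comp_add, SForm.codiff, SForm.codiff,
      SForm.comp_smul (_ ^ (3 + 1))]
    norm_num
  have hσ := H.sq_orientation
  rw [s1, s2, s3] at t1 t2 t3
  refine ⟨_, _, _, rfl, ?_, ?_⟩
  · rw [hc, hc, hc, d1, d2, d3, t1, t2, t3]
    simp only [starDeriv, Prod.mk.injEq]
    refine ⟨?_, ?_, ?_⟩
    · linear_combination (2 * (p * q ^ 2 / R ^ 2) * (2 * (p / q ^ 2 * (2 * φ.comp 7 - 2 * φ.comp 25 +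
        4 * φ.comp 42)) + 4 * ((2 * φ.comp 7 + 2 * φ.comp 25) / p))) * hσ
    · linear_combination (p / q ^ 2 * (2 * (2 * (p * q ^ 2 / R ^ 2) * (2 * φ.comp 25 +
        4 * φ.comp 42)) - 2 * (p / q ^ 2 * (2 * φ.comp 7 - 2 * φ.comp 25 + 4 * φ.comp 42)) +
          4 * ((2 * φ.comp 7 + 2 * φ.comp 25) / p))) * hσ
    · linear_combination ((2 * (2 * (p * q ^ 2 / R ^ 2) * (2 * φ.comp 25 + 4 * φ.comp 42)) +
        2 * (p / q ^ 2 * (2 * φ.comp 7 - 2 * φ.comp 25 + 4 * φ.comp 42))) / p) * hσ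
  · rw [hc, d4, t4, add_zero]

end LaplacianComponents

end G2Sphere

namespace G2Sphere

/-! ### From infinitesimal to semi-global injectivity -/

section LocalInjectivity

open Filter Set

/-- A map that is locally injective at the points of `S` and a topological embedding on `S` is
injective on a neighbourhood of `S`. -/
theorem exists_isOpen_injOn {X Y : Type*} [PseudoMetricSpace X] [PseudoMetricSpace Y] {f : X → Y}
    {S : Set X} (hc : ∀ x ∈ S, ContinuousAt f x) (hi : ∀ x ∈ S, ∃ U ∈ 𝓝 x, InjOn f U)
    (he : ∀ x ∈ S, comap f (𝓝 (f x)) ⊓ 𝓟 S ≤ 𝓝 x) : ∃ V, IsOpen V ∧ S ⊆ V ∧ InjOn f V := by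
  have key : ∀ x : S, ∃ ρ ε : ℝ, 0 < ε ∧ ε ≤ ρ ∧ InjOn f (Metric.ball (x : X) ρ) ∧
      ∀ y ∈ S, dist (f y) (f x) < ε → dist y x < ρ / 2 := by
    rintro ⟨x, hx⟩
    obtain ⟨U, hU, hinj⟩ := hi x hx
    obtain ⟨ρ, hρ, hball⟩ := Metric.mem_nhds_iff.mp hU
    have h1 := he x hx (Metric.ball_mem_nhds x (half_pos hρ))
    rw [mem_inf_principal, mem_comap] at h1
    obtain ⟨T, hT, hTs⟩ := h1
    obtain ⟨ε, hε, hεT⟩ := Metric.mem_nhds_iff.mp hT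
    refine ⟨ρ, min ε ρ, lt_min hε hρ, min_le_right _ _, hinj.mono hball, fun y hy hd => ?_⟩
    exact hTs (hεT (hd.trans_le (min_le_left _ _))) hy
  choose ρ ε hε hερ hinj hS using key
  refine ⟨⋃ x : S, interior {z | dist z x < ε x / 2 ∧ dist (f z) (f x) < ε x / 2},
    isOpen_iUnion fun _ => isOpen_interior, fun x hx => ?_, ?_⟩
  · refine mem_iUnion.mpr ⟨⟨x, hx⟩, mem_interior_iff_mem_nhds.mpr ?_⟩
    have hpos := half_pos (hε ⟨x, hx⟩)
    exact inter_mem (Metric.ball_mem_nhds x hpos) (hc x hx (Metric.ball_mem_nhds (f x) hpos))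
  · intro z hz z' hz' hzz
    obtain ⟨x, hx⟩ := mem_iUnion.mp hz
    obtain ⟨y, hy⟩ := mem_iUnion.mp hz'
    replace hx := interior_subset hx
    replace hy := interior_subset hy
    -- Centring at the point with the larger `ε` makes the images of both centres `ε x`-close. Then
    -- `hS` puts `y` within `ρ x / 2` of `x`, and both `z` and `z'` fall into the ball where `f` is
    -- injective.
    wlog hle : ε y ≤ ε x generalizing x y z z'
    · exact (this hz' hz hzz.symm y x hy hx (le_of_not_ge hle)).symm
    obtain ⟨h1, h2⟩ := hx
    obtain ⟨h3, h4⟩ := hy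
    rw [← hzz] at h4
    have h5 : dist (f y) (f x) < ε x := by
      have := dist_triangle_left (f y) (f x) (f z)
      linarith
    have h6 := hS x y y.2 h5
    have h7 := hερ x
    have h8 := dist_triangle z' y x
    refine hinj x ?_ ?_ hzz
    · rw [Metric.mem_ball]
      linarith [hε x]
    · rw [Metric.mem_ball]
      linarith [hε x]

/-- An injective endomorphism in finite dimension is invertible, so the inverse function theorem
applies. Stating the hypothesis along lines reduces its verification to one-variable calculus. -/
theorem exists_mem_nhds_injOn {E : Type*} [NormedAddCommGroup E] [NormedSpace ℝ E]
    [FiniteDimensional ℝ E] {f : E → E} {x : E} (hf : ContDiffAt ℝ 1 f x)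
    (h : ∀ v, HasDerivAt (fun t : ℝ => f (x + t • v)) 0 0 → v = 0) : ∃ U ∈ 𝓝 x, InjOn f U := by
  have hs := hf.hasStrictFDerivAt one_ne_zero
  have : CompleteSpace E := FiniteDimensional.complete ℝ E
  have hinj : Function.Injective (fderiv ℝ f x) := by
    rw [injective_iff_map_eq_zero]
    intro v hv
    apply h
    have h1 := hs.hasFDerivAt.hasLineDerivAt v
    rw [hv] at h1
    exact h1
  let e : E ≃L[ℝ] E := (LinearEquiv.ofInjectiveEndo (fderiv ℝ f x).toLinearMap hinj).toContinuousLinearEquiv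
  have he : (e : E →L[ℝ] E) = fderiv ℝ f x := by
    ext v
    rfl
  rw [← he] at hs
  exact ⟨(hs.toOpenPartialHomeomorph f).source,
    (hs.toOpenPartialHomeomorph f).open_source.mem_nhds hs.mem_toOpenPartialHomeomorph_source,
    (hs.toOpenPartialHomeomorph f).injOn⟩

end LocalInjectivity

end G2Sphere

namespace G2Sphere

/-! ### The Laplacian in metric parameters and its linearization -/

section LaplaceMap

open Filter Set

/-- The components of `Δ_φ φ` in terms of the metric parameters `p`, `q`, `R` and the last
component of `φ`, if the signs of the components of `φ` are positive. -/
noncomputable def laplaceMap (y : ℝ × ℝ × ℝ × ℝ) : ℝ × ℝ × ℝ × ℝ :=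
  let x := starDeriv y.1 y.2.1 y.2.2.1 (y.1 * y.2.1 ^ 2) (y.1 * y.2.2.1)
    √(y.2.1 ^ 2 * y.2.2.1 ^ 2 - y.2.2.2 ^ 2)
  let z := starDeriv y.1 y.2.1 y.2.2.1 x.1 x.2.1 x.2.2
  (z.1, z.2.1, z.2.2, 8 * (2 * y.2.1 ^ 2 / y.2.2.1 ^ 2 + 1 / y.2.1 ^ 2) * y.2.2.2)

theorem contDiffAt_laplaceMap {y : ℝ × ℝ × ℝ × ℝ} (hp : 0 < y.1) (hq : 0 < y.2.1)
    (hR : 0 < y.2.2.1) (hc : 0 < y.2.1 ^ 2 * y.2.2.1 ^ 2 - y.2.2.2 ^ 2) :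
    ContDiffAt ℝ 1 laplaceMap y := by
  have hp' := hp.ne'
  have hq' : y.2.1 ^ 2 ≠ 0 := by positivity
  have hR' : y.2.2.1 ^ 2 ≠ 0 := by positivity
  have hc' := hc.ne'
  have h1 : ContDiffAt ℝ 1 (fun y : ℝ × ℝ × ℝ × ℝ => √(y.2.1 ^ 2 * y.2.2.1 ^ 2 - y.2.2.2 ^ 2)) y :=
    ContDiffAt.sqrt (by fun_prop) hc'
  unfold laplaceMap starDeriv
  fun_prop (disch := assumption)

/-- Here `u`, `v`, `w` are the logarithmic derivatives of `p`, `q`, `R`, so the variation of each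
monomial prefactor is a linear combination of them. The arguments vary too, which allows the lemma
to be applied twice for the square of `starDeriv`. -/
theorem hasDerivAt_starDeriv {s t u v w a₁ b₁ c₁ : ℝ} {p q R a b c : ℝ → ℝ} (hs : 0 < s)
    (ht : 0 < t) (p0 : p 0 = s) (q0 : q 0 = s) (R0 : R 0 = s ^ 2 / t) (hp : HasDerivAt p (s * u) 0)
    (hq : HasDerivAt q (s * v) 0) (hR : HasDerivAt R (s ^ 2 / t * w) 0) (ha : HasDerivAt a a₁ 0)
    (hb : HasDerivAt b b₁ 0) (hc : HasDerivAt c c₁ 0) :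
    HasDerivAt (fun τ => (starDeriv (p τ) (q τ) (R τ) (a τ) (b τ) (c τ)).1)
        (2 * (t ^ 2 / s) * ((u + 2 * v - 2 * w) * (2 * b 0 + 4 * c 0) + (2 * b₁ + 4 * c₁))) 0 ∧
      HasDerivAt (fun τ => (starDeriv (p τ) (q τ) (R τ) (a τ) (b τ) (c τ)).2.1)
        (1 / s * ((u - 2 * v) * (2 * a 0 - 2 * b 0 + 4 * c 0) + (2 * a₁ - 2 * b₁ + 4 * c₁))) 0 ∧
      HasDerivAt (fun τ => (starDeriv (p τ) (q τ) (R τ) (a τ) (b τ) (c τ)).2.2)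
        (1 / s * (-u * (2 * a 0 + 2 * b 0) + (2 * a₁ + 2 * b₁))) 0 := by
  have hq2 : q 0 ^ 2 ≠ 0 := by rw [q0]; positivity
  have hR2 : R 0 ^ 2 ≠ 0 := by rw [R0]; positivity
  have hp2 : p 0 ≠ 0 := by rw [p0]; positivity
  refine ⟨?_, ?_, ?_⟩
  · have h := (((hp.fun_mul (hq.fun_pow 2)).fun_div (hR.fun_pow 2) hR2).const_mul 2).fun_mul
      ((hb.const_mul 2).fun_add (hc.const_mul 4))
    refine h.congr_deriv ?_
    simp only [p0, q0, R0, Nat.add_one_sub_one, pow_one, Nat.cast_ofNat]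
    field_simp
  · have h := (hp.fun_div (hq.fun_pow 2) hq2).fun_mul
      (((ha.const_mul 2).fun_sub (hb.const_mul 2)).fun_add (hc.const_mul 4))
    refine h.congr_deriv ?_
    simp only [p0, q0, Nat.add_one_sub_one, pow_one, Nat.cast_ofNat]
    field_simp
  · have h := ((ha.const_mul 2).fun_add (hb.const_mul 2)).fun_div hp hp2
    refine h.congr_deriv ?_
    simp only [p0]
    field_simp
    ring

theorem eq_zero_of_linearization {t u v w : ℝ} (ht : 0 < t)
    (h1 : (u + 2 * v) * (20 * t + 12) - w * (24 * t + 12) = 0)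
    (h2 : (u - 2 * v) * (24 * t ^ 2 + 4 * t + 4) + t ^ 2 * (32 * u + 64 * v - 24 * w) +
      t * (16 * v - 8 * u) + 4 * w = 0)
    (h3 : -u * (24 * t ^ 2 + 4 * t + 4) + t ^ 2 * (32 * u + 64 * v - 24 * w) + 8 * t * u +
      4 * w = 0) : u = 0 ∧ v = 0 ∧ w = 0 := by
  have huv : (u - v) * (6 * t ^ 2 - t + 1) = 0 := by linear_combination (h2 - h3) / 8
  have h4 : 6 * t ^ 2 - t + 1 ≠ 0 := by nlinarith [sq_nonneg (t - 1)]
  have h5 : u = v := sub_eq_zero.mp ((mul_eq_zero.mp huv).resolve_right h4)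
  subst h5
  -- The combination is chosen to eliminate `w`; what remains has positive coefficients.
  have h6 : u * (6 * t ^ 3 + 2 * t ^ 2 + 4 * t + 2) = 0 := by
    linear_combination (2 * t + 1) / 4 * h3 - (6 * t ^ 2 - 1) / 12 * h1
  have h7 : 6 * t ^ 3 + 2 * t ^ 2 + 4 * t + 2 ≠ 0 := by positivity
  have h8 : u = 0 := (mul_eq_zero.mp h6).resolve_right h7
  subst h8
  have h9 : w * (24 * t + 12) = 0 := by linear_combination -h1
  exact ⟨rfl, rfl, (mul_eq_zero.mp h9).resolve_right (by positivity)⟩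

/-- The last parameter enters the square root quadratically and is zero here, so to first order it
decouples. The other three directions reduce to a linear system in logarithmic derivatives. -/
theorem laplaceMap_linearization {s t : ℝ} (hs : 0 < s) (ht : 0 < t) (d : ℝ × ℝ × ℝ × ℝ)
    (h : HasDerivAt (fun τ : ℝ => laplaceMap ((s, s, s ^ 2 / t, 0) + τ • d)) 0 0) : d = 0 := by
  obtain ⟨u, hu⟩ : ∃ u, d.1 = s * u := ⟨d.1 / s, by field_simp⟩
  obtain ⟨v, hv⟩ : ∃ v, d.2.1 = s * v := ⟨d.2.1 / s, by field_simp⟩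
  obtain ⟨w, hw⟩ : ∃ w, d.2.2.1 = s ^ 2 / t * w := ⟨d.2.2.1 / (s ^ 2 / t), by field_simp⟩
  obtain ⟨e, he⟩ : ∃ e, d.2.2.2 = e := ⟨_, rfl⟩
  set p : ℝ → ℝ := fun τ => s + τ * (s * u) with hp
  set q : ℝ → ℝ := fun τ => s + τ * (s * v) with hq
  set R : ℝ → ℝ := fun τ => s ^ 2 / t + τ * (s ^ 2 / t * w) with hR
  set c : ℝ → ℝ := fun τ => √(q τ ^ 2 * R τ ^ 2 - (τ * e) ^ 2) with hc
  have hline (τ : ℝ) : (s, s, s ^ 2 / t, (0 : ℝ)) + τ • d = (p τ, q τ, R τ, τ * e) := by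
    rw [show d = (s * u, s * v, s ^ 2 / t * w, e) from
      Prod.ext hu (Prod.ext hv (Prod.ext hw he))]
    simp [hp, hq, hR]
  simp only [hline] at h
  have lin (x y : ℝ) : HasDerivAt (fun τ : ℝ => x + τ * y) y 0 := by
    simpa using ((hasDerivAt_id (0 : ℝ)).mul_const y).const_add x
  have dp : HasDerivAt p (s * u) 0 := lin _ _
  have dq : HasDerivAt q (s * v) 0 := lin _ _
  have dR : HasDerivAt R (s ^ 2 / t * w) 0 := lin _ _
  have de : HasDerivAt (fun τ : ℝ => τ * e) e 0 := by simpa using lin 0 e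
  have p0 : p 0 = s := by simp [hp]
  have q0 : q 0 = s := by simp [hq]
  have R0 : R 0 = s ^ 2 / t := by simp [hR]
  have c0' : q 0 ^ 2 * R 0 ^ 2 - (0 * e) ^ 2 = (s ^ 3 / t) ^ 2 := by
    rw [q0, R0]
    ring
  have c0 : c 0 = s ^ 3 / t := by
    simp only [hc]
    rw [c0', Real.sqrt_sq (by positivity)]
  have dc : HasDerivAt c (s ^ 3 / t * (v + w)) 0 := by
    have h1 := (((dq.fun_pow 2).fun_mul (dR.fun_pow 2)).fun_sub (de.fun_pow 2)).sqrt
      (by rw [c0']; positivity)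
    refine h1.congr_deriv ?_
    rw [c0', Real.sqrt_sq (by positivity), q0, R0]
    simp only [Nat.add_one_sub_one, pow_one, Nat.cast_ofNat]
    field_simp
    ring
  have da : HasDerivAt (fun τ => p τ * q τ ^ 2) (s ^ 3 * (u + 2 * v)) 0 := by
    refine (dp.fun_mul (dq.fun_pow 2)).congr_deriv ?_
    rw [p0, q0]
    push_cast
    ring
  have db : HasDerivAt (fun τ => p τ * R τ) (s ^ 3 / t * (u + w)) 0 := by
    refine (dp.fun_mul dR).congr_deriv ?_
    rw [p0, R0]
    ring
  obtain ⟨x1, x2, x3⟩ := hasDerivAt_starDeriv hs ht p0 q0 R0 dp dq dR da db dc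
  obtain ⟨z1, z2, z3⟩ := hasDerivAt_starDeriv hs ht p0 q0 R0 dp dq dR x1 x2 x3
  have h1 := z1.unique h.fst
  have h2 := z2.unique h.snd.fst
  have h3 := z3.unique h.snd.snd.fst
  -- The last component is a nonzero factor times `τ e`; at `τ = 0` the derivative of the factor
  -- does not matter.
  have h4 : e = 0 := by
    have hG : DifferentiableAt ℝ (fun τ => 8 * (2 * q τ ^ 2 / R τ ^ 2 + 1 / q τ ^ 2)) 0 := by
      have d1 := dq.differentiableAt
      have d2 := dR.differentiableAt
      have n1 : q 0 ^ 2 ≠ 0 := by rw [q0]; positivity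
      have n2 : R 0 ^ 2 ≠ 0 := by rw [R0]; positivity
      fun_prop (disch := assumption)
    have h5 := (hG.hasDerivAt.fun_mul de).unique h.snd.snd.snd
    rw [zero_mul, mul_zero, zero_add, q0, R0] at h5
    have h6 : 8 * (2 * s ^ 2 / (s ^ 2 / t) ^ 2 + 1 / s ^ 2) ≠ 0 := by positivity
    exact (mul_eq_zero.mp h5).resolve_left h6
  simp only [starDeriv, p0, q0, R0, c0, Prod.fst_zero, Prod.snd_zero] at h1 h2 h3
  have e1 : 2 * t * s * ((u + 2 * v) * (20 * t + 12) - w * (24 * t + 12)) = 0 := by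
    rw [← h1]
    field_simp
    ring
  have e2 : s / t * ((u - 2 * v) * (24 * t ^ 2 + 4 * t + 4) + t ^ 2 * (32 * u + 64 * v - 24 * w) +
      t * (16 * v - 8 * u) + 4 * w) = 0 := by
    rw [← h2]
    field_simp
    ring
  have e3 : s / t * (-u * (24 * t ^ 2 + 4 * t + 4) + t ^ 2 * (32 * u + 64 * v - 24 * w) +
      8 * t * u + 4 * w) = 0 := by
    rw [← h3]
    field_simp
    ring
  obtain ⟨rfl, rfl, rfl⟩ := eq_zero_of_linearization ht
    ((mul_eq_zero.mp e1).resolve_left (by positivity))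
    ((mul_eq_zero.mp e2).resolve_left (by positivity))
    ((mul_eq_zero.mp e3).resolve_left (by positivity))
  rw [mul_zero] at hu hv hw
  exact Prod.ext hu (Prod.ext hv (Prod.ext hw (he.trans h4)))

end LaplaceMap

end G2Sphere

namespace G2Sphere

/-! ### Embedding of the homogeneous family, and an injectivity domain -/

section Embedding

open Filter Set

/-- The metric parameters of the `Sp(2)·Sp(1)`-invariant forms. -/
def homogeneousParameters : Set (ℝ × ℝ × ℝ × ℝ) :=
  {y | ∃ s t, 0 < s ∧ 0 < t ∧ y = (s, s, s ^ 2 / t, 0)}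

theorem laplaceMap_homogeneous {s t : ℝ} (hs : 0 < s) (ht : 0 < t) :
    laplaceMap (s, s, s ^ 2 / t, 0) =
      (24 * s * t * (t + 1), s * (24 * t + 4 + 4 / t), s * (24 * t + 4 + 4 / t), 0) := by
  have h : √(s ^ 2 * (s ^ 2 / t) ^ 2 - 0 ^ 2) = s ^ 3 / t := by
    rw [show s ^ 2 * (s ^ 2 / t) ^ 2 - 0 ^ 2 = (s ^ 3 / t) ^ 2 by ring, Real.sqrt_sq (by positivity)]
  simp only [laplaceMap, starDeriv, h, Prod.mk.injEq]
  refine ⟨?_, ?_, ?_, by ring⟩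
  · field_simp
    ring
  · field_simp
    ring
  · field_simp
    ring

theorem strictMonoOn_ratio :
    StrictMonoOn (fun t : ℝ => 6 * t ^ 2 * (t + 1) / (6 * t ^ 2 + t + 1)) (Ioi 0) := by
  intro x hx y hy hxy
  simp only [mem_Ioi] at hx hy
  simp only
  rw [div_lt_div_iff₀ (by positivity) (by positivity), ← sub_pos]
  have h : 0 < 6 * (y - x) * (6 * x ^ 2 * y ^ 2 + x * y * (x + y) + (x ^ 2 + x * y + y ^ 2) + x * y +
      (x + y)) := by
    have := sub_pos.mpr hxy
    positivity
  refine h.trans_eq ?_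
  ring

/-- This expresses that the inverse on the family is continuous: `t` is recovered from the ratio of
the first two components, a strictly increasing function, and then `s` from the first component. -/
theorem comap_laplaceMap_le {x : ℝ × ℝ × ℝ × ℝ} (hx : x ∈ homogeneousParameters) :
    comap laplaceMap (𝓝 (laplaceMap x)) ⊓ 𝓟 homogeneousParameters ≤ 𝓝 x := by
  obtain ⟨s, t, hs, ht, rfl⟩ := hx
  set l := comap laplaceMap (𝓝 (laplaceMap (s, s, s ^ 2 / t, 0))) ⊓ 𝓟 homogeneousParameters with hl
  have hF : Tendsto laplaceMap l (𝓝 (laplaceMap (s, s, s ^ 2 / t, 0))) :=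
    tendsto_comap.mono_left inf_le_left
  have hS : ∀ᶠ y in l, y ∈ homogeneousParameters := mem_inf_of_right (mem_principal_self _)
  rw [laplaceMap_homogeneous hs ht] at hF
  have hα : Tendsto (fun y => (laplaceMap y).1) l (𝓝 (24 * s * t * (t + 1))) :=
    (continuous_fst.tendsto _).comp hF
  have hβ : Tendsto (fun y => (laplaceMap y).2.1) l (𝓝 (s * (24 * t + 4 + 4 / t))) :=
    ((continuous_fst.comp continuous_snd).tendsto _).comp hF
  have hr := hα.div hβ (by positivity)
  set T : ℝ × ℝ × ℝ × ℝ → ℝ := fun y => y.1 ^ 2 / y.2.2.1 with hT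
  have hTS {a b : ℝ} (ha : 0 < a) (hb : 0 < b) : T (a, a, a ^ 2 / b, 0) = b := by
    simp only [hT]
    field_simp
  have hratio {a b : ℝ} (ha : 0 < a) (hb : 0 < b) :
      24 * a * b * (b + 1) / (a * (24 * b + 4 + 4 / b)) =
        6 * b ^ 2 * (b + 1) / (6 * b ^ 2 + b + 1) := by
    have h1 : 24 * b + 4 + 4 / b = 4 * (6 * b ^ 2 + b + 1) / b := by
      field_simp
      ring
    rw [h1]
    field_simp
    ring
  have hh : Tendsto (fun y => 6 * T y ^ 2 * (T y + 1) / (6 * T y ^ 2 + T y + 1)) l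
      (𝓝 (6 * t ^ 2 * (t + 1) / (6 * t ^ 2 + t + 1))) := by
    rw [hratio hs ht] at hr
    refine hr.congr' ?_
    filter_upwards [hS] with y hy
    obtain ⟨a, b, ha, hb, rfl⟩ := hy
    rw [hTS ha hb, Pi.div_apply, laplaceMap_homogeneous ha hb]
    exact hratio ha hb
  have hTpos : ∀ᶠ y in l, 0 < T y := by
    filter_upwards [hS] with y hy
    obtain ⟨a, b, ha, hb, rfl⟩ := hy
    rwa [hTS ha hb]
  have hTt : Tendsto T l (𝓝 t) := by
    refine tendsto_order.mpr ⟨fun a ha => ?_, fun a ha => ?_⟩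
    · rcases le_or_gt a 0 with h0 | h0
      · filter_upwards [hTpos] with y hy
        exact h0.trans_lt hy
      · filter_upwards [hTpos, (tendsto_order.mp hh).1 _ (strictMonoOn_ratio h0 ht ha)] with y hy hy'
        exact (strictMonoOn_ratio.lt_iff_lt h0 hy).mp hy'
    · filter_upwards [hTpos, (tendsto_order.mp hh).2 _ (strictMonoOn_ratio ht (ht.trans ha) ha)]
        with y hy hy'
      exact (strictMonoOn_ratio.lt_iff_lt hy (ht.trans ha)).mp hy'
  have hs' : Tendsto (fun y => (laplaceMap y).1 / (24 * T y * (T y + 1))) l (𝓝 s) := by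
    have h1 := hα.div ((hTt.const_mul 24).mul (hTt.add_const 1)) (by positivity)
    rwa [show 24 * s * t * (t + 1) / (24 * t * (t + 1)) = s by field_simp] at h1
  have h1 : Tendsto (fun y : ℝ × ℝ × ℝ × ℝ => y.1) l (𝓝 s) := by
    refine hs'.congr' ?_
    filter_upwards [hS] with y hy
    obtain ⟨a, b, ha, hb, rfl⟩ := hy
    rw [hTS ha hb, laplaceMap_homogeneous ha hb]
    field_simp
  have h2 := (h1.prodMk_nhds (h1.prodMk_nhds (((h1.pow 2).div hTt ht.ne').prodMk_nhds
    (tendsto_const_nhds (x := (0 : ℝ))))))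
  refine Tendsto.congr' (f₂ := id) ?_ h2
  filter_upwards [hS] with y hy
  obtain ⟨a, b, ha, hb, rfl⟩ := hy
  simp only [Pi.div_apply, hTS ha hb, id]

/-- The domain of the metric parameters of forms near the `Sp(2)·Sp(1)`-invariant ones. -/
def parameterDomain : Set (ℝ × ℝ × ℝ × ℝ) :=
  {y | 0 < y.1 ∧ 0 < y.2.1 ∧ 0 < y.2.2.1 ∧ 0 < y.2.1 ^ 2 * y.2.2.1 ^ 2 - y.2.2.2 ^ 2 ∧
    0 < y.1 * y.2.1 ^ 2 - y.1 * y.2.2.1 + 2 * √(y.2.1 ^ 2 * y.2.2.1 ^ 2 - y.2.2.2 ^ 2)}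

theorem isOpen_parameterDomain : IsOpen parameterDomain := by
  simp only [parameterDomain, ofPred_and]
  refine IsOpen.inter ?_ (IsOpen.inter ?_ (IsOpen.inter ?_ (IsOpen.inter ?_ ?_))) <;>
    exact isOpen_lt continuous_const (by fun_prop)

theorem homogeneousParameters_subset : homogeneousParameters ⊆ parameterDomain := by
  rintro y ⟨s, t, hs, ht, rfl⟩
  have h1 : s ^ 2 * (s ^ 2 / t) ^ 2 - 0 ^ 2 = (s ^ 3 / t) ^ 2 := by ring
  refine ⟨hs, hs, by positivity, ?_, ?_⟩
  · simp only [h1]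
    positivity
  · simp only [h1]
    rw [Real.sqrt_sq (by positivity), show s * s ^ 2 - s * (s ^ 2 / t) + 2 * (s ^ 3 / t) =
      s ^ 3 + s ^ 3 / t by ring]
    positivity

theorem exists_isOpen_injOn_laplaceMap : ∃ V ⊆ parameterDomain, IsOpen V ∧
    homogeneousParameters ⊆ V ∧ InjOn laplaceMap V := by
  have hc (y) (hy : y ∈ homogeneousParameters) : ContDiffAt ℝ 1 laplaceMap y := by
    obtain ⟨h1, h2, h3, h4, -⟩ := homogeneousParameters_subset hy
    exact contDiffAt_laplaceMap h1 h2 h3 h4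
  obtain ⟨V, hV, hSV, hinj⟩ := exists_isOpen_injOn (fun y hy => (hc y hy).continuousAt)
    (fun y hy => exists_mem_nhds_injOn (hc y hy) (by
      obtain ⟨s, t, hs, ht, rfl⟩ := hy
      exact fun d hd => laplaceMap_linearization hs ht d hd))
    (fun y hy => comap_laplaceMap_le hy)
  exact ⟨V ∩ parameterDomain, inter_subset_right, hV.inter isOpen_parameterDomain,
    subset_inter hSV homogeneousParameters_subset, hinj.mono inter_subset_left⟩

/-- The last condition of the domain makes the second entry of the inner `starDeriv` positive, and
the third always is. This later separates `φ` from forms of the opposite sign. -/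
theorem laplaceMap_fst_pos {y : ℝ × ℝ × ℝ × ℝ} (hy : y ∈ parameterDomain) :
    0 < (laplaceMap y).1 := by
  obtain ⟨h1, h2, h3, h4, h5⟩ := hy
  simp only [laplaceMap, starDeriv]
  have h6 : 0 < 2 * (y.1 * y.2.1 ^ 2) - 2 * (y.1 * y.2.2.1) +
      4 * √(y.2.1 ^ 2 * y.2.2.1 ^ 2 - y.2.2.2 ^ 2) := by linarith
  positivity

end Embedding

end G2Sphere

namespace G2Sphere

/-! ### Transfer from parameters to invariant forms -/

section Coordinates

open Filter Set

/-- The four components that determine an invariant 3-form. -/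
noncomputable def coordinates (φ : SForm 3) : ℝ × ℝ × ℝ × ℝ :=
  (φ.comp 7, φ.comp 25, φ.comp 42, φ.comp 74)

theorem continuous_comp_indexMask {j : Fin 3 → Fin 7} (hj : StrictMono j) :
    Continuous fun φ : SForm 3 => φ.comp (indexMask j) := by
  simp only [SForm.comp_indexMask _ hj]
  exact (continuous_eval_const (F := TS basePoint [⋀^Fin 3]→L[ℝ] ℝ) _).comp
    (continuous_apply basePoint)

theorem continuous_coordinates : Continuous coordinates := by
  have h (j : Fin 3 → Fin 7) (m : ℕ) (hj : (∀ a b, a < b → j a < j b) ∧ indexMask j = m) :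
      Continuous fun φ : SForm 3 => φ.comp m := by
    rw [← hj.2]
    exact continuous_comp_indexMask fun a b => hj.1 a b
  exact (h ![0, 1, 2] 7 (by decide)).prodMk ((h ![0, 3, 4] 25 (by decide)).prodMk
    ((h ![1, 3, 5] 42 (by decide)).prodMk (h ![1, 3, 6] 74 (by decide))))

/-- The metric parameters in terms of the components. -/
noncomputable def parameters (x : ℝ × ℝ × ℝ × ℝ) : ℝ × ℝ × ℝ × ℝ :=
  let p := (x.1 * x.2.1 ^ 2 / (x.2.2.1 ^ 2 + x.2.2.2 ^ 2)) ^ (((3 : ℕ) : ℝ)⁻¹)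
  (p, √(x.1 / p), x.2.1 / p, x.2.2.2)

/-- The point is the identity `a b² / (c² + e²) = p³`, which recovers `p` first. -/
theorem parameters_eq {p q R c e : ℝ} (hp : 0 < p) (hq : 0 < q) (hR : 0 < R)
    (h : c ^ 2 + e ^ 2 = q ^ 2 * R ^ 2) : parameters (p * q ^ 2, p * R, c, e) = (p, q, R, e) := by
  have h1 : (p * q ^ 2 * (p * R) ^ 2 / (c ^ 2 + e ^ 2)) ^ (((3 : ℕ) : ℝ)⁻¹) = p := by
    rw [h, show p * q ^ 2 * (p * R) ^ 2 / (q ^ 2 * R ^ 2) = p ^ 3 by field_simp]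
    exact Real.pow_rpow_inv_natCast hp.le (by norm_num)
  simp only [parameters, h1, Prod.mk.injEq, true_and, and_true]
  constructor
  · rw [mul_div_cancel_left₀ _ hp.ne', Real.sqrt_sq hq.le]
  · rw [mul_div_cancel_left₀ _ hp.ne']

theorem continuousOn_parameters :
    ContinuousOn parameters {x | 0 < x.1 ∧ 0 < x.2.1 ∧ 0 < x.2.2.1} := by
  rintro x ⟨h1, h2, h3⟩
  apply ContinuousAt.continuousWithinAt
  have h4 : x.2.2.1 ^ 2 + x.2.2.2 ^ 2 ≠ 0 := by positivity
  have h5 : ContinuousAt (fun x : ℝ × ℝ × ℝ × ℝ =>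
      (x.1 * x.2.1 ^ 2 / (x.2.2.1 ^ 2 + x.2.2.2 ^ 2)) ^ (((3 : ℕ) : ℝ)⁻¹)) x :=
    ContinuousAt.rpow_const (by fun_prop (disch := assumption)) (Or.inr (by positivity))
  have h6 : (x.1 * x.2.1 ^ 2 / (x.2.2.1 ^ 2 + x.2.2.2 ^ 2)) ^ (((3 : ℕ) : ℝ)⁻¹) ≠ 0 := by positivity
  exact h5.prodMk ((Real.continuous_sqrt.continuousAt.comp (continuousAt_fst.div h5 h6)).prodMk
    (((continuous_fst.comp continuous_snd).continuousAt.div h5 h6).prodMk (by fun_prop)))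

/-- The components with parameters in `V`. -/
def chart (V : Set (ℝ × ℝ × ℝ × ℝ)) : Set (ℝ × ℝ × ℝ × ℝ) :=
  {x | 0 < x.1 ∧ 0 < x.2.1 ∧ 0 < x.2.2.1} ∩ parameters ⁻¹' V

theorem isOpen_chart {V : Set (ℝ × ℝ × ℝ × ℝ)} (hV : IsOpen V) : IsOpen (chart V) := by
  refine continuousOn_parameters.isOpen_inter_preimage ?_ hV
  simp only [ofPred_and]
  refine IsOpen.inter ?_ (IsOpen.inter ?_ ?_) <;> exact isOpen_lt continuous_const (by fun_prop)

theorem starDeriv_smul (p q R r a b c : ℝ) :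
    starDeriv p q R (r * a) (r * b) (r * c) = r • starDeriv p q R a b c := by
  simp only [starDeriv, Prod.smul_mk, smul_eq_mul, Prod.mk.injEq]
  refine ⟨by ring, by ring, by ring⟩

theorem HasMetric.parameters_coordinates {φ : SForm 3} {σ s p q R : ℝ}
    (H : HasMetric φ σ s p q R) : parameters (s • coordinates φ) = (p, q, R, s * φ.comp 74) := by
  have hs := H.sq_sign
  have h1 : s • coordinates φ = (p * q ^ 2, p * R, s * φ.comp 42, s * φ.comp 74) := by
    simp only [coordinates, Prod.smul_mk, smul_eq_mul, H.comp_vertical, H.comp_mixed, ← mul_assoc,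
      hs, one_mul]
  rw [h1]
  refine parameters_eq H.p_pos H.q_pos H.R_pos ?_
  rw [← H.comp_sq_add]
  linear_combination (φ.comp 42 ^ 2 + φ.comp 74 ^ 2) * hs

/-- The components in terms of the metric parameters. -/
noncomputable def components (y : ℝ × ℝ × ℝ × ℝ) : ℝ × ℝ × ℝ × ℝ :=
  (y.1 * y.2.1 ^ 2, y.1 * y.2.2.1, √(y.2.1 ^ 2 * y.2.2.1 ^ 2 - y.2.2.2 ^ 2), y.2.2.2)

theorem laplaceMap_parameters {φ : SForm 3} (hφ : φ.IsInvariant Sp2U1) (hp : φ.IsPositive) {r : ℝ}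
    (hr : r * r = 1) {V : Set (ℝ × ℝ × ℝ × ℝ)} (h : r • coordinates φ ∈ chart V) :
    r • coordinates (SForm.g2Laplacian φ) = laplaceMap (parameters (r • coordinates φ)) ∧
      r • coordinates φ = components (parameters (r • coordinates φ)) := by
  obtain ⟨σ, s, p, q, R, H⟩ := exists_hasMetric hφ (hp basePoint)
  have hs := H.sq_sign
  have hpq : 0 < p * q ^ 2 := mul_pos H.p_pos (pow_pos H.q_pos 2)
  -- Membership in the chart makes `r a` positive while `a = s p q²`, so the two signs agree.
  obtain rfl : r = s := by
    have h1 : 0 < r * (s * (p * q ^ 2)) := by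
      rw [← H.comp_vertical]
      exact h.1.1
    have h2 : 0 < r * s := by
      rw [← mul_assoc] at h1
      exact (pos_iff_pos_of_mul_pos h1).mpr hpq
    have h3 : (r * s - 1) * (r * s + 1) = 0 := by linear_combination s * s * hr + hs
    have h4 : r * s = 1 := by
      rcases mul_eq_zero.mp h3 with h | h
      · linarith
      · linarith
    linear_combination s * h4 - r * hs
  have h42 : 0 < r * φ.comp 42 := h.1.2.2
  rw [H.parameters_coordinates]
  have hc : √(q ^ 2 * R ^ 2 - (r * φ.comp 74) ^ 2) = r * φ.comp 42 := by
    rw [show q ^ 2 * R ^ 2 - (r * φ.comp 74) ^ 2 = (r * φ.comp 42) ^ 2 by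
      rw [← H.comp_sq_add]
      linear_combination (-(φ.comp 42 ^ 2 + φ.comp 74 ^ 2)) * hs, Real.sqrt_sq h42.le]
  have ha : p * q ^ 2 = r * φ.comp 7 := by
    rw [H.comp_vertical, ← mul_assoc, hs, one_mul]
  have hb : p * R = r * φ.comp 25 := by
    rw [H.comp_mixed, ← mul_assoc, hs, one_mul]
  constructor
  · obtain ⟨a, b, c, h1, h2, h3⟩ := H.comp_g2Laplacian hφ
    simp only [laplaceMap, hc, ha, hb, starDeriv_smul, ← h1, Prod.smul_mk, smul_eq_mul, ← h2]
    simp only [coordinates, Prod.smul_mk, smul_eq_mul, h3, Prod.mk.injEq, true_and]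
    ring
  · simp only [components, hc, ha, hb]
    rfl

theorem smul_coordinates_mem_chart {φ : SForm 3} (hφ : φ.IsInvariant Sp2U1)
    (h : φ.IsInvariant Sp2Sp1) (hp : φ.IsPositive) {V : Set (ℝ × ℝ × ℝ × ℝ)}
    (hV : homogeneousParameters ⊆ V) : ∃ r : ℝ, r * r = 1 ∧ r • coordinates φ ∈ chart V := by
  obtain ⟨σ, s, p, q, R, H⟩ := exists_hasMetric hφ (hp basePoint)
  obtain ⟨h1, h2⟩ := SForm.comp_of_Sp2Sp1 hφ h
  have hs := H.sq_sign
  have hp := H.p_pos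
  have hq := H.q_pos
  have hR := H.R_pos
  have hpq : p = q := by
    have h3 := H.comp_sq_add
    rw [h1, h2, H.comp_mixed] at h3
    have h4 : p ^ 2 * R ^ 2 = q ^ 2 * R ^ 2 := by linear_combination h3 - p ^ 2 * R ^ 2 * hs
    have h5 := mul_right_cancel₀ (pow_ne_zero 2 hR.ne') h4
    exact (sq_eq_sq₀ hp.le hq.le).mp h5
  subst hpq
  refine ⟨s, hs, ⟨?_, ?_, ?_⟩, ?_⟩
  · change 0 < s * φ.comp 7
    rw [H.comp_vertical, ← mul_assoc, hs, one_mul]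
    positivity
  · change 0 < s * φ.comp 25
    rw [H.comp_mixed, ← mul_assoc, hs, one_mul]
    positivity
  · change 0 < s * φ.comp 42
    rw [h1, H.comp_mixed, ← mul_assoc, hs, one_mul]
    positivity
  · apply hV
    rw [H.parameters_coordinates, h2, mul_zero]
    -- The parameter is `t = p² / R`, so that `s² / t` gives back `R`.
    refine ⟨p, p ^ 2 / R, hp, by positivity, ?_⟩
    rw [div_div_cancel₀ (by positivity)]

theorem eq_of_g2Laplacian_eq {V : Set (ℝ × ℝ × ℝ × ℝ)} (hV : V ⊆ parameterDomain)
    (hinj : InjOn laplaceMap V) {φ ψ : SForm 3} (hφ : φ ∈ invariantPositiveForms Sp2U1)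
    (hψ : ψ ∈ invariantPositiveForms Sp2U1) {r r' : ℝ} (hr : r * r = 1) (hr' : r' * r' = 1)
    (h : r • coordinates φ ∈ chart V) (h' : r' • coordinates ψ ∈ chart V)
    (heq : SForm.g2Laplacian φ = SForm.g2Laplacian ψ) : φ = ψ := by
  obtain ⟨h1, h2⟩ := laplaceMap_parameters hφ.2.1 hφ.2.2 hr h
  obtain ⟨h3, h4⟩ := laplaceMap_parameters hψ.2.1 hψ.2.2 hr' h'
  have p1 := laplaceMap_fst_pos (hV h.2)
  have p2 := laplaceMap_fst_pos (hV h'.2)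
  rw [← h1] at p1
  rw [← h3, ← heq] at p2
  -- Equal Laplacians have first components of the same sign, and that sign is `r` for `φ` and `r'`
  -- for `ψ`.
  have hrr : r' = r := by
    rcases mul_self_eq_one_iff.mp hr with rfl | rfl <;>
      rcases mul_self_eq_one_iff.mp hr' with rfl | rfl
    · rfl
    · simp only [Prod.smul_fst, smul_eq_mul] at p1 p2
      linarith
    · simp only [Prod.smul_fst, smul_eq_mul] at p1 p2
      linarith
    · rfl
  subst hrr
  have h5 := hinj h.2 h'.2 (by rw [← h1, ← h3, heq])
  have h6 : r' • coordinates φ = r' • coordinates ψ := by rw [h2, h4, h5]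
  have h7 : coordinates φ = coordinates ψ := by
    have := congrArg (fun x => r' • x) h6
    simpa only [smul_smul, hr, one_smul] using this
  refine SForm.eq_of_eq_basePoint hφ.2.1 hψ.2.1 (SForm.eq_basePoint hφ.2.1 hψ.2.1 ?_)
  simp only [coordinates, Prod.mk.injEq] at h7
  simpa using h7

end Coordinates

end G2Sphere

theorem mainTheorem5 :
    ∃ U : Set (invariantPositiveForms Sp2U1),
      IsOpen U ∧
      (∀ φ : invariantPositiveForms Sp2U1, (φ : SForm 3) ∈ invariantPositiveForms Sp2Sp1 → φ ∈ U) ∧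
      Set.BijOn (fun φ : invariantPositiveForms Sp2U1 => SForm.g2Laplacian (φ : SForm 3)) U
        ((fun φ : invariantPositiveForms Sp2U1 => SForm.g2Laplacian (φ : SForm 3)) '' U) := by
  obtain ⟨V, hVd, hV, hSV, hinj⟩ := exists_isOpen_injOn_laplaceMap
  -- The union runs over `r = 1` and `r = -1`, the two sheets of forms.
  refine ⟨⋃ r ∈ {r : ℝ | r * r = 1}, (fun φ : invariantPositiveForms Sp2U1 =>
    r • coordinates (φ : SForm 3)) ⁻¹' chart V, ?_, fun φ hφ => ?_, Set.InjOn.bijOn_image ?_⟩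
  · refine isOpen_biUnion fun r _ => (isOpen_chart hV).preimage ?_
    exact (continuous_coordinates.comp continuous_subtype_val).const_smul r
  · obtain ⟨r, hr, h⟩ := smul_coordinates_mem_chart φ.2.2.1 hφ.2.1 hφ.2.2 hSV
    exact Set.mem_biUnion hr h
  · intro φ hφ ψ hψ heq
    obtain ⟨r, hr, h⟩ := Set.mem_iUnion₂.mp hφ
    obtain ⟨r', hr', h'⟩ := Set.mem_iUnion₂.mp hψ
    exact Subtype.ext (eq_of_g2Laplacian_eq hVd hinj φ.2 ψ.2 hr hr' h h' heq)
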